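/- **Setting.** Let $n$ be the number of virtual pages, $[n]$ the set of pages, and $k\ge 1$ the number of slots of the real memory. A deterministic online paging strategy maintains a set of at most $k$ pages, initially empty; after each request the requested page is in the set, no other page may be brought in, and the set depends only on the sequence of pages requested so far. A request of a page that is not in the set is a fault. A randomized online strategy is a probability distribution on deterministic ones. $\mathrm{OPT}(k,\sigma)$ is the least number of faults with which $\sigma$ can be served offline with $k$ slots. An *extended access graph* on $[n]$ is a finite undirected graph $G$ with a labeling $\ell$ of its vertices by pages. Its request sequences are the sequences $\ell(v_1),\dots,\ell(v_m)$ with $v_{i+1}=v_i$ or $v_iv_{i+1}\in E(G)$, where $v_1$ is arbitrary; strategies see only the pages. $\Delta(G)\in\mathbb N\cup\{\infty\}$ is the least length of a walk between two different vertices with the same label. For a strategy $S$ let $r_S(G,k)$ be the infimum of all $r$ such that $E[S(\sigma)]\le r\,\mathrm{OPT}(k,\sigma)$ for every request sequence $\sigma$ of $G$, where $S(\sigma)$ is the number of faults, and let $r_S^\infty(G,k)$ be the infimum of all $r$ such that, for some constant $b\geq 0$, $E[S(\sigma)]\le r\,\mathrm{OPT}(k,\sigma)+b$ for every such $\sigma$.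 Let $r(G,k)$ and $r^\infty(G,k)$ be the infima of these ratios over all deterministic strategies, and $r_{\mathsf{obl}}(G,k)$ and $r^\infty_{\mathsf{obl}}(G,k)$ those over all randomized strategies. An algorithm $A$ assigns to each $(n,k,G)$ a strategy; its ratio on $G$ is denoted by $r_A(G,k)$. It is *truly online* if, for any two extended access graphs on the same set of pages, every $k$ and every common request sequence $\sigma$, the two strategies have the same behavior (in the randomized case: the same distribution of behavior) on $\sigma$. $A$ is *very strongly competitive* on a class of pairs $(G,k)$ if there are $b_1,b_2\ge0$ with $r_A(G,k)\le b_1 r^\infty(G,k)+b_2$ (for randomized $A$: $\le b_1r^\infty_{\mathsf{obl}}(G,k)+b_2$) for all pairs of the class. **Theorem.** There are absolute constants $c,C>0$ with the following properties. 1. For all integers $0<f<k<n$ and every deterministic truly online algorithm $A$ there is an extended access graph $G$ on $[n]$ with $\Delta(G)\ge k-f+1$, $r_A(G,k)\ge f$ and $r(G,k)\le C\log k$. In particular, for $f=f(k)=\omega(\log k)$ (with $0<f(k)<k$) such graphs $G=G_{k,n}$ can be chosen for all $n>k$ so that $r_A(G_{k,n},k)=\omega(r(G_{k,n},k))$ as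 $k\to\infty$, uniformly in $n>k$. 2. For all integers $0<f<k<n$ and every randomized truly online algorithm $A$ there is an extended access graph $G$ on $[n]$ with $\Delta(G)\ge k-f-1$, $r_A(G,k)\ge c\log f$ and $r_{\mathsf{obl}}(G,k)\le C(\log k-\log f+\log\log f)$, where $\log\log 1$ is read as $0$. In particular, for $f=f(k)=k^{1-o(1)}$ (with $0<f(k)<k$) such graphs $G=G_{k,n}$ can be chosen for all $n>k$ so that $r_A(G_{k,n},k)=\omega(r_{\mathsf{obl}}(G_{k,n},k))$ as $k\to\infty$, uniformly in $n>k$. 3. Consequently, there is a function $g(k)=o(k)$ such that no truly online algorithm, deterministic or randomized, is very strongly competitive on any class that contains all pairs $(G,k)$ with $\Delta(G)\ge k-g(k)$. -/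

import Mathlib

open Filter MeasureTheory Asymptotics
open scoped ENNReal NNReal

namespace Paging

/-- An extended access graph on the set of pages `P`: a finite undirected graph whose vertices are
labeled by pages; several vertices may carry the same page. -/
structure ExtGraph (P : Type) where
  V : Type
  finite : Finite V
  graph : SimpleGraph V
  label : V → P

/-- The request sequences of `G`: the label sequences of finite sequences of vertices in which each
vertex is equal or adjacent to its predecessor. The first vertex is arbitrary. -/
def ExtGraph.requests {P : Type} (G : ExtGraph P) : Set (List P) :=
  {σ | ∃ vs : List G.V, vs.IsChain (fun u v => u = v ∨ G.graph.Adj u v) ∧ σ = vs.map G.label}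

/-- `Δ(G)`: the least number of edges of a walk between two different vertices that carry the same
page (`⊤` if there is no such walk). -/
noncomputable def ExtGraph.Delta {P : Type} (G : ExtGraph P) : ℕ∞ :=
  ⨅ (u : G.V) (v : G.V) (_ : u ≠ v) (_ : G.label u = G.label v) (w : G.graph.Walk u v),
    (w.length : ℕ∞)

/-- A deterministic online paging strategy with `k` page slots: `cache σ` is the content of the real
memory after the requests `σ` (in chronological order) have been served. The memory is empty at the
beginning, a requested page has to be brought in, and no other page may be brought in. -/
@[ext]
structure DetAlg (P : Type) [DecidableEq P] (k : ℕ) where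
  cache : List P → Finset P
  cache_nil : cache [] = ∅
  card_le : ∀ σ, (cache σ).card ≤ k
  mem_cache : ∀ σ p, p ∈ cache (σ ++ [p])
  cache_subset : ∀ σ p, cache (σ ++ [p]) ⊆ insert p (cache σ)

/-- The number of page faults on `σ`: the requests whose page is not in the memory. -/
def DetAlg.faults {P : Type} [DecidableEq P] {k : ℕ} (a : DetAlg P k) (σ : List P) : ℕ :=
  ∑ i : Fin σ.length, if σ[i] ∈ a.cache (σ.take i) then 0 else 1

/-- The behavior of a strategy on `σ`: the successive contents of the real memory. -/
def DetAlg.run {P : Type} [DecidableEq P] {k : ℕ} (a : DetAlg P k) (σ : List P) :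
    List (Finset P) :=
  σ.inits.map a.cache

/-- The `σ`-algebra on strategies generated by the events `cache σ = C`. -/
instance {P : Type} [DecidableEq P] {k : ℕ} : MeasurableSpace (DetAlg P k) :=
  ⨆ σ : List P, MeasurableSpace.comap (fun a : DetAlg P k => a.cache σ) ⊤

/-- A randomized online paging strategy: a probability distribution on deterministic ones. -/
abbrev RandAlg (P : Type) [DecidableEq P] (k : ℕ) := ProbabilityMeasure (DetAlg P k)

/-- `Serves k C σ m`: starting with memory content `C`, the sequence `σ` can be served with `k` page
slots (by an offline algorithm) at a cost of `m` page faults. -/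
inductive Serves {P : Type} [DecidableEq P] (k : ℕ) : Finset P → List P → ℕ → Prop
  | nil (C : Finset P) : Serves k C [] 0
  | cons (C C' : Finset P) (p : P) (σ : List P) (m : ℕ) (hp : p ∈ C') (hC : C' ⊆ insert p C)
      (hk : C'.card ≤ k) (h : Serves k C' σ m) :
      Serves k C (p :: σ) ((if p ∈ C then 0 else 1) + m)

/-- The offline optimum `OPT(k, σ)`, starting with no pages in memory. -/
noncomputable def opt {P : Type} [DecidableEq P] (k : ℕ) (σ : List P) : ℕ :=
  sInf {m | Serves k ∅ σ m}

/-- The cost function of a deterministic strategy. -/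
def detCost {P : Type} [DecidableEq P] {k : ℕ} (a : DetAlg P k) (σ : List P) : ℝ≥0∞ :=
  (a.faults σ : ℝ≥0∞)

/-- The expected cost of a randomized strategy on a fixed sequence (oblivious adversary). -/
noncomputable def randCost {P : Type} [DecidableEq P] {k : ℕ} (μ : RandAlg P k) (σ : List P) :
    ℝ≥0∞ :=
  ∫⁻ a, (a.faults σ : ℝ≥0∞) ∂(μ : Measure (DetAlg P k))

/-- The strict competitive ratio on `G` of a strategy with the given (expected) cost function. -/
noncomputable def ratio {P : Type} [DecidableEq P] (G : ExtGraph P) (k : ℕ)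
    (cost : List P → ℝ≥0∞) : ℝ≥0∞ :=
  sInf {r | ∀ σ ∈ G.requests, cost σ ≤ r * (opt k σ : ℝ≥0∞)}

/-- The asymptotic competitive ratio on `G` of a strategy with the given cost function. -/
noncomputable def asympRatio {P : Type} [DecidableEq P] (G : ExtGraph P) (k : ℕ)
    (cost : List P → ℝ≥0∞) : ℝ≥0∞ :=
  sInf {r | ∃ b : ℝ≥0, ∀ σ ∈ G.requests, cost σ ≤ r * (opt k σ : ℝ≥0∞) + b}

/-- `r(G, k)`. -/
noncomputable def detRatio {P : Type} [DecidableEq P] (G : ExtGraph P) (k : ℕ) : ℝ≥0∞ :=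
  ⨅ a : DetAlg P k, ratio G k (detCost a)

/-- `r_obl(G, k)`. -/
noncomputable def oblRatio {P : Type} [DecidableEq P] (G : ExtGraph P) (k : ℕ) : ℝ≥0∞ :=
  ⨅ μ : RandAlg P k, ratio G k (randCost μ)

/-- `r^∞(G, k)`. -/
noncomputable def detRatioInf {P : Type} [DecidableEq P] (G : ExtGraph P) (k : ℕ) : ℝ≥0∞ :=
  ⨅ a : DetAlg P k, asympRatio G k (detCost a)

/-- `r^∞_obl(G, k)`. -/
noncomputable def oblRatioInf {P : Type} [DecidableEq P] (G : ExtGraph P) (k : ℕ) : ℝ≥0∞ :=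
  ⨅ μ : RandAlg P k, asympRatio G k (randCost μ)

/-- A deterministic algorithm that assigns to each access graph a strategy is truly online if the
strategies for two graphs on the same pages behave identically on all common request sequences. -/
def TrulyOnline {P : Type} [DecidableEq P] {k : ℕ} (A : ExtGraph P → DetAlg P k) : Prop :=
  ∀ G₁ G₂ : ExtGraph P, ∀ σ ∈ G₁.requests ∩ G₂.requests, (A G₁).run σ = (A G₂).run σ

/-- The same for randomized algorithms: the behavior on a common request sequence has the same
distribution for both graphs. -/
def RandTrulyOnline {P : Type} [DecidableEq P] {k : ℕ} (A : ExtGraph P → RandAlg P k) : Prop :=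
  ∀ G₁ G₂ : ExtGraph P, ∀ σ ∈ G₁.requests ∩ G₂.requests, ∀ E : Set (List (Finset P)),
    (A G₁ : Measure (DetAlg P k)) {a | a.run σ ∈ E} =
      (A G₂ : Measure (DetAlg P k)) {a | a.run σ ∈ E}

/-- A deterministic uniform algorithm: a strategy for each number `n` of virtual pages, each number
`k ≥ 1` of page slots and each extended access graph. -/
abbrev DetUniform := ∀ n k : ℕ, 0 < k → ExtGraph (Fin n) → DetAlg (Fin n) k

/-- A randomized uniform algorithm. -/
abbrev RandUniform := ∀ n k : ℕ, 0 < k → ExtGraph (Fin n) → RandAlg (Fin n) k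

/-- `A` is very strongly competitive on the class `𝒞` of paging problems `(G, k)`: its strict ratio
is at most a fixed linear function of the asymptotic deterministic ratio of the problem. -/
def VeryStronglyCompetitive (A : DetUniform) (𝒞 : ∀ n : ℕ, ℕ → Set (ExtGraph (Fin n))) : Prop :=
  ∃ b₁ b₂ : ℝ≥0, ∀ (n k : ℕ) (hk : 0 < k), ∀ G ∈ 𝒞 n k,
    ratio G k (detCost (A n k hk G)) ≤ b₁ * detRatioInf G k + b₂

/-- The same for randomized algorithms. -/
def RandVeryStronglyCompetitive (A : RandUniform) (𝒞 : ∀ n : ℕ, ℕ → Set (ExtGraph (Fin n))) :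
    Prop :=
  ∃ b₁ b₂ : ℝ≥0, ∀ (n k : ℕ) (hk : 0 < k), ∀ G ∈ 𝒞 n k,
    ratio G k (randCost (A n k hk G)) ≤ b₁ * oblRatioInf G k + b₂

end Paging

/-!
A truly online algorithm cannot see the graph, so on every request sequence it behaves as it does on
the complete graph. The adversary can therefore play against this one strategy first and choose the
graph afterwards. The graph is a path made of cells of `k` vertices: the labels of a cell are the
first `f` entries of a permutation of `f + 1` pages, followed by `k - f` further pages that are the
same in every cell. Before each new vertex the adversary goes back over recently requested pages,
all but the entries of the permutation that have not been requested yet. Unless this already causes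
a fault, one of these entries is missing from the memory, and an exchange of two of them makes it
the next one. So each cell costs the algorithm `f` faults. For a randomized algorithm and random
permutations, the `j`-th entry of a cell (counted from `0`) causes a fault with probability at least
`1 / (f + 1 - j)`, hence a cell costs about `log f`. Offline, one fault per cell suffices, apart
from the first `k`.

The upper bounds concern strategies that know the path but not the first vertex. Among the `k + 1`
pages there is always one that is requested early in the phase from at most half of the possible
starting positions. If it is evicted, its request halves the number of these positions or reveals a
quarter of the pages not yet requested in the phase, so a phase has `O(log k)` faults. Once the
start is known, a phase on random blocks costs only `O(log (log f))` faults: the pages to be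
searched are first entries of one permutation that are last entries of another, with high
probability these sets have about their expected size, and bisection reduces them quickly. Almost
all permutations are good neighbors of a given one in this sense, so the cells can be chosen one
after another such that each of them is both good and costly for the algorithm.
-/

namespace Paging

section Strategies

variable {P : Type} [DecidableEq P] {k : ℕ}

namespace DetAlg

@[simp]
lemma faults_nil (a : DetAlg P k) : a.faults [] = 0 := by
  simp [faults]

lemma faults_append_singleton (a : DetAlg P k) (σ : List P) (p : P) :
    a.faults (σ ++ [p]) = a.faults σ + if p ∈ a.cache σ then 0 else 1 := by
  have faults_eq_sum_range : ∀ τ : List P, a.faults τ =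
      ∑ i ∈ Finset.range τ.length, if τ.getD i p ∈ a.cache (τ.take i) then 0 else 1 := by
    intro τ
    rw [faults, Finset.sum_range]
    exact Finset.sum_congr rfl fun i _ => by simp
  rw [faults_eq_sum_range, faults_eq_sum_range, List.length_append, List.length_singleton,
    Finset.sum_range_succ]
  congr 1
  · refine Finset.sum_congr rfl fun i hi => ?_
    have hi := Finset.mem_range.1 hi
    rw [List.getD_append _ _ _ _ hi, List.take_append_of_le_length hi.le]
  · simp

lemma faults_le_append (a : DetAlg P k) (σ τ : List P) : a.faults σ ≤ a.faults (σ ++ τ) := by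
  induction τ using List.reverseRecOn with
  | nil => simp
  | append_singleton τ p ih =>
    rw [← List.append_assoc, faults_append_singleton]
    omega

lemma notMem_cache_append {a : DetAlg P k} {σ τ : List P} {q : P} (hq : q ∉ a.cache σ)
    (hτ : q ∉ τ) : q ∉ a.cache (σ ++ τ) := by
  induction τ using List.reverseRecOn with
  | nil => simpa using hq
  | append_singleton τ p ih =>
    rw [List.mem_append, List.mem_singleton, not_or] at hτ
    rw [← List.append_assoc]
    intro h
    exact (Finset.mem_insert.1 (a.cache_subset _ _ h)).elim hτ.2 (ih hτ.1)

lemma faults_lt_of_notMem {a : DetAlg P k} {σ τ : List P} {q : P} (hq : q ∉ a.cache σ)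
    (hτ : q ∈ τ) : a.faults σ < a.faults (σ ++ τ) := by
  induction τ using List.reverseRecOn with
  | nil => simp at hτ
  | append_singleton τ p ih =>
    rw [← List.append_assoc, faults_append_singleton]
    by_cases h : q ∈ τ
    · exact (ih h).trans_le (Nat.le_add_right _ _)
    · obtain rfl : q = p := by simpa [h] using hτ
      rw [if_neg (notMem_cache_append hq h)]
      exact Nat.lt_succ_of_le (a.faults_le_append σ τ)

lemma exists_faults_lt (a : DetAlg P k) (σ τ : List P) {Q R : Finset P} (hQ : k < Q.card)
    (hR : R.Nonempty) (hcover : ∀ q ∈ Q, q ∈ τ ∨ q ∈ R) :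
    ∃ p ∈ R, a.faults σ < a.faults (σ ++ (τ ++ [p])) := by
  obtain ⟨q, hqQ, hq⟩ : ∃ q ∈ Q, q ∉ a.cache σ :=
    Finset.exists_mem_notMem_of_card_lt_card ((a.card_le σ).trans_lt hQ)
  rcases hcover q hqQ with h | h
  · obtain ⟨p, hp⟩ := hR
    exact ⟨p, hp, faults_lt_of_notMem hq (by simp [h])⟩
  · exact ⟨q, h, faults_lt_of_notMem hq (by simp)⟩

lemma getLast?_run (a : DetAlg P k) (σ : List P) : (a.run σ).getLast? = some (a.cache σ) := by
  induction σ using List.reverseRecOn with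
  | nil => simp [run]
  | append_singleton σ p _ => simp [run, List.inits_append]

end DetAlg

lemma measurableSet_cache_mem (σ : List P) (S : Set (Finset P)) :
    MeasurableSet {a : DetAlg P k | a.cache σ ∈ S} :=
  le_iSup (fun σ : List P => MeasurableSpace.comap (fun a : DetAlg P k => a.cache σ) ⊤) σ _
    ⟨S, trivial, rfl⟩

lemma measurable_faults (σ : List P) : Measurable fun a : DetAlg P k => a.faults σ := by
  induction σ using List.reverseRecOn with
  | nil => simp
  | append_singleton σ p ih =>
    simp only [DetAlg.faults_append_singleton]
    exact ih.add ((measurable_const).ite (measurableSet_cache_mem σ {C | p ∈ C}) measurable_const)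

lemma measurable_detCost (σ : List P) : Measurable fun a : DetAlg P k => detCost a σ :=
  (measurable_from_top (f := fun n : ℕ => (n : ℝ≥0∞))).comp (measurable_faults σ)

@[simp]
lemma randCost_nil (μ : RandAlg P k) : randCost μ [] = 0 := by
  simp [randCost]

lemma randCost_append_singleton (μ : RandAlg P k) (σ : List P) (p : P) :
    randCost μ (σ ++ [p]) =
      randCost μ σ + (μ : Measure (DetAlg P k)) {a | p ∉ a.cache σ} := by
  have cost_append : ∀ a : DetAlg P k, (a.faults (σ ++ [p]) : ℝ≥0∞) =
      detCost a σ + {a : DetAlg P k | p ∉ a.cache σ}.indicator 1 a := by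
    intro a
    rw [DetAlg.faults_append_singleton, detCost]
    by_cases hp : p ∈ a.cache σ <;> simp [hp]
  simp only [randCost, cost_append]
  rw [lintegral_add_left (measurable_detCost σ), lintegral_indicator_one]
  · rfl
  · exact measurableSet_cache_mem σ {C | p ∉ C}

lemma randCost_add_measure_faults_lt_le (μ : RandAlg P k) (σ τ : List P) :
    randCost μ σ + (μ : Measure (DetAlg P k)) {a | a.faults σ < a.faults (σ ++ τ)} ≤
      randCost μ (σ ++ τ) := by
  have hmeas : MeasurableSet {a : DetAlg P k | a.faults σ < a.faults (σ ++ τ)} :=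
    measurableSet_lt (measurable_faults _) (measurable_faults _)
  have hmeas' : Measurable fun a : DetAlg P k => (a.faults σ : ℝ≥0∞) := measurable_detCost σ
  rw [randCost, ← lintegral_indicator_one hmeas, ← lintegral_add_left hmeas']
  refine lintegral_mono fun a => ?_
  by_cases h : a.faults σ < a.faults (σ ++ τ)
  · simp only [Set.indicator, Set.mem_ofPred_eq, h, if_true, Pi.one_apply]
    exact_mod_cast h
  · simp only [Set.indicator, Set.mem_ofPred_eq, h, if_false, add_zero]
    exact_mod_cast a.faults_le_append σ τ

end Strategies

section Ratios

variable {P : Type} [DecidableEq P] {k : ℕ}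

lemma le_ratio {G : ExtGraph P} {cost : List P → ℝ≥0∞} {x : ℝ≥0∞} {σ : List P}
    (hσ : σ ∈ G.requests) (hopt : opt k σ ≠ 0) (h : x * (opt k σ : ℝ≥0∞) ≤ cost σ) :
    x ≤ ratio G k cost := by
  refine le_sInf fun r hr => ?_
  have hxr := h.trans (hr σ hσ)
  rwa [ENNReal.mul_le_mul_iff_left (by exact_mod_cast hopt) (ENNReal.natCast_ne_top _)] at hxr

lemma asympRatio_le_ratio (G : ExtGraph P) (k : ℕ) (cost : List P → ℝ≥0∞) :
    asympRatio G k cost ≤ ratio G k cost :=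
  sInf_le_sInf fun _ hr => ⟨0, fun σ hσ => (hr σ hσ).trans le_self_add⟩

lemma detRatioInf_le_detRatio (G : ExtGraph P) (k : ℕ) : detRatioInf G k ≤ detRatio G k :=
  iInf_mono fun _ => asympRatio_le_ratio _ _ _

lemma oblRatioInf_le_oblRatio (G : ExtGraph P) (k : ℕ) : oblRatioInf G k ≤ oblRatio G k :=
  iInf_mono fun _ => asympRatio_le_ratio _ _ _

lemma oblRatio_le_detRatio (G : ExtGraph P) (k : ℕ) : oblRatio G k ≤ detRatio G k := by
  refine le_iInf fun a => ?_
  refine iInf_le_of_le ⟨Measure.dirac a, Measure.dirac.isProbabilityMeasure⟩ (le_of_eq ?_)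
  congr 1
  funext σ
  exact lintegral_dirac' a (measurable_detCost σ)

lemma mem_requests_of_append {P : Type} {G : ExtGraph P} {σ τ : List P}
    (h : σ ++ τ ∈ G.requests) : σ ∈ G.requests := by
  obtain ⟨vs, hchain, hvs⟩ := h
  obtain ⟨us, ws, rfl, hus, -⟩ := List.append_eq_map_iff.1 hvs
  exact ⟨us, hchain.left_of_append, hus.symm⟩

/-- The complete graph on the set of all pages. All sequences of pages are request sequences of it,
so a truly online algorithm has to use the strategy for this graph throughout. -/
def completeExtGraph (P : Type) [Finite P] : ExtGraph P := ⟨P, inferInstance, ⊤, id⟩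

lemma mem_requests_completeExtGraph {P : Type} [Finite P] (σ : List P) :
    σ ∈ (completeExtGraph P).requests :=
  ⟨σ, List.isChain_iff_getElem.2 fun _ _ => em _, by simp [completeExtGraph]⟩

lemma TrulyOnline.detCost_eq {A : ExtGraph P → DetAlg P k} (hA : TrulyOnline A)
    {G₁ G₂ : ExtGraph P} {σ : List P} (h₁ : σ ∈ G₁.requests) (h₂ : σ ∈ G₂.requests) :
    detCost (A G₁) σ = detCost (A G₂) σ := by
  suffices h : (A G₁).faults σ = (A G₂).faults σ by rw [detCost, detCost, h]
  induction σ using List.reverseRecOn with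
  | nil => simp
  | append_singleton σ p ih =>
    have h₁ := mem_requests_of_append h₁
    have h₂ := mem_requests_of_append h₂
    have cache_eq : (A G₁).cache σ = (A G₂).cache σ := by
      rw [← Option.some_inj, ← DetAlg.getLast?_run, ← DetAlg.getLast?_run, hA G₁ G₂ σ ⟨h₁, h₂⟩]
    rw [DetAlg.faults_append_singleton, DetAlg.faults_append_singleton, ih h₁ h₂, cache_eq]

lemma RandTrulyOnline.randCost_eq {A : ExtGraph P → RandAlg P k} (hA : RandTrulyOnline A)
    {G₁ G₂ : ExtGraph P} {σ : List P} (h₁ : σ ∈ G₁.requests) (h₂ : σ ∈ G₂.requests) :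
    randCost (A G₁) σ = randCost (A G₂) σ := by
  induction σ using List.reverseRecOn with
  | nil => simp
  | append_singleton σ p ih =>
    have h₁ := mem_requests_of_append h₁
    have h₂ := mem_requests_of_append h₂
    have fault_prob_eq := hA G₁ G₂ σ ⟨h₁, h₂⟩ {L | ∃ C, L.getLast? = some C ∧ p ∉ C}
    simp only [DetAlg.getLast?_run, Set.mem_ofPred_eq, Option.some_inj, exists_eq_left']
      at fault_prob_eq
    rw [randCost_append_singleton, randCost_append_singleton, ih h₁ h₂, fault_prob_eq]

end Ratios

section OfflineOptimum

variable {P : Type} [DecidableEq P] {k : ℕ}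

lemma exists_serves (hk : 0 < k) (C : Finset P) (σ : List P) : ∃ m, Serves k C σ m := by
  induction σ generalizing C with
  | nil => exact ⟨0, .nil C⟩
  | cons p σ ih =>
    obtain ⟨m, hm⟩ := ih {p}
    exact ⟨_, .cons C {p} p σ m (by simp) (by simp) (by simpa using Nat.succ_le_of_lt hk) hm⟩

lemma serves_opt (hk : 0 < k) (σ : List P) : Serves k ∅ σ (opt k σ) :=
  Nat.sInf_mem (s := {m | Serves k ∅ σ m}) (exists_serves hk ∅ σ)

lemma opt_le_of_serves {σ : List P} {m : ℕ} (h : Serves k ∅ σ m) : opt k σ ≤ m :=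
  Nat.sInf_le h

lemma Serves.card_sdiff_le {C : Finset P} {σ : List P} {m : ℕ} (h : Serves k C σ m) :
    (σ.toFinset \ C).card ≤ m := by
  induction h with
  | nil C => simp
  | cons C C' p σ m _ hC _ _ ih =>
    have hsub : (p :: σ).toFinset \ C ⊆ (σ.toFinset \ C') ∪ ({p} \ C) := by
      intro x hx
      have hxC : x ∈ C' → x = p ∨ x ∈ C := fun hx => Finset.mem_insert.1 (hC hx)
      simp only [List.toFinset_cons, Finset.mem_sdiff, Finset.mem_insert, List.mem_toFinset,
        Finset.mem_union, Finset.mem_singleton] at hx ⊢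
      tauto
    have hcard := (Finset.card_le_card hsub).trans (Finset.card_union_le _ _)
    have hfault : ({p} \ C).card = if p ∈ C then 0 else 1 := by
      split_ifs with hpC
      · simp [hpC]
      · rw [Finset.sdiff_eq_self_of_disjoint (by simpa using hpC), Finset.card_singleton]
    omega

lemma card_toFinset_le_opt (hk : 0 < k) (σ : List P) : σ.toFinset.card ≤ opt k σ := by
  simpa using (serves_opt hk σ).card_sdiff_le

lemma opt_ne_zero (hk : 0 < k) {σ : List P} (hσ : σ ≠ []) : opt k σ ≠ 0 := by
  have hpos : 0 < σ.toFinset.card := Finset.card_pos.2 ((List.toFinset_nonempty_iff σ).2 hσ)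
  exact (hpos.trans_le (card_toFinset_le_opt hk σ)).ne'

/-- One step of the greedy partition of a request sequence into phases with at most `k` different
pages. The state consists of the number of completed phases and the requests of the current one. -/
def phaseStep (k : ℕ) (st : ℕ × List P) (p : P) : ℕ × List P :=
  if (st.2 ++ [p]).toFinset.card ≤ k then (st.1, st.2 ++ [p]) else (st.1 + 1, [p])

/-- The state of the greedy phase partition after the requests `σ`. -/
def phases (k : ℕ) (σ : List P) : ℕ × List P := σ.foldl (phaseStep k) (0, [])

/-- The number of completed phases of `σ`. -/
def phaseCount (k : ℕ) (σ : List P) : ℕ := (phases k σ).1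

/-- The requests of the current, not yet completed phase of `σ`. -/
def currentPhase (k : ℕ) (σ : List P) : List P := (phases k σ).2

lemma phases_append_singleton (σ : List P) (p : P) :
    phases k (σ ++ [p]) =
      if (currentPhase k σ ++ [p]).toFinset.card ≤ k then (phaseCount k σ, currentPhase k σ ++ [p])
      else (phaseCount k σ + 1, [p]) := by
  simp [phases, phaseStep, currentPhase, phaseCount]

lemma mem_currentPhase_append_singleton (σ : List P) (p : P) :
    p ∈ currentPhase k (σ ++ [p]) := by
  rw [currentPhase, phases_append_singleton]; split_ifs <;> simp

lemma currentPhase_ne_nil {σ : List P} (hσ : σ ≠ []) : currentPhase k σ ≠ [] := by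
  induction σ using List.reverseRecOn with
  | nil => exact absurd rfl hσ
  | append_singleton τ p _ => exact List.ne_nil_of_mem (mem_currentPhase_append_singleton τ p)

lemma card_currentPhase_le (hk : 0 < k) (σ : List P) : (currentPhase k σ).toFinset.card ≤ k := by
  induction σ using List.reverseRecOn with
  | nil => simp [currentPhase, phases]
  | append_singleton τ p _ =>
    rw [currentPhase, phases_append_singleton]; split_ifs with h
    · exact h
    · simpa using Nat.succ_le_of_lt hk

lemma currentPhase_suffix (σ : List P) : currentPhase k σ <:+ σ := by
  induction σ using List.reverseRecOn with
  | nil => simp [currentPhase, phases]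
  | append_singleton τ p ih =>
    rw [currentPhase, phases_append_singleton]; split_ifs
    · obtain ⟨t, ht⟩ := ih
      exact ⟨t, by simp [← List.append_assoc, ht]⟩
    · exact ⟨τ, rfl⟩

lemma phaseCount_lt_or_currentPhase_append (σ τ : List P) :
    phaseCount k σ < phaseCount k (σ ++ τ) ∨
      phaseCount k (σ ++ τ) = phaseCount k σ ∧
        currentPhase k (σ ++ τ) = currentPhase k σ ++ τ := by
  induction τ using List.reverseRecOn with
  | nil => simp
  | append_singleton τ p ih =>
    rw [← List.append_assoc, currentPhase.eq_def k (σ ++ τ ++ [p]),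
      phaseCount.eq_def k (σ ++ τ ++ [p]), phases_append_singleton]
    split_ifs
    · exact ih.imp_right fun h => ⟨h.1, by simp [h.2]⟩
    · dsimp only
      omega

lemma phaseCount_le_append (σ τ : List P) : phaseCount k σ ≤ phaseCount k (σ ++ τ) :=
  (phaseCount_lt_or_currentPhase_append σ τ).elim le_of_lt fun h => h.1.ge

lemma card_toFinset_le_of_phaseCount_eq_zero (hk : 0 < k) {σ : List P}
    (h : phaseCount k σ = 0) : σ.toFinset.card ≤ k := by
  have hphase : currentPhase k ([] ++ σ) = [] ++ σ :=
    ((phaseCount_lt_or_currentPhase_append [] σ).resolve_left (by simp [h])).2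
  rw [List.nil_append] at hphase
  exact hphase ▸ card_currentPhase_le hk σ

/-- The potential is the number of pages that are in memory or have been requested during the
current phase: it grows only at a fault, and it exceeds `k` as soon as a phase is completed. -/
lemma Serves.phaseCount_add_le {C : Finset P} {σ : List P} {m : ℕ}
    (h : Serves k C σ m) (st : ℕ × List P) :
    (σ.foldl (phaseStep k) st).1 = st.1 ∨
      (σ.foldl (phaseStep k) st).1 + k ≤ st.1 + m + (st.2.toFinset ∪ C).card := by
  induction h generalizing st with
  | nil C => simp
  | cons C C' p σ m hp hC hC' _ ih =>
    obtain ⟨z, s⟩ := st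
    have insert_card_le :
        (insert p (s.toFinset ∪ C)).card ≤ (s.toFinset ∪ C).card + if p ∈ C then 0 else 1 := by
      split_ifs with hpC
      · rw [Finset.insert_eq_of_mem (Finset.mem_union_right _ hpC), Nat.add_zero]
      · exact Finset.card_insert_le _ _
    have toFinset_append : (s ++ [p]).toFinset = insert p s.toFinset := by ext; simp
    rw [List.foldl_cons]
    by_cases hphase : (s ++ [p]).toFinset.card ≤ k
    · have hstep : phaseStep k (z, s) p = (z, s ++ [p]) := if_pos hphase
      have hgrow : ((s ++ [p]).toFinset ∪ C').card ≤ (insert p (s.toFinset ∪ C)).card := by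
        rw [toFinset_append]
        refine Finset.card_le_card (Finset.union_subset ?_ ?_)
        · exact Finset.insert_subset_insert _ Finset.subset_union_left
        · exact hC.trans (Finset.insert_subset_insert _ Finset.subset_union_right)
      rw [hstep]
      exact (ih (z, s ++ [p])).imp_right fun h => by dsimp only at h ⊢; omega
    · have hstep : phaseStep k (z, s) p = (z + 1, [p]) := if_neg hphase
      have hfull : (s ++ [p]).toFinset.card ≤ (insert p (s.toFinset ∪ C)).card := by
        rw [toFinset_append]
        exact Finset.card_le_card (Finset.insert_subset_insert _ Finset.subset_union_left)
      have hrestart : ([p].toFinset ∪ C').card ≤ k := by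
        rwa [Finset.union_eq_right.2 (by simpa using hp)]
      have ih := ih (z + 1, [p])
      rw [hstep]
      dsimp only at ih ⊢
      omega

lemma phaseCount_add_le_opt (hk : 0 < k) {σ : List P} (h : phaseCount k σ ≠ 0) :
    phaseCount k σ + k ≤ opt k σ := by
  have hserves := ((serves_opt hk σ).phaseCount_add_le (0, [])).resolve_left h
  simpa [phaseCount, phases] using hserves

end OfflineOptimum

section LazyStrategies

variable {P : Type} [DecidableEq P] {k : ℕ}

/-- The memory of the lazy strategy with eviction rule `e`: at a fault with full memory it evicts
the page `e σ`, where `σ` includes the current request. For the sake of structural recursion the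
argument is the list of requests in reversed order. -/
def lazyCache (k : ℕ) (e : List P → P) : List P → Finset P
  | [] => ∅
  | p :: σ =>
    if p ∈ lazyCache k e σ then lazyCache k e σ
    else if (lazyCache k e σ).card < k then insert p (lazyCache k e σ)
    else if e (p :: σ).reverse ∈ lazyCache k e σ then
      insert p ((lazyCache k e σ).erase (e (p :: σ).reverse))
    else {p}

lemma card_lazyCache_le (hk : 0 < k) (e : List P → P) (σ : List P) :
    (lazyCache k e σ).card ≤ k := by
  induction σ with
  | nil => simp [lazyCache]
  | cons p σ ih =>
    rw [lazyCache]
    split_ifs with hmem hlt hevict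
    · exact ih
    · exact (Finset.card_insert_le _ _).trans hlt
    · exact (Finset.card_insert_le _ _).trans ((Finset.card_erase_add_one hevict).trans_le ih)
    · simpa using Nat.succ_le_of_lt hk

lemma mem_lazyCache_cons (e : List P → P) (σ : List P) (p : P) : p ∈ lazyCache k e (p :: σ) := by
  rw [lazyCache]
  split_ifs with hmem <;> simp [hmem]

lemma lazyCache_cons_subset (e : List P → P) (σ : List P) (p : P) :
    lazyCache k e (p :: σ) ⊆ insert p (lazyCache k e σ) := by
  rw [lazyCache]
  split_ifs
  · exact Finset.subset_insert _ _
  · exact subset_rfl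
  · exact Finset.insert_subset_insert _ (Finset.erase_subset _ _)
  · simp

/-- The lazy strategy with eviction rule `e`, which evicts a page only at a fault with full
memory. -/
def lazyAlg (hk : 0 < k) (e : List P → P) : DetAlg P k where
  cache σ := lazyCache k e σ.reverse
  cache_nil := rfl
  card_le σ := card_lazyCache_le hk e σ.reverse
  mem_cache σ p := by simpa using mem_lazyCache_cons e σ.reverse p
  cache_subset σ p := by simpa using lazyCache_cons_subset e σ.reverse p

lemma cache_lazyAlg_append_singleton (hk : 0 < k) (e : List P → P) (σ : List P) (p : P) :
    (lazyAlg hk e).cache (σ ++ [p]) =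
      if p ∈ (lazyAlg hk e).cache σ then (lazyAlg hk e).cache σ
      else if ((lazyAlg hk e).cache σ).card < k then insert p ((lazyAlg hk e).cache σ)
      else if e (σ ++ [p]) ∈ (lazyAlg hk e).cache σ then
        insert p (((lazyAlg hk e).cache σ).erase (e (σ ++ [p])))
      else {p} := by
  change lazyCache k e (σ ++ [p]).reverse = _
  rw [List.reverse_append, List.reverse_singleton, List.singleton_append, lazyCache,
    List.reverse_cons, List.reverse_reverse]
  rfl

lemma toFinset_append_singleton (σ : List P) (p : P) :
    (σ ++ [p]).toFinset = insert p σ.toFinset := by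
  ext; simp

lemma cache_lazyAlg_and_faults_of_card_le (hk : 0 < k) (e : List P → P) {σ : List P}
    (hσ : σ.toFinset.card ≤ k) :
    (lazyAlg hk e).cache σ = σ.toFinset ∧ (lazyAlg hk e).faults σ = σ.toFinset.card := by
  induction σ using List.reverseRecOn with
  | nil => simp [DetAlg.cache_nil]
  | append_singleton σ p ih =>
    rw [toFinset_append_singleton] at hσ ⊢
    obtain ⟨hcache, hfaults⟩ := ih ((Finset.card_le_card (Finset.subset_insert _ _)).trans hσ)
    rw [cache_lazyAlg_append_singleton, DetAlg.faults_append_singleton, hcache, hfaults]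
    by_cases hp : p ∈ σ.toFinset
    · simp only [hp, if_true, Finset.insert_eq_of_mem, add_zero, and_self]
    · rw [Finset.card_insert_of_notMem hp] at hσ ⊢
      rw [if_neg hp, if_neg hp, if_pos (Nat.lt_of_succ_le hσ)]
      exact ⟨rfl, rfl⟩

lemma cache_lazyAlg_append_singleton_of_eq_erase (hk : 0 < k) {e : List P → P} {σ : List P} {p : P}
    {Q : Finset P} (hQ : Q.card = k + 1) (hp : p ∈ Q)
    (hcache : (lazyAlg hk e).cache σ = Q.erase p) (heQ : e (σ ++ [p]) ∈ Q)
    (hep : e (σ ++ [p]) ≠ p) :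
    (lazyAlg hk e).cache (σ ++ [p]) = Q.erase (e (σ ++ [p])) := by
  have hfull : (Q.erase p).card = k := by rw [Finset.card_erase_of_mem hp, hQ, Nat.add_sub_cancel]
  rw [cache_lazyAlg_append_singleton, hcache, if_neg (Finset.notMem_erase p Q), hfull,
    if_neg (lt_irrefl k), if_pos (Finset.mem_erase.2 ⟨hep, heQ⟩), Finset.erase_right_comm,
    Finset.insert_erase (Finset.mem_erase.2 ⟨hep.symm, hp⟩)]

lemma toFinset_eq_erase_of_card_lt {Q : Finset P} {σ : List P} {p : P} (hQ : Q.card = k + 1)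
    (hsub : ∀ q ∈ σ ++ [p], q ∈ Q) (hcard : σ.toFinset.card ≤ k)
    (hcard' : k < (σ ++ [p]).toFinset.card) : σ.toFinset = Q.erase p := by
  rw [toFinset_append_singleton] at hcard'
  have hp : p ∉ σ.toFinset := fun hp => by rw [Finset.insert_eq_of_mem hp] at hcard'; omega
  rw [Finset.card_insert_of_notMem hp] at hcard'
  refine Finset.eq_of_subset_of_card_le (fun x hx => Finset.mem_erase.2 ⟨?_, ?_⟩) ?_
  · exact fun h => hp (h ▸ hx)
  · exact hsub x (List.mem_append_left _ (List.mem_toFinset.1 hx))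
  · rw [Finset.card_erase_of_mem (hsub p (by simp)), hQ]
    omega

lemma mem_of_mem_requests {P : Type} {G : ExtGraph P} {Q : Finset P} (hG : ∀ v, G.label v ∈ Q)
    {σ : List P} (hσ : σ ∈ G.requests) {p : P} (hp : p ∈ σ) : p ∈ Q := by
  obtain ⟨vs, -, rfl⟩ := hσ
  obtain ⟨v, -, rfl⟩ := List.mem_map.1 hp
  exact hG v

/-- A lazy strategy on `k + 1` pages always misses exactly one page, so each fault is a request of
the page evicted at the preceding fault. -/
lemma exists_cache_lazyAlg_eq_erase (hk : 0 < k) {G : ExtGraph P} {Q : Finset P}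
    {e : List P → P} {Φ : List P → ℕ} (hQ : Q.card = k + 1) (hG : ∀ v, G.label v ∈ Q)
    (he : ∀ σ p, σ ++ [p] ∈ G.requests → e (σ ++ [p]) ∈ Q ∧ e (σ ++ [p]) ≠ p)
    (hΦ : ∀ h τ, h ≠ [] → h ++ τ ++ [e h] ∈ G.requests → e h ∉ τ → Φ h < Φ (h ++ τ ++ [e h]))
    {σ : List P} (hσ : σ ∈ G.requests) (hcard : k < σ.toFinset.card) :
    ∃ h τ, h ≠ [] ∧ σ = h ++ τ ∧ e h ∉ τ ∧ (lazyAlg hk e).cache σ = Q.erase (e h) ∧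
      (lazyAlg hk e).faults σ ≤ k + 1 + Φ h := by
  induction σ using List.reverseRecOn with
  | nil => simp at hcard
  | append_singleton σ p ih =>
    have hpQ : p ∈ Q := mem_of_mem_requests hG hσ (by simp)
    obtain ⟨heQ, hep⟩ := he σ p hσ
    have evict := cache_lazyAlg_append_singleton_of_eq_erase (e := e) (σ := σ) hk hQ hpQ
    by_cases hwarm : σ.toFinset.card ≤ k
    · obtain ⟨hcache, hfaults⟩ := cache_lazyAlg_and_faults_of_card_le hk e hwarm
      have hfull := toFinset_eq_erase_of_card_lt hQ
        (fun q => mem_of_mem_requests hG hσ) hwarm hcard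
      refine ⟨σ ++ [p], [], by simp, by simp, by simp, evict (hcache.trans hfull) heQ hep, ?_⟩
      rw [DetAlg.faults_append_singleton, hfaults]
      split_ifs <;> omega
    · have hσ' := mem_requests_of_append hσ
      obtain ⟨h, τ, hne, rfl, hτ, hcache, hfaults⟩ := ih hσ' (not_le.1 hwarm)
      rw [DetAlg.faults_append_singleton]
      by_cases hp : p = e h
      · have hgrow := hΦ h τ hne (hp ▸ hσ) hτ
        rw [← hp] at hcache hgrow
        refine ⟨h ++ τ ++ [p], [], by simp, by simp, by simp, evict hcache heQ hep, ?_⟩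
        split_ifs <;> omega
      · have hmem : p ∈ (lazyAlg hk e).cache (h ++ τ) := hcache ▸ Finset.mem_erase.2 ⟨hp, hpQ⟩
        refine ⟨h, τ ++ [p], hne, by simp, by simp [hτ, Ne.symm hp], ?_, ?_⟩
        · rw [cache_lazyAlg_append_singleton, if_pos hmem, hcache]
        · simpa [hmem] using hfaults

lemma detRatio_le_of_potential (hk : 0 < k) {G : ExtGraph P} {Q : Finset P} {e : List P → P}
    {Φ : List P → ℕ} {c : ℕ} (hQ : Q.card = k + 1) (hG : ∀ v, G.label v ∈ Q)
    (he : ∀ σ p, σ ++ [p] ∈ G.requests → e (σ ++ [p]) ∈ Q ∧ e (σ ++ [p]) ≠ p)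
    (hΦ : ∀ h τ, h ≠ [] → h ++ τ ++ [e h] ∈ G.requests → e h ∉ τ → Φ h < Φ (h ++ τ ++ [e h]))
    (Φ_le : ∀ σ ∈ G.requests, σ ≠ [] → Φ σ ≤ c * (phaseCount k σ + k)) :
    detRatio G k ≤ (c + 1 : ℕ) := by
  refine (iInf_le _ (lazyAlg hk e)).trans (sInf_le fun σ hσ => ?_)
  suffices hfaults : (lazyAlg hk e).faults σ ≤ (c + 1) * opt k σ by
    rw [detCost]; exact_mod_cast hfaults
  by_cases hcard : σ.toFinset.card ≤ k
  · rw [(cache_lazyAlg_and_faults_of_card_le hk e hcard).2]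
    exact (card_toFinset_le_opt hk σ).trans (Nat.le_mul_of_pos_left _ c.succ_pos)
  · obtain ⟨h, τ, hne, rfl, -, -, hfaults⟩ :=
      exists_cache_lazyAlg_eq_erase hk hQ hG he hΦ hσ (not_le.1 hcard)
    have hphases := phaseCount_add_le_opt (σ := h ++ τ) hk
      fun h0 => hcard (card_toFinset_le_of_phaseCount_eq_zero hk h0)
    have hpages := card_toFinset_le_opt hk (h ++ τ)
    have hpotential : Φ h ≤ c * opt k (h ++ τ) :=
      (Φ_le h (mem_requests_of_append hσ) hne).trans <| Nat.mul_le_mul_left c <|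
        (Nat.add_le_add_right (phaseCount_le_append h τ) k).trans hphases
    rw [Nat.succ_mul]
    omega

/-- Bounds the ratio by that of a lazy strategy which evicts pages outside the current phase. From
each fault to the next either `Z` grows or `Z` stays and `rank < L` drops, so the number of faults
is at most about `L * Z`. -/
theorem detRatio_le_of_rank (hk : 0 < k) {G : ExtGraph P} {Q : Finset P} (hQ : Q.card = k + 1)
    (hG : ∀ v, G.label v ∈ Q) {e : List P → P} {rank Z : List P → ℕ} {L c : ℕ}
    (he : ∀ σ ∈ G.requests, σ ≠ [] → e σ ∈ Q ∧ e σ ∉ currentPhase k σ)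
    (rank_lt : ∀ σ ∈ G.requests, σ ≠ [] → rank σ < L)
    (step : ∀ h τ, h ≠ [] → h ++ τ ++ [e h] ∈ G.requests → e h ∉ τ →
      Z h < Z (h ++ τ ++ [e h]) ∨
        Z h = Z (h ++ τ ++ [e h]) ∧ rank (h ++ τ ++ [e h]) < rank h)
    (hc : ∀ σ ∈ G.requests, σ ≠ [] → L * (Z σ + 1) ≤ c * (phaseCount k σ + k)) :
    detRatio G k ≤ (c + 1 : ℕ) := by
  refine detRatio_le_of_potential (e := e) (Φ := fun h => L * Z h + (L - 1 - rank h)) hk hQ hG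
    (fun σ p hσ => ?_) (fun h τ hne hreq hτ => ?_) fun σ hσ hne => ?_
  · obtain ⟨heQ, hephase⟩ := he _ hσ (by simp)
    refine ⟨heQ, fun hep => hephase ?_⟩
    rw [hep]
    exact mem_currentPhase_append_singleton σ p
  · have hh := rank_lt h (mem_requests_of_append (mem_requests_of_append hreq)) hne
    have hh' := rank_lt _ hreq (by simp)
    rcases step h τ hne hreq hτ with hZ | ⟨hZ, hrank⟩
    · have hmul := Nat.mul_le_mul_left L (Nat.succ_le_of_lt hZ)
      rw [Nat.mul_succ] at hmul
      omega
    · simp only [hZ]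
      omega
  · have hrank := rank_lt σ hσ hne
    refine le_trans ?_ (hc σ hσ hne)
    rw [Nat.mul_succ]
    omega

end LazyStrategies

section LabeledPaths

variable {P : Type} {N : ℕ} {lab : ℕ → P}

/-- The path with the vertices `0, …, N - 1`, where `x` is labeled by `lab x`. -/
def pathExt (N : ℕ) (lab : ℕ → P) : ExtGraph P :=
  ⟨Fin N, inferInstance, SimpleGraph.pathGraph N, fun v => lab v⟩

/-- Two positions on a path are equal or adjacent. -/
def Near (x y : ℕ) : Prop := x ≤ y + 1 ∧ y ≤ x + 1

/-- The positions `vs` form a walk, with stops allowed, on the path with `N` vertices and labeling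
`lab`, and `s` is the label sequence of this walk. -/
structure IsWalkOn (N : ℕ) (lab : ℕ → P) (vs : List ℕ) (s : List P) : Prop where
  lt : ∀ v ∈ vs, v < N
  chain : vs.IsChain Near
  map_eq : vs.map lab = s

lemma mem_requests_pathExt {σ : List P} :
    σ ∈ (pathExt N lab).requests ↔ ∃ vs, IsWalkOn N lab vs σ := by
  have hadj : ∀ u v : Fin N, (u = v ∨ (pathExt N lab).graph.Adj u v) ↔ Near u v := by
    intro u v
    change (u = v ∨ (SimpleGraph.pathGraph N).Adj u v) ↔ _
    rw [SimpleGraph.pathGraph_adj, Near, Fin.ext_iff]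
    omega
  constructor
  · rintro ⟨vs, hchain, rfl⟩
    change List (Fin N) at vs
    refine ⟨vs.map Fin.val, fun v hv => ?_, ?_, ?_⟩
    · obtain ⟨u, -, rfl⟩ := List.mem_map.1 hv
      exact u.2
    · rw [List.isChain_map]
      exact hchain.imp fun u v h => (hadj u v).1 h
    · rw [List.map_map]; rfl
  · rintro ⟨vs, hlt, hchain, rfl⟩
    lift vs to List (Fin N) using hlt
    rw [List.isChain_map] at hchain
    refine ⟨vs, hchain.imp fun u v h => (hadj u v).2 h, ?_⟩
    rw [List.map_map]; rfl

lemma label_pathExt_mem {Q : Finset P} (hlab : ∀ x < N, lab x ∈ Q) (v : (pathExt N lab).V) :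
    (pathExt N lab).label v ∈ Q :=
  hlab _ (Fin.is_lt v)

lemma le_add_length_pathGraph {u v : Fin N} (w : (SimpleGraph.pathGraph N).Walk u v) :
    (u : ℕ) ≤ v + w.length ∧ (v : ℕ) ≤ u + w.length := by
  induction w with
  | nil => simp
  | cons h w ih =>
    rw [SimpleGraph.pathGraph_adj] at h
    rw [SimpleGraph.Walk.length_cons]
    omega

lemma le_Delta_pathExt {d : ℕ} (h : ∀ x y, x < y → y < N → lab x = lab y → x + d ≤ y) :
    (d : ℕ∞) ≤ (pathExt N lab).Delta := by
  refine le_iInf fun (u : Fin N) => le_iInf fun (v : Fin N) => le_iInf fun huv =>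
    le_iInf fun (hl : lab u = lab v) => le_iInf fun (w : (SimpleGraph.pathGraph N).Walk u v) => ?_
  suffices d ≤ w.length from Nat.cast_le.2 this
  have hw := le_add_length_pathGraph w
  rcases Fin.lt_or_lt_of_ne huv with huv | hvu
  · have := h u v huv v.2 hl
    omega
  · have := h v u hvu u.2 hl.symm
    omega

lemma exists_toFinset_eq_Icc {vs : List ℕ} (hne : vs ≠ []) (hc : vs.IsChain Near) :
    ∃ l r, l ≤ r ∧ vs.toFinset = Finset.Icc l r := by
  induction vs with
  | nil => simp at hne
  | cons x vs ih =>
    cases vs with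
    | nil => exact ⟨x, x, le_rfl, by simp⟩
    | cons y vs =>
      rw [List.isChain_cons_cons] at hc
      obtain ⟨l, r, hlr, h⟩ := ih (by simp) hc.2
      have hy : y ∈ Finset.Icc l r := by rw [← h]; simp
      obtain ⟨hxy, hyx⟩ := hc.1
      rw [Finset.mem_Icc] at hy
      refine ⟨min l x, max r x, by omega, ?_⟩
      rw [List.toFinset_cons, h]
      ext z
      simp only [Finset.mem_insert, Finset.mem_Icc]
      omega

namespace IsWalkOn

lemma exists_append {vs : List ℕ} {s t : List P} (h : IsWalkOn N lab vs (s ++ t)) :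
    ∃ us ws, vs = us ++ ws ∧ IsWalkOn N lab us s ∧ IsWalkOn N lab ws t := by
  obtain ⟨us, ws, rfl, hus, hws⟩ := List.map_eq_append_iff.1 h.map_eq
  exact ⟨us, ws, rfl, ⟨fun v hv => h.lt v (by simp [hv]), h.chain.left_of_append, hus⟩,
    ⟨fun v hv => h.lt v (by simp [hv]), h.chain.right_of_append, hws⟩⟩

lemma ne_nil {vs : List ℕ} {s : List P} (h : IsWalkOn N lab vs s) (hs : s ≠ []) : vs ≠ [] := by
  rintro rfl
  exact hs h.map_eq.symm

lemma exists_Icc [DecidableEq P] {vs : List ℕ} {s : List P} (h : IsWalkOn N lab vs s)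
    (hs : s ≠ []) :
    ∃ l r, l ≤ r ∧ r < N ∧ vs.toFinset = Finset.Icc l r ∧
      (Finset.Icc l r).image lab = s.toFinset := by
  obtain ⟨l, r, hlr, hvs⟩ := exists_toFinset_eq_Icc (h.ne_nil hs) h.chain
  have hr : r ∈ vs := by rw [← List.mem_toFinset, hvs]; exact Finset.right_mem_Icc.2 hlr
  refine ⟨l, r, hlr, h.lt r hr, hvs, ?_⟩
  rw [← hvs, ← h.map_eq]
  ext
  simp

end IsWalkOn

/-- The possible first positions of a walk on the labeled path with label sequence `s`. -/
noncomputable def starts (N : ℕ) (lab : ℕ → P) (s : List P) : Finset ℕ := by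
  classical exact (Finset.range N).filter fun x => ∃ vs, IsWalkOn N lab (x :: vs) s

lemma mem_starts {s : List P} {x : ℕ} :
    x ∈ starts N lab s ↔ ∃ vs, IsWalkOn N lab (x :: vs) s := by
  classical
  rw [starts, Finset.mem_filter, Finset.mem_range, and_iff_right_iff_imp]
  rintro ⟨vs, hvs⟩
  exact hvs.lt x List.mem_cons_self

lemma card_starts_le (s : List P) : (starts N lab s).card ≤ N := by
  classical exact (Finset.card_filter_le _ _).trans (Finset.card_range N).le

lemma card_starts_le_of_card_filter_le [DecidableEq P] {m : ℕ} {s : List P} (hs : s ≠ [])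
    (hm : ∀ p, ((Finset.range N).filter fun x => lab x = p).card ≤ m) :
    (starts N lab s).card ≤ m := by
  obtain ⟨p, s, rfl⟩ := List.exists_cons_of_ne_nil hs
  refine (Finset.card_le_card fun x hx => ?_).trans (hm p)
  obtain ⟨vs, hvs⟩ := mem_starts.1 hx
  exact Finset.mem_filter.2 ⟨Finset.mem_range.2 (hvs.lt x List.mem_cons_self),
    (List.cons.inj hvs.map_eq).1⟩

lemma starts_append_subset {s : List P} (hs : s ≠ []) (t : List P) :
    starts N lab (s ++ t) ⊆ starts N lab s := by
  intro x hx
  obtain ⟨vs, hvs⟩ := mem_starts.1 hx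
  obtain ⟨us, ws, hsplit, hus, -⟩ := hvs.exists_append
  obtain ⟨y, us, rfl⟩ := List.exists_cons_of_ne_nil (hus.ne_nil hs)
  obtain rfl : x = y := (List.cons.inj hsplit).1
  exact mem_starts.2 ⟨us, hus⟩

lemma starts_nonempty_of_suffix {σ s : List P} (hσ : σ ∈ (pathExt N lab).requests) (hs : s <:+ σ)
    (hne : s ≠ []) : (starts N lab s).Nonempty := by
  obtain ⟨vs, hvs⟩ := mem_requests_pathExt.1 hσ
  obtain ⟨t, rfl⟩ := hs
  obtain ⟨-, ws, -, -, hws⟩ := hvs.exists_append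
  obtain ⟨x, ws, rfl⟩ := List.exists_cons_of_ne_nil (hws.ne_nil hne)
  exact ⟨x, mem_starts.2 ⟨ws, hws⟩⟩

lemma exists_interval_of_mem_starts [DecidableEq P] {s : List P} {x : ℕ}
    (hx : x ∈ starts N lab s) :
    ∃ l r, l ≤ x ∧ x ≤ r ∧ r < N ∧ (Finset.Icc l r).image lab = s.toFinset := by
  obtain ⟨vs, hvs⟩ := mem_starts.1 hx
  obtain ⟨l, r, -, hr, hIcc, himage⟩ := hvs.exists_Icc fun hs => by simpa [hs] using hvs.map_eq
  have hxlr : x ∈ Finset.Icc l r := by simp [← hIcc]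
  exact ⟨l, r, (Finset.mem_Icc.1 hxlr).1, (Finset.mem_Icc.1 hxlr).2, hr, himage⟩

end LabeledPaths

section UnknownStart

variable {P : Type} [DecidableEq P] {k N : ℕ} {lab : ℕ → P} {Q M : Finset P}

/-- The page `q` occurs in an interval around `x` that contains at most a quarter of the pages of
`Q \ M`. For a walk from `x` that has seen the pages `M`, a request of `q` is then possible before
many new pages have been seen. -/
def Early (N : ℕ) (lab : ℕ → P) (Q M : Finset P) (x : ℕ) (q : P) : Prop :=
  ∃ l r, l ≤ x ∧ x ≤ r ∧ r < N ∧ q ∈ (Finset.Icc l r).image lab ∧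
    4 * ((Finset.Icc l r).image lab \ M).card ≤ (Q \ M).card

open Classical in
/-- All early pages lie in the union of two intervals with few pages: the one that reaches farthest
to the left and the one that reaches farthest to the right. -/
lemma two_mul_card_early_le (N : ℕ) (lab : ℕ → P) (Q M : Finset P) (x : ℕ) :
    2 * ((Q \ M).filter (Early N lab Q M x)).card ≤ (Q \ M).card := by
  set S := ((Finset.range (x + 1)) ×ˢ (Finset.range N)).filter fun z =>
    x ≤ z.2 ∧ 4 * ((Finset.Icc z.1 z.2).image lab \ M).card ≤ (Q \ M).card with hS
  have mem_S : ∀ {l r}, (l, r) ∈ S ↔ (l ≤ x ∧ r < N) ∧ x ≤ r ∧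
      4 * ((Finset.Icc l r).image lab \ M).card ≤ (Q \ M).card := by
    simp [hS]
  rcases S.eq_empty_or_nonempty with hempty | hne
  · have : (Q \ M).filter (Early N lab Q M x) = ∅ := by
      rw [Finset.filter_eq_empty_iff]
      rintro q - ⟨l, r, hl, hr, hrN, -, hfew⟩
      simpa [hempty] using mem_S.2 ⟨⟨hl, hrN⟩, hr, hfew⟩
    simp [this]
  obtain ⟨⟨l₁, r₁⟩, hz₁, hmin⟩ := Finset.exists_min_image S Prod.fst hne
  obtain ⟨⟨l₂, r₂⟩, hz₂, hmax⟩ := Finset.exists_max_image S Prod.snd hne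
  rw [mem_S] at hz₁ hz₂
  have hsub : (Q \ M).filter (Early N lab Q M x) ⊆
      ((Finset.Icc l₁ r₁).image lab \ M) ∪ ((Finset.Icc l₂ r₂).image lab \ M) := by
    intro q hq
    obtain ⟨hq, l, r, hl, hr, hrN, hqlr, hfew⟩ := Finset.mem_filter.1 hq
    have hqM := (Finset.mem_sdiff.1 hq).2
    have hl₁ : l₁ ≤ l := hmin _ (mem_S.2 ⟨⟨hl, hrN⟩, hr, hfew⟩)
    have hr₂ : r ≤ r₂ := hmax _ (mem_S.2 ⟨⟨hl, hrN⟩, hr, hfew⟩)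
    obtain ⟨y, hy, rfl⟩ := Finset.mem_image.1 hqlr
    rw [Finset.mem_Icc] at hy
    rw [Finset.mem_union, Finset.mem_sdiff, Finset.mem_sdiff]
    rcases le_total y x with hyx | hxy
    · exact .inl ⟨Finset.mem_image_of_mem _ (Finset.mem_Icc.2 (by omega)), hqM⟩
    · exact .inr ⟨Finset.mem_image_of_mem _ (Finset.mem_Icc.2 (by omega)), hqM⟩
  have hcard := (Finset.card_le_card hsub).trans (Finset.card_union_le _ _)
  omega

open Classical in
lemma exists_rarely_early (N : ℕ) (lab : ℕ → P) (hM : (Q \ M).Nonempty) (X : Finset ℕ) :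
    ∃ q ∈ Q \ M, 2 * (X.filter fun x => Early N lab Q M x q).card ≤ X.card := by
  by_contra! hoften
  have hdouble := Finset.sum_card_bipartiteAbove_eq_sum_card_bipartiteBelow (s := X) (t := Q \ M)
    (Early N lab Q M)
  have hupper : ∑ x ∈ X, 2 * ((Q \ M).bipartiteAbove (Early N lab Q M) x).card ≤
      X.card * (Q \ M).card :=
    Finset.sum_le_card_nsmul _ _ _ fun x _ => two_mul_card_early_le N lab Q M x
  have hlower : ∑ _q ∈ Q \ M, X.card <
      ∑ q ∈ Q \ M, 2 * (X.bipartiteBelow (Early N lab Q M) q).card :=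
    Finset.sum_lt_sum_of_nonempty hM fun q hq => hoften q hq
  rw [← Finset.mul_sum, hdouble, Finset.mul_sum] at hupper
  rw [Finset.sum_const, smul_eq_mul, mul_comm] at hlower
  omega

lemma card_sdiff_append_add {s t : List P} (hsub : (s ++ t).toFinset ⊆ Q) :
    (Q \ (s ++ t).toFinset).card + ((s ++ t).toFinset \ s.toFinset).card =
      (Q \ s.toFinset).card := by
  have hs : s.toFinset ⊆ (s ++ t).toFinset := by
    rw [List.toFinset_append]; exact Finset.subset_union_left
  rw [Finset.card_sdiff_of_subset hsub, Finset.card_sdiff_of_subset hs,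
    Finset.card_sdiff_of_subset (hs.trans hsub)]
  have := Finset.card_le_card hsub
  have := Finset.card_le_card hs
  omega

open Classical in
/-- A request of a rarely early page rules out half of the starts or reveals a quarter of the
missing pages, and `2 * (3 / 4) ^ 3 ≤ 1`. -/
lemma two_mul_card_pow_mul_card_starts_append_le {s t : List P} {q : P} (hs : s ≠ [])
    (hsub : (s ++ t).toFinset ⊆ Q) (hq : q ∈ t)
    (hrare : 2 * ((starts N lab s).filter fun x => Early N lab Q s.toFinset x q).card ≤
      (starts N lab s).card) :
    2 * ((Q \ (s ++ t).toFinset).card ^ 3 * (starts N lab (s ++ t)).card) ≤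
      (Q \ s.toFinset).card ^ 3 * (starts N lab s).card := by
  have hcard := card_sdiff_append_add hsub
  by_cases hfew : 4 * ((s ++ t).toFinset \ s.toFinset).card ≤ (Q \ s.toFinset).card
  · have hearly : starts N lab (s ++ t) ⊆
        (starts N lab s).filter fun x => Early N lab Q s.toFinset x q := by
      intro x hx
      obtain ⟨l, r, hl, hr, hrN, himage⟩ := exists_interval_of_mem_starts hx
      refine Finset.mem_filter.2 ⟨starts_append_subset hs t hx, l, r, hl, hr, hrN, ?_, ?_⟩
      · rw [himage]; simp [hq]
      · rwa [himage]
    calc 2 * ((Q \ (s ++ t).toFinset).card ^ 3 * (starts N lab (s ++ t)).card)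
        = (Q \ (s ++ t).toFinset).card ^ 3 * (2 * (starts N lab (s ++ t)).card) := by ring
      _ ≤ _ := Nat.mul_le_mul (Nat.pow_le_pow_left (by omega) 3)
        ((Nat.mul_le_mul_left 2 (Finset.card_le_card hearly)).trans hrare)
  · have hcube : (4 * (Q \ (s ++ t).toFinset).card) ^ 3 ≤ (3 * (Q \ s.toFinset).card) ^ 3 :=
      Nat.pow_le_pow_left (by omega) 3
    rw [mul_pow, mul_pow] at hcube
    rw [← mul_assoc]
    exact Nat.mul_le_mul (by omega) (Finset.card_le_card (starts_append_subset hs t))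

theorem detRatio_pathExt_le (hk : 0 < k) (hQ : Q.card = k + 1) (hlab : ∀ x < N, lab x ∈ Q) :
    detRatio (pathExt N lab) k ≤ (Nat.log 2 ((k + 1) ^ 3 * N) + 2 : ℕ) := by
  classical
  have exists_evict : ∀ h : List P, ∃ q ∈ Q \ (currentPhase k h).toFinset,
      2 * ((starts N lab (currentPhase k h)).filter fun x =>
        Early N lab Q (currentPhase k h).toFinset x q).card ≤
          (starts N lab (currentPhase k h)).card := by
    intro h
    refine exists_rarely_early N lab (Finset.sdiff_nonempty_of_card_lt_card ?_) _
    exact (card_currentPhase_le hk h).trans_lt (by omega)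
  choose e he hrare using exists_evict
  have missing_ne_zero : ∀ h, (Q \ (currentPhase k h).toFinset).card ≠ 0 := fun h =>
    Finset.card_ne_zero_of_mem (he h)
  refine detRatio_le_of_rank hk hQ (label_pathExt_mem hlab) (e := e) (Z := phaseCount k)
    (rank := fun h => Nat.log 2 ((Q \ (currentPhase k h).toFinset).card ^ 3 *
      (starts N lab (currentPhase k h)).card))
    (L := Nat.log 2 ((k + 1) ^ 3 * N) + 1) (fun h _ _ => ?_) (fun h _ _ => ?_)
    (fun h τ hne hreq _ => ?_) fun h _ _ => Nat.mul_le_mul_left _ (by omega)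
  · simpa using he h
  · refine Nat.lt_succ_of_le (Nat.log_mono_right (Nat.mul_le_mul ?_ (card_starts_le _)))
    exact Nat.pow_le_pow_left (hQ ▸ Finset.card_le_card Finset.sdiff_subset) 3
  · have hstarts := starts_nonempty_of_suffix hreq (currentPhase_suffix (k := k) _)
      (currentPhase_ne_nil (by simp))
    have hmissing := missing_ne_zero (h ++ τ ++ [e h])
    have hsub : (currentPhase k (h ++ τ ++ [e h])).toFinset ⊆ Q := fun p hp =>
      mem_of_mem_requests (label_pathExt_mem hlab) hreq
        ((currentPhase_suffix _).subset (List.mem_toFinset.1 hp))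
    rw [List.append_assoc] at hstarts hmissing hsub ⊢
    refine (phaseCount_lt_or_currentPhase_append (k := k) h (τ ++ [e h])).imp_right
      fun ⟨hcount, hphase⟩ => ⟨hcount.symm, Nat.lt_of_succ_le ?_⟩
    rw [hphase] at hstarts hmissing hsub ⊢
    rw [Nat.succ_eq_add_one, ← Nat.log_mul_base one_lt_two
      (mul_ne_zero (pow_ne_zero 3 hmissing) hstarts.card_ne_zero), mul_comm]
    exact Nat.log_mono_right (two_mul_card_pow_mul_card_starts_append_le
      (currentPhase_ne_nil hne) hsub (by simp) (hrare h))

end UnknownStart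

section KnownStart

variable {P : Type} {N : ℕ} {lab : ℕ → P}

lemma IsWalkOn.unique (hΔ : ∀ x y, x < y → y < N → lab x = lab y → x + 3 ≤ y) {x : ℕ}
    {vs ws : List ℕ} {s : List P} (hvs : IsWalkOn N lab (x :: vs) s)
    (hws : IsWalkOn N lab (x :: ws) s) : vs = ws := by
  induction vs generalizing x ws s with
  | nil =>
    have hlen := congrArg List.length (hvs.map_eq.trans hws.map_eq.symm)
    simpa [eq_comm] using hlen
  | cons y vs ih =>
    obtain rfl | ⟨z, ws, rfl⟩ : ws = [] ∨ ∃ z ws', ws = z :: ws' := by cases ws <;> simp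
    · simpa using congrArg List.length (hvs.map_eq.trans hws.map_eq.symm)
    have hmap := hvs.map_eq.trans hws.map_eq.symm
    simp only [List.map_cons, List.cons.injEq, true_and] at hmap
    obtain ⟨⟨hxy, hyx⟩, hchain⟩ := List.isChain_cons_cons.1 hvs.chain
    obtain ⟨⟨hxz, hzx⟩, hchain'⟩ := List.isChain_cons_cons.1 hws.chain
    obtain rfl : y = z := by
      rcases lt_trichotomy y z with hlt | heq | hgt
      · have := hΔ y z hlt (hws.lt z (by simp)) hmap.1
        omega
      · exact heq
      · have := hΔ z y hgt (hvs.lt y (by simp)) hmap.1.symm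
        omega
    rw [ih ⟨fun v hv => hvs.lt v (List.mem_cons_of_mem x hv), hchain, rfl⟩
      ⟨fun v hv => hws.lt v (List.mem_cons_of_mem x hv), hchain', by simp [hmap.2]⟩]

open Classical in
/-- A walk with label sequence `s` from the least possible start (`[]` if there is none). -/
noncomputable def leastWalk (N : ℕ) (lab : ℕ → P) (s : List P) : List ℕ :=
  if h : ∃ vs, IsWalkOn N lab (sInf (starts N lab s : Set ℕ) :: vs) s then
    sInf (starts N lab s : Set ℕ) :: h.choose
  else []

lemma exists_leastWalk_eq_cons {s : List P} (hs : (starts N lab s).Nonempty) :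
    ∃ vs, leastWalk N lab s = sInf (starts N lab s : Set ℕ) :: vs ∧
      IsWalkOn N lab (sInf (starts N lab s : Set ℕ) :: vs) s := by
  have hmem : sInf (starts N lab s : Set ℕ) ∈ starts N lab s :=
    Nat.sInf_mem (Finset.coe_nonempty.2 hs)
  have hwalk := mem_starts.1 hmem
  exact ⟨hwalk.choose, dif_pos hwalk, hwalk.choose_spec⟩

lemma leastWalk_prefix_append (hΔ : ∀ x y, x < y → y < N → lab x = lab y → x + 3 ≤ y)
    {s t : List P} (hs : s ≠ []) (hst : (starts N lab (s ++ t)).Nonempty)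
    (heq : starts N lab (s ++ t) = starts N lab s) :
    leastWalk N lab s <+: leastWalk N lab (s ++ t) := by
  obtain ⟨vs, hvs, hwalk⟩ := exists_leastWalk_eq_cons (heq ▸ hst)
  obtain ⟨vs', hvs', hwalk'⟩ := exists_leastWalk_eq_cons hst
  obtain ⟨us, ws, hsplit, hus, -⟩ := hwalk'.exists_append
  obtain ⟨x, us, rfl⟩ := List.exists_cons_of_ne_nil (hus.ne_nil hs)
  obtain rfl : sInf (starts N lab (s ++ t) : Set ℕ) = x := (List.cons.inj hsplit).1
  rw [heq] at hus
  rw [hvs, hvs', hsplit, hwalk.unique hΔ hus, heq]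
  exact List.prefix_append _ _

/-- The positions that the walk from the least possible start has visited in the current phase. -/
noncomputable def visited [DecidableEq P] (N : ℕ) (lab : ℕ → P) (k : ℕ) (h : List P) : Finset ℕ :=
  ((leastWalk N lab h).drop (h.length - (currentPhase k h).length)).toFinset

variable [DecidableEq P] {k : ℕ} {Q : Finset P}

lemma exists_visited_eq_Icc {h : List P} (hreq : h ∈ (pathExt N lab).requests) (hne : h ≠ []) :
    ∃ l r, l ≤ r ∧ r < N ∧ visited N lab k h = Finset.Icc l r ∧
      (Finset.Icc l r).image lab = (currentPhase k h).toFinset := by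
  obtain ⟨vs, hvs, hwalk⟩ :=
    exists_leastWalk_eq_cons (starts_nonempty_of_suffix hreq List.suffix_rfl hne)
  rw [← hvs] at hwalk
  refine IsWalkOn.exists_Icc ⟨fun v hv => hwalk.lt v (List.mem_of_mem_drop hv),
    hwalk.chain.drop _, ?_⟩ (currentPhase_ne_nil hne)
  rw [List.map_drop, hwalk.map_eq]
  exact (List.suffix_iff_eq_drop.1 (currentPhase_suffix h)).symm

lemma visited_subset_append (hΔ : ∀ x y, x < y → y < N → lab x = lab y → x + 3 ≤ y)
    {h τ : List P} (hne : h ≠ []) (hstarts : (starts N lab (h ++ τ)).Nonempty)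
    (heq : starts N lab (h ++ τ) = starts N lab h)
    (hphase : currentPhase k (h ++ τ) = currentPhase k h ++ τ) :
    visited N lab k h ⊆ visited N lab k (h ++ τ) := by
  obtain ⟨ws, hws⟩ := leastWalk_prefix_append hΔ hne hstarts heq
  intro x hx
  rw [visited, List.mem_toFinset] at hx ⊢
  rw [hphase, List.length_append, List.length_append, Nat.add_sub_add_right, ← hws,
    List.drop_append]
  exact List.mem_append_left _ hx

/-- `WinsPhase N lab Q k n I`: if a fault occurs when the positions `I` have been visited during
the current phase, the evicted pages can be chosen such that the phase has fewer than `n` further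
faults. -/
def WinsPhase (N : ℕ) (lab : ℕ → P) (Q : Finset P) (k : ℕ) : ℕ → Finset ℕ → Prop
  | 0, _ => False
  | n + 1, I => ∃ q ∈ Q, q ∉ I.image lab ∧ ∀ l r, I ⊆ Finset.Icc l r → r < N →
      q ∈ (Finset.Icc l r).image lab → ((Finset.Icc l r).image lab).card ≤ k →
      WinsPhase N lab Q k n (Finset.Icc l r)

namespace WinsPhase

lemma succ {n : ℕ} {I : Finset ℕ} (h : WinsPhase N lab Q k n I) :
    WinsPhase N lab Q k (n + 1) I := by
  induction n generalizing I with
  | zero => exact h.elim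
  | succ n ih =>
    obtain ⟨q, hq, hqI, h⟩ := h
    exact ⟨q, hq, hqI, fun l r hI hr hqlr hcard => ih (h l r hI hr hqlr hcard)⟩

lemma of_le {n m : ℕ} {I : Finset ℕ} (h : WinsPhase N lab Q k n I) (hnm : n ≤ m) :
    WinsPhase N lab Q k m I := by
  induction hnm with
  | refl => exact h
  | step _ ih => exact ih.succ

lemma of_subset {n : ℕ} {I : Finset ℕ} (h : WinsPhase N lab Q k n I) {l r : ℕ}
    (hI : I ⊆ Finset.Icc l r) (hr : r < N) (hcard : ((Finset.Icc l r).image lab).card ≤ k) :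
    WinsPhase N lab Q k n (Finset.Icc l r) := by
  cases n with
  | zero => exact h.elim
  | succ n =>
    obtain ⟨q, hq, -, h⟩ := h
    by_cases hqlr : q ∈ (Finset.Icc l r).image lab
    · exact (h l r hI hr hqlr hcard).succ
    · exact ⟨q, hq, hqlr, fun l' r' hI' => h l' r' (hI.trans hI')⟩

end WinsPhase

/-- The least number of further faults within which the current phase can be survived. -/
noncomputable def winRank (N : ℕ) (lab : ℕ → P) (Q : Finset P) (k : ℕ) (h : List P) : ℕ :=
  sInf {n | WinsPhase N lab Q k (n + 1) (visited N lab k h)}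

lemma winRank_lt_of_winsPhase {n : ℕ} {h : List P}
    (hwin : WinsPhase N lab Q k n (visited N lab k h)) : winRank N lab Q k h < n := by
  cases n with
  | zero => exact hwin.elim
  | succ n => exact Nat.lt_succ_of_le (Nat.sInf_le hwin)

lemma winsPhase_visited (hk : 0 < k) {L : ℕ} (hwin : ∀ x < N, WinsPhase N lab Q k L {x})
    {h : List P} (hreq : h ∈ (pathExt N lab).requests) (hne : h ≠ []) :
    WinsPhase N lab Q k L (visited N lab k h) := by
  obtain ⟨l, r, hlr, hr, hvisited, himage⟩ := exists_visited_eq_Icc (k := k) hreq hne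
  rw [hvisited]
  exact (hwin r hr).of_subset (by simpa using hlr) hr (himage ▸ card_currentPhase_le hk h)

lemma winsPhase_winRank_succ (hk : 0 < k) {L : ℕ} (hwin : ∀ x < N, WinsPhase N lab Q k L {x})
    {h : List P} (hreq : h ∈ (pathExt N lab).requests) (hne : h ≠ []) :
    WinsPhase N lab Q k (winRank N lab Q k h + 1) (visited N lab k h) :=
  Nat.sInf_mem (s := {n | WinsPhase N lab Q k (n + 1) (visited N lab k h)})
    ⟨L, (winsPhase_visited hk hwin hreq hne).succ⟩

lemma exists_evict_of_winsPhase (hk : 0 < k) {L : ℕ} (hwin : ∀ x < N, WinsPhase N lab Q k L {x})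
    (hΔ : ∀ x y, x < y → y < N → lab x = lab y → x + 3 ≤ y) {h : List P}
    (hreq : h ∈ (pathExt N lab).requests) (hne : h ≠ []) :
    ∃ q ∈ Q, q ∉ currentPhase k h ∧ ∀ τ, h ++ τ ++ [q] ∈ (pathExt N lab).requests →
      starts N lab (h ++ τ ++ [q]) = starts N lab h →
      currentPhase k (h ++ τ ++ [q]) = currentPhase k h ++ (τ ++ [q]) →
      winRank N lab Q k (h ++ τ ++ [q]) < winRank N lab Q k h := by
  obtain ⟨q, hq, hqI, hnext⟩ := winsPhase_winRank_succ hk hwin hreq hne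
  obtain ⟨l, r, -, -, hvisited, himage⟩ := exists_visited_eq_Icc (k := k) hreq hne
  rw [hvisited, himage, List.mem_toFinset] at hqI
  refine ⟨q, hq, hqI, fun τ hreq' hstarts hphase => winRank_lt_of_winsPhase ?_⟩
  have hstarts_ne := starts_nonempty_of_suffix hreq' List.suffix_rfl (by simp)
  obtain ⟨l', r', -, hr', hvisited', himage'⟩ := exists_visited_eq_Icc (k := k) hreq' (by simp)
  have hcard := card_currentPhase_le hk (h ++ τ ++ [q])
  have hqIcc : q ∈ (Finset.Icc l' r').image lab := by rw [himage', hphase]; simp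
  rw [← himage'] at hcard
  rw [hvisited']
  refine hnext l' r' ?_ hr' hqIcc hcard
  rw [← hvisited']
  rw [List.append_assoc] at hstarts hphase hstarts_ne ⊢
  exact visited_subset_append hΔ hne hstarts_ne hstarts hphase

/-- If equal labels have distance at least three, the position is known once the start is known.
The strategy follows the walk from the least possible start, and whenever a phase lasts longer than
this walk allows, a start has been ruled out. -/
theorem detRatio_pathExt_le_of_winsPhase (hk : 0 < k) (hQ : Q.card = k + 1)
    (hlab : ∀ x < N, lab x ∈ Q) (hΔ : ∀ x y, x < y → y < N → lab x = lab y → x + 3 ≤ y)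
    (hm : ∀ p, ((Finset.range N).filter fun x => lab x = p).card ≤ k + 1) {L : ℕ}
    (hwin : ∀ x < N, WinsPhase N lab Q k L {x}) :
    detRatio (pathExt N lab) k ≤ (2 * L + 1 : ℕ) := by
  have exists_evict : ∀ h : List P, ∃ q, h ∈ (pathExt N lab).requests → h ≠ [] →
      q ∈ Q ∧ q ∉ currentPhase k h ∧ ∀ τ, h ++ τ ++ [q] ∈ (pathExt N lab).requests →
        starts N lab (h ++ τ ++ [q]) = starts N lab h →
        currentPhase k (h ++ τ ++ [q]) = currentPhase k h ++ (τ ++ [q]) →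
        winRank N lab Q k (h ++ τ ++ [q]) < winRank N lab Q k h := by
    intro h
    by_cases hh : h ∈ (pathExt N lab).requests ∧ h ≠ []
    · exact (exists_evict_of_winsPhase hk hwin hΔ hh.1 hh.2).imp fun _ hq _ _ => hq
    · obtain ⟨q, -⟩ : Q.Nonempty := Finset.card_pos.1 (by omega)
      exact ⟨q, fun hreq hne => absurd ⟨hreq, hne⟩ hh⟩
  choose e he using exists_evict
  refine detRatio_le_of_rank hk hQ (label_pathExt_mem hlab) (e := e) (rank := winRank N lab Q k)
    (Z := fun h => phaseCount k h + (k + 1 - (starts N lab h).card)) (L := L)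
    (fun h hreq hne => ⟨(he h hreq hne).1, (he h hreq hne).2.1⟩)
    (fun h hreq hne => winRank_lt_of_winsPhase (winsPhase_visited hk hwin hreq hne))
    (fun h τ hne hreq _ => ?_) fun h hreq hne => ?_
  · have hh := mem_requests_of_append (mem_requests_of_append hreq)
    obtain ⟨-, -, hrank⟩ := he h hh hne
    have hcard := card_starts_le_of_card_filter_le hne hm
    rw [List.append_assoc] at hreq ⊢
    have hsub := starts_append_subset (N := N) (lab := lab) hne (τ ++ [e h])
    rcases phaseCount_lt_or_currentPhase_append (k := k) h (τ ++ [e h]) with hlt | ⟨hcount, hphase⟩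
    · have := Finset.card_le_card hsub
      omega
    rcases hsub.eq_or_ssubset with heq | hssub
    · rw [hcount, heq]
      rw [← List.append_assoc] at hreq heq hphase ⊢
      exact .inr ⟨rfl, hrank τ hreq heq hphase⟩
    · have := Finset.card_lt_card hssub
      omega
  · have hpos := (starts_nonempty_of_suffix hreq List.suffix_rfl hne).card_pos
    rw [mul_comm 2, mul_assoc]
    exact Nat.mul_le_mul_left L (by omega)

end KnownStart

section Permutations

open Equiv

variable {ι : Type*} [Fintype ι] [DecidableEq ι]

/-- The permutations that map `S` into `T`. -/
def permsInto (S T : Finset ι) : Finset (Perm ι) :=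
  {σ | ∀ x ∈ S, σ x ∈ T}

@[simp]
lemma mem_permsInto {S T : Finset ι} {σ : Perm ι} : σ ∈ permsInto S T ↔ ∀ x ∈ S, σ x ∈ T := by
  simp [permsInto]

lemma filter_permsInto (S T : Finset ι) (x : ι) :
    (permsInto S T).filter (fun σ => σ x ∈ T) = permsInto (insert x S) T := by
  ext σ
  simp [and_comm]

lemma card_permsInto_insert_congr {S : Finset ι} (T : Finset ι) {x y : ι} (hx : x ∉ S)
    (hy : y ∉ S) : (permsInto (insert x S) T).card = (permsInto (insert y S) T).card := by
  refine Finset.card_equiv (Equiv.mulRight (swap x y)) fun σ => ?_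
  have hfix : ∀ z ∈ S, swap x y z = z := fun z hz =>
    swap_apply_of_ne_of_ne (ne_of_mem_of_not_mem hz hx) (ne_of_mem_of_not_mem hz hy)
  simp +contextual [hfix]

lemma card_filter_compl_of_mem_permsInto {S T : Finset ι} {σ : Perm ι} (hσ : σ ∈ permsInto S T) :
    (Sᶜ.filter fun y => σ y ∈ T).card = T.card - S.card := by
  rw [mem_permsInto] at hσ
  have hsub : S ⊆ T.map σ.symm.toEmbedding := fun x hx => by simpa using hσ x hx
  rw [← Finset.card_map (s := T) σ.symm.toEmbedding, ← Finset.card_sdiff_of_subset hsub]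
  congr 1
  ext y
  simp [and_comm]

lemma card_permsInto_insert_mul (S T : Finset ι) {x : ι} (hx : x ∉ S) :
    (Fintype.card ι - S.card) * (permsInto (insert x S) T).card =
      (T.card - S.card) * (permsInto S T).card :=
  calc (Fintype.card ι - S.card) * (permsInto (insert x S) T).card
      = ∑ y ∈ Sᶜ, ((permsInto S T).filter fun σ => σ y ∈ T).card := by
        rw [← Finset.card_compl, ← smul_eq_mul, ← Finset.sum_const]
        refine Finset.sum_congr rfl fun y hy => ?_
        rw [filter_permsInto, card_permsInto_insert_congr T hx (Finset.mem_compl.1 hy)]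
    _ = ∑ σ ∈ permsInto S T, (Sᶜ.filter fun y => σ y ∈ T).card := by
        simp only [Finset.card_filter]
        exact Finset.sum_comm
    _ = (T.card - S.card) * (permsInto S T).card := by
        rw [Finset.sum_congr rfl fun σ => card_filter_compl_of_mem_permsInto, Finset.sum_const,
          smul_eq_mul, mul_comm]

lemma card_permsInto_insert_le (S T : Finset ι) {x : ι} (hx : x ∉ S) :
    Fintype.card ι * (permsInto (insert x S) T).card ≤ T.card * (permsInto S T).card := by
  have hS : S.card < Fintype.card ι := Finset.card_lt_univ_of_notMem hx
  have hT : T.card ≤ Fintype.card ι := Finset.card_le_univ T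
  have hratio : Fintype.card ι * (T.card - S.card) ≤ (Fintype.card ι - S.card) * T.card := by
    rw [Nat.mul_sub, Nat.sub_mul, mul_comm S.card]
    exact Nat.sub_le_sub_left (Nat.mul_le_mul_right _ hT) _
  refine le_of_mul_le_mul_left ?_ (Nat.sub_pos_of_lt hS)
  calc (Fintype.card ι - S.card) * (Fintype.card ι * (permsInto (insert x S) T).card)
      = Fintype.card ι * (T.card - S.card) * (permsInto S T).card := by
        rw [mul_left_comm, card_permsInto_insert_mul S T hx, mul_assoc]
    _ ≤ (Fintype.card ι - S.card) * T.card * (permsInto S T).card :=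
        Nat.mul_le_mul_right _ hratio
    _ = (Fintype.card ι - S.card) * (T.card * (permsInto S T).card) := mul_assoc ..

lemma card_pow_mul_card_permsInto_le (S T : Finset ι) :
    Fintype.card ι ^ S.card * (permsInto S T).card ≤
      T.card ^ S.card * (Fintype.card ι).factorial := by
  induction S using Finset.induction_on with
  | empty => simp [permsInto, Fintype.card_perm]
  | insert x S hx ih =>
    rw [Finset.card_insert_of_notMem hx]
    calc Fintype.card ι ^ (S.card + 1) * (permsInto (insert x S) T).card
        = Fintype.card ι ^ S.card * (Fintype.card ι * (permsInto (insert x S) T).card) := by ring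
      _ ≤ Fintype.card ι ^ S.card * (T.card * (permsInto S T).card) :=
        Nat.mul_le_mul_left _ (card_permsInto_insert_le S T hx)
      _ = T.card * (Fintype.card ι ^ S.card * (permsInto S T).card) := by ring
      _ ≤ T.card * (T.card ^ S.card * (Fintype.card ι).factorial) := Nat.mul_le_mul_left _ ih
      _ = T.card ^ (S.card + 1) * (Fintype.card ι).factorial := by ring

lemma card_permsInto_le (S T : Finset ι) :
    ((permsInto S T).card : ℝ) ≤
      ((T.card : ℝ) / Fintype.card ι) ^ S.card * (Fintype.card ι).factorial := by
  cases isEmpty_or_nonempty ι with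
  | inl _ => simp [S.eq_empty_of_isEmpty, permsInto]
  | inr _ =>
    rw [div_pow, div_mul_eq_mul_div, le_div_iff₀ (by positivity), mul_comm]
    exact_mod_cast card_pow_mul_card_permsInto_le S T

lemma card_filter_le_card_filter_mem_le (S T : Finset ι) (s : ℕ) :
    ((Finset.univ.filter fun σ : Perm ι => s ≤ (S.filter fun x => σ x ∈ T).card).card : ℝ) ≤
      ((S.card : ℝ) * T.card / Fintype.card ι) ^ s / s.factorial * (Fintype.card ι).factorial := by
  set M : ℝ := ((T.card : ℝ) / Fintype.card ι) ^ s * (Fintype.card ι).factorial with hM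
  have hunion : (Finset.univ.filter fun σ : Perm ι => s ≤ (S.filter fun x => σ x ∈ T).card) ⊆
      (S.powersetCard s).biUnion fun S' => permsInto S' T := by
    intro σ hσ
    obtain ⟨S', hS', hcard⟩ := Finset.exists_subset_card_eq (Finset.mem_filter.1 hσ).2
    refine Finset.mem_biUnion.2 ⟨S', Finset.mem_powersetCard.2
      ⟨hS'.trans (Finset.filter_subset _ _), hcard⟩, ?_⟩
    exact mem_permsInto.2 fun x hx => (Finset.mem_filter.1 (hS' hx)).2
  have hinto : ∀ S' ∈ S.powersetCard s, ((permsInto S' T).card : ℝ) ≤ M := fun S' hS' => by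
    rw [hM, ← (Finset.mem_powersetCard.1 hS').2]
    exact card_permsInto_le S' T
  calc ((Finset.univ.filter fun σ : Perm ι => s ≤ (S.filter fun x => σ x ∈ T).card).card : ℝ)
      ≤ ∑ S' ∈ S.powersetCard s, ((permsInto S' T).card : ℝ) := by
        exact_mod_cast (Finset.card_le_card hunion).trans Finset.card_biUnion_le
    _ ≤ S.card.choose s * M := by
        rw [← nsmul_eq_mul, ← Finset.card_powersetCard]
        exact Finset.sum_le_card_nsmul _ _ _ hinto
    _ ≤ (S.card : ℝ) ^ s / s.factorial * M := by
        gcongr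
        exact Nat.choose_le_pow_div s S.card
    _ = _ := by
        rw [hM, mul_div_assoc, mul_pow]
        ring

end Permutations

section Corners

open Equiv

variable {n : ℕ} {α β : Perm (Fin n)}

/-- The elements that are among the first `a` of `α` and among the last `c` of `β`, where a
permutation is read as the list of its values. -/
def corner (α β : Perm (Fin n)) (a c : ℕ) : Finset (Fin n) :=
  {p | (α⁻¹ p : ℕ) < a ∧ n ≤ (β⁻¹ p : ℕ) + c}

lemma mem_corner {a c : ℕ} {p : Fin n} :
    p ∈ corner α β a c ↔ (α⁻¹ p : ℕ) < a ∧ n ≤ (β⁻¹ p : ℕ) + c := by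
  simp [corner]

lemma corner_mono {a c a' c' : ℕ} (ha : a' ≤ a) (hc : c' ≤ c) :
    corner α β a' c' ⊆ corner α β a c := by
  intro p hp
  rw [mem_corner] at hp ⊢
  omega

lemma card_filter_inv_lt (α : Perm (Fin n)) {a : ℕ} (ha : a ≤ n) :
    (Finset.univ.filter fun p => (α⁻¹ p : ℕ) < a).card = a := by
  rw [Finset.card_equiv (t := Finset.univ.filter fun j : Fin n => (j : ℕ) < a) α⁻¹ (by simp),
    Fin.card_filter_val_lt, min_eq_right ha]

lemma card_filter_le_val_add {c : ℕ} (hc : c ≤ n) :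
    (Finset.univ.filter fun j : Fin n => n ≤ (j : ℕ) + c).card = c := by
  rw [Finset.card_equiv (t := Finset.univ.filter fun j : Fin n => (j : ℕ) < c) Fin.revPerm,
    Fin.card_filter_val_lt, min_eq_right hc]
  intro j
  simp only [Finset.mem_filter, Finset.mem_univ, true_and, Fin.revPerm_apply, Fin.val_rev]
  omega

lemma corner_eq_filter (α β : Perm (Fin n)) (a c : ℕ) :
    corner α β a c = (Finset.univ.filter fun p => (α⁻¹ p : ℕ) < a).filter fun p =>
      β⁻¹ p ∈ Finset.univ.filter fun j : Fin n => n ≤ (j : ℕ) + c := by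
  ext p
  simp [mem_corner]

lemma card_filter_corner_eq_empty_le (α : Perm (Fin n)) {a c : ℕ} (ha : a ≤ n) (hc : c ≤ n) :
    ((Finset.univ.filter fun β : Perm (Fin n) => corner α β a c = ∅).card : ℝ) ≤
      Real.exp (-((a : ℝ) * c / n)) * n.factorial := by
  set S := Finset.univ.filter fun p => (α⁻¹ p : ℕ) < a
  set T := Finset.univ.filter fun j : Fin n => (j : ℕ) < n - c
  have hcard : (Finset.univ.filter fun β : Perm (Fin n) => corner α β a c = ∅).card =
      (permsInto S T).card := by
    refine Finset.card_equiv (Equiv.inv _) fun β => ?_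
    have hiff (p : Fin n) : ¬n ≤ (β⁻¹ p : ℕ) + c ↔ (β⁻¹ p : ℕ) < n - c := by omega
    simp only [Finset.mem_filter, Finset.mem_univ, true_and, Finset.eq_empty_iff_forall_notMem,
      mem_corner, not_and, hiff, Equiv.inv_apply, mem_permsInto, S, T]
  have hbase : ((n - c : ℕ) : ℝ) / n ≤ Real.exp (-((c : ℝ) / n)) := by
    rcases n.eq_zero_or_pos with rfl | hn
    · simp
    · rw [Nat.cast_sub hc, sub_div, div_self (by positivity)]
      exact Real.one_sub_le_exp_neg _
  have hcard_le := card_permsInto_le S T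
  rw [Fintype.card_fin, card_filter_inv_lt α ha, Fin.card_filter_val_lt,
    min_eq_right (Nat.sub_le _ _)] at hcard_le
  calc ((Finset.univ.filter fun β : Perm (Fin n) => corner α β a c = ∅).card : ℝ)
      ≤ (((n - c : ℕ) : ℝ) / n) ^ a * n.factorial := by rwa [hcard]
    _ ≤ Real.exp (-((c : ℝ) / n)) ^ a * n.factorial := by gcongr
    _ = Real.exp (-((a : ℝ) * c / n)) * n.factorial := by
        rw [← Real.exp_nat_mul]
        ring_nf

lemma card_filter_le_card_corner_le (α : Perm (Fin n)) {a c : ℕ} (ha : a ≤ n) (hc : c ≤ n)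
    (s : ℕ) :
    ((Finset.univ.filter fun β : Perm (Fin n) => s ≤ (corner α β a c).card).card : ℝ) ≤
      ((a : ℝ) * c / n) ^ s / s.factorial * n.factorial := by
  have hle := card_filter_le_card_filter_mem_le (Finset.univ.filter fun p => (α⁻¹ p : ℕ) < a)
    (Finset.univ.filter fun j : Fin n => n ≤ (j : ℕ) + c) s
  rw [card_filter_inv_lt α ha, card_filter_le_val_add hc, Fintype.card_fin] at hle
  refine le_trans (le_of_eq ?_) hle
  rw [Finset.card_equiv (Equiv.inv _) fun β => ?_]
  simp only [Finset.mem_filter_univ, corner_eq_filter, Equiv.inv_apply]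

/-- `PairWin α β m a c`: with `m` faults one can search the elements of `corner α β a c`, where the
search of an element `q` removes the elements after `q` in `α` or those before `q` in `β`. -/
def PairWin (α β : Perm (Fin n)) : ℕ → ℕ → ℕ → Prop
  | 0, a, c => corner α β a c = ∅
  | m + 1, a, c => corner α β a c = ∅ ∨ ∃ q ∈ corner α β a c,
      PairWin α β m (α⁻¹ q : ℕ) c ∧ PairWin α β m a (n - ((β⁻¹ q : ℕ) + 1))

lemma PairWin.succ {m a c : ℕ} (h : PairWin α β m a c) : PairWin α β (m + 1) a c := by
  induction m generalizing a c with
  | zero => exact Or.inl h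
  | succ m ih =>
    obtain hempty | ⟨q, hq, hα, hβ⟩ := h
    · exact Or.inl hempty
    · exact Or.inr ⟨q, hq, ih hα, ih hβ⟩

lemma PairWin.of_le {m m' a c : ℕ} (h : PairWin α β m a c) (hm : m ≤ m') :
    PairWin α β m' a c := by
  induction hm with
  | refl => exact h
  | step _ ih => exact ih.succ

lemma exists_mem_corner_card_lt {a c u : ℕ} (hu : u < (corner α β a c).card) :
    ∃ q ∈ corner α β a c, (corner α β (α⁻¹ q) c).card ≤ u ∧
      (corner α β a (n - ((β⁻¹ q : ℕ) + 1))).card + u < (corner α β a c).card := by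
  classical
  have hex : ∃ a', u < (corner α β a' c).card := ⟨a, hu⟩
  set a' := Nat.find hex
  have hspec : u < (corner α β a' c).card := Nat.find_spec hex
  have ha' : a' ≤ a := Nat.find_min' hex hu
  obtain ⟨q, hq, hmax⟩ := Finset.exists_max_image (corner α β a' c) (fun p => (β⁻¹ p : ℕ))
    (Finset.card_pos.1 (by omega))
  have hdisj : Disjoint (corner α β a (n - ((β⁻¹ q : ℕ) + 1))) (corner α β a' c) := by
    refine Finset.disjoint_left.2 fun p hp hp' => ?_
    have := hmax p hp'
    have := (mem_corner.1 hp).2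
    have := (β⁻¹ q).isLt
    omega
  have hunion := Finset.card_le_card <| Finset.union_subset
    (corner_mono (α := α) (β := β) (le_refl a)
      (by have := (mem_corner.1 hq).2; omega : n - ((β⁻¹ q : ℕ) + 1) ≤ c))
    (corner_mono ha' (le_refl c))
  rw [Finset.card_union_of_disjoint hdisj] at hunion
  exact ⟨q, corner_mono ha' le_rfl hq, not_lt.1 (Nat.find_min hex (mem_corner.1 hq).1), by omega⟩

lemma pairWin_of_card_corner_lt {m a c : ℕ} (h : (corner α β a c).card < 2 ^ m) :
    PairWin α β m a c := by
  induction m generalizing a c with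
  | zero => exact Finset.card_eq_zero.1 (Nat.lt_one_iff.1 h)
  | succ m ih =>
    rcases (corner α β a c).eq_empty_or_nonempty with hempty | hne
    · exact Or.inl hempty
    · have := hne.card_pos
      obtain ⟨q, hq, hα, hβ⟩ := exists_mem_corner_card_lt
        (by omega : (corner α β a c).card / 2 < (corner α β a c).card)
      rw [pow_succ] at h
      exact Or.inr ⟨q, hq, ih (by omega), ih (by omega)⟩

/-- Corners of area at least `w * n` are not empty, and those of area at most `8 * w * n` have fewer
than `s` elements. -/
def GoodPair (w s : ℕ) (α β : Perm (Fin n)) : Prop :=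
  ∀ a ≤ n, ∀ c ≤ n, (w * n ≤ a * c → (corner α β a c).Nonempty) ∧
    (a * c ≤ 8 * w * n → (corner α β a c).card < s)

lemma exists_balanced_le {a c W : ℕ} (hW : W ≤ a * c) :
    ∃ x ≤ a, ∃ y ≤ c, W ≤ x * y ∧ (∀ x' < x, (x' * c) ^ 2 < a * c * W) ∧
      ∀ y' < y, (a * y') ^ 2 < a * c * W := by
  classical
  have hac : a * c * W ≤ (a * c) ^ 2 := by
    rw [pow_two]
    exact Nat.mul_le_mul_left _ hW
  have hx : ∃ x, a * c * W ≤ (x * c) ^ 2 := ⟨a, hac⟩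
  have hy : ∃ y, a * c * W ≤ (a * y) ^ 2 := ⟨c, hac⟩
  refine ⟨Nat.find hx, Nat.find_min' hx hac, Nat.find hy, Nat.find_min' hy hac, ?_,
    fun x' hx' => not_le.1 (Nat.find_min hx hx'), fun y' hy' => not_le.1 (Nat.find_min hy hy')⟩
  rcases (a * c).eq_zero_or_pos with h0 | hpos
  · omega
  · refine Nat.le_of_mul_le_mul_left ((Nat.pow_le_pow_iff_left two_ne_zero).1 ?_) hpos
    calc (a * c * W) ^ 2 = (a * c * W) * (a * c * W) := pow_two _
      _ ≤ (Nat.find hx * c) ^ 2 * (a * Nat.find hy) ^ 2 :=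
        Nat.mul_le_mul (Nat.find_spec hx) (Nat.find_spec hy)
      _ = (a * c * (Nat.find hx * Nat.find hy)) ^ 2 := by ring

lemma GoodPair.pairWin {w s R : ℕ} (h : GoodPair w s α β) (hs : s ≤ 2 ^ R) {m a c : ℕ}
    (ha : a ≤ n) (hc : c ≤ n) (hac : a * c ≤ 4 * (w * n) * 2 ^ 2 ^ m) :
    PairWin α β (m + R) a c := by
  have hsmall {a c : ℕ} (ha : a ≤ n) (hc : c ≤ n) (hac : a * c ≤ 8 * w * n) : PairWin α β R a c :=
    pairWin_of_card_corner_lt (((h a ha c hc).2 hac).trans_le hs)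
  induction m generalizing a c with
  | zero =>
    rw [zero_add]
    exact hsmall ha hc (hac.trans_eq (by ring))
  | succ m ih =>
    by_cases hle : a * c ≤ 8 * w * n
    · exact (hsmall ha hc hle).of_le (by omega)
    obtain ⟨x, hxa, y, hyc, hxy, hx, hy⟩ :=
      exists_balanced_le (a := a) (c := c) (W := w * n) (by nlinarith)
    obtain ⟨q, hq⟩ := (h x (hxa.trans ha) y (hyc.trans hc)).1 hxy
    obtain ⟨hqx, hqy⟩ := mem_corner.1 hq
    have hsqrt {z : ℕ} (hz : z ^ 2 < a * c * (w * n)) : z ≤ 4 * (w * n) * 2 ^ 2 ^ m := by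
      refine (Nat.pow_le_pow_iff_left two_ne_zero).1 (hz.le.trans ?_)
      calc a * c * (w * n) ≤ 4 * (w * n) * 2 ^ 2 ^ (m + 1) * (w * n) :=
            Nat.mul_le_mul_right _ hac
        _ = 4 * ((w * n) * 2 ^ 2 ^ m) ^ 2 := by rw [pow_succ 2 m, pow_mul]; ring
        _ ≤ 16 * ((w * n) * 2 ^ 2 ^ m) ^ 2 := Nat.mul_le_mul_right _ (by norm_num)
        _ = (4 * (w * n) * 2 ^ 2 ^ m) ^ 2 := by ring
    rw [show m + 1 + R = m + R + 1 by omega]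
    exact Or.inr ⟨q, corner_mono hxa hyc hq, ih (by omega) hc (hsqrt (hx _ hqx)),
      ih ha (by omega) (hsqrt (hy _ (by have := (β⁻¹ q).isLt; omega)))⟩

end Corners

section GoodPairs

open Equiv

variable {n : ℕ}

lemma inv_pow_le_of_le_two_pow {g : ℝ} {l : ℕ} (hg : 0 < g) (hgl : g ≤ 2 ^ l) (m : ℕ) :
    ((2 : ℝ) ^ (m * l))⁻¹ ≤ (g ^ m)⁻¹ := by
  rw [mul_comm, pow_mul]
  gcongr

lemma exp_neg_le_inv_two_pow (m : ℕ) : Real.exp (-(m : ℝ)) ≤ ((2 : ℝ) ^ m)⁻¹ := by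
  have htwo : (2 : ℝ) ≤ Real.exp 1 := by linarith [Real.add_one_le_exp (1 : ℝ)]
  rw [Real.exp_neg, ← mul_one (m : ℝ), Real.exp_nat_mul]
  gcongr

lemma pow_div_factorial_le_inv_two_pow (m : ℕ) :
    (m : ℝ) ^ (4 * m) / (4 * m).factorial ≤ ((2 : ℝ) ^ m)⁻¹ := by
  have hexp_two : Real.exp 2 ≤ 2 ^ 3 := by
    rw [← one_add_one_eq_two, Real.exp_add]
    nlinarith [Real.exp_one_lt_d9, Real.exp_pos 1]
  have hexp : (2 * (m : ℝ)) ^ (4 * m) / (4 * m).factorial ≤ 2 ^ (3 * m) :=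
    calc (2 * (m : ℝ)) ^ (4 * m) / (4 * m).factorial ≤ Real.exp (2 * m) :=
          Real.pow_div_factorial_le_exp _ (by positivity) _
      _ = Real.exp 2 ^ m := by rw [← Real.exp_nat_mul, mul_comm]
      _ ≤ (2 ^ 3) ^ m := by gcongr
      _ = 2 ^ (3 * m) := (pow_mul ..).symm
  rw [← one_div, le_div_iff₀ (by positivity)]
  refine le_of_mul_le_mul_right ?_ (by positivity : (0 : ℝ) < 2 ^ (3 * m))
  calc (m : ℝ) ^ (4 * m) / (4 * m).factorial * 2 ^ m * 2 ^ (3 * m)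
      = (2 * (m : ℝ)) ^ (4 * m) / (4 * m).factorial := by
        rw [mul_assoc, ← pow_add, mul_pow, show m + 3 * m = 4 * m by ring]
        ring
    _ ≤ 1 * 2 ^ (3 * m) := by rwa [one_mul]

/-- `GoodPair` with the parameters for which most permutations qualify. -/
def Good (α β : Perm (Fin n)) : Prop :=
  GoodPair (5 * Nat.clog 2 n) (160 * Nat.clog 2 n) α β

lemma le_two_pow_clog (n : ℕ) : (n : ℝ) ≤ 2 ^ Nat.clog 2 n := by
  exact_mod_cast Nat.le_pow_clog one_lt_two n

lemma card_filter_corner_eq_empty_le_of_le_mul (hn : 0 < n) (α : Perm (Fin n)) {a c : ℕ}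
    (ha : a ≤ n) (hc : c ≤ n) (hac : 5 * Nat.clog 2 n * n ≤ a * c) :
    ((Finset.univ.filter fun β : Perm (Fin n) => corner α β a c = ∅).card : ℝ) ≤
      ((n : ℝ) ^ 5)⁻¹ * n.factorial := by
  refine (card_filter_corner_eq_empty_le α ha hc).trans ?_
  gcongr
  calc Real.exp (-((a : ℝ) * c / n)) ≤ Real.exp (-((5 * Nat.clog 2 n : ℕ) : ℝ)) := by
        rw [Real.exp_le_exp, neg_le_neg_iff, le_div_iff₀ (by positivity)]
        exact_mod_cast hac
    _ ≤ ((2 : ℝ) ^ (5 * Nat.clog 2 n))⁻¹ := exp_neg_le_inv_two_pow _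
    _ ≤ ((n : ℝ) ^ 5)⁻¹ := inv_pow_le_of_le_two_pow (by positivity) (le_two_pow_clog n) 5

lemma card_filter_le_card_corner_le_of_mul_le (hn : 0 < n) (α : Perm (Fin n)) {a c : ℕ}
    (ha : a ≤ n) (hc : c ≤ n) (hac : a * c ≤ 8 * (5 * Nat.clog 2 n) * n) :
    ((Finset.univ.filter fun β : Perm (Fin n) =>
      160 * Nat.clog 2 n ≤ (corner α β a c).card).card : ℝ) ≤ ((n : ℝ) ^ 5)⁻¹ * n.factorial := by
  refine (card_filter_le_card_corner_le α ha hc _).trans ?_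
  gcongr
  have hdiv : (a : ℝ) * c / n ≤ (40 * Nat.clog 2 n : ℕ) := by
    rw [div_le_iff₀ (by positivity)]
    exact_mod_cast hac.trans_eq (by ring)
  calc ((a : ℝ) * c / n) ^ (160 * Nat.clog 2 n) / (160 * Nat.clog 2 n).factorial
      ≤ ((40 * Nat.clog 2 n : ℕ) : ℝ) ^ (4 * (40 * Nat.clog 2 n)) /
          (4 * (40 * Nat.clog 2 n)).factorial := by
        rw [show 4 * (40 * Nat.clog 2 n) = 160 * Nat.clog 2 n by ring]
        gcongr
    _ ≤ ((2 : ℝ) ^ (40 * Nat.clog 2 n))⁻¹ := pow_div_factorial_le_inv_two_pow _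
    _ ≤ ((2 : ℝ) ^ (5 * Nat.clog 2 n))⁻¹ := by
        gcongr
        · exact one_le_two
        · norm_num
    _ ≤ ((n : ℝ) ^ 5)⁻¹ := inv_pow_le_of_le_two_pow (by positivity) (le_two_pow_clog n) 5

lemma card_filter_bad_corner_le (hn : 0 < n) (α : Perm (Fin n)) {a c : ℕ} (ha : a ≤ n)
    (hc : c ≤ n) :
    ((Finset.univ.filter fun β : Perm (Fin n) =>
      (5 * Nat.clog 2 n * n ≤ a * c ∧ corner α β a c = ∅) ∨
        (a * c ≤ 8 * (5 * Nat.clog 2 n) * n ∧ 160 * Nat.clog 2 n ≤ (corner α β a c).card)).card :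
      ℝ) ≤ 2 * (((n : ℝ) ^ 5)⁻¹ * n.factorial) := by
  have hbound : (0 : ℝ) ≤ ((n : ℝ) ^ 5)⁻¹ * n.factorial := by positivity
  have hempty : ((Finset.univ.filter fun β : Perm (Fin n) =>
      5 * Nat.clog 2 n * n ≤ a * c ∧ corner α β a c = ∅).card : ℝ) ≤
        ((n : ℝ) ^ 5)⁻¹ * n.factorial := by
    by_cases hac : 5 * Nat.clog 2 n * n ≤ a * c
    · simpa only [hac, true_and] using card_filter_corner_eq_empty_le_of_le_mul hn α ha hc hac
    · simpa only [hac, false_and, Finset.filter_false, Finset.card_empty, Nat.cast_zero]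
  have hlarge : ((Finset.univ.filter fun β : Perm (Fin n) => a * c ≤ 8 * (5 * Nat.clog 2 n) * n ∧
      160 * Nat.clog 2 n ≤ (corner α β a c).card).card : ℝ) ≤
        ((n : ℝ) ^ 5)⁻¹ * n.factorial := by
    by_cases hac : a * c ≤ 8 * (5 * Nat.clog 2 n) * n
    · simpa only [hac, true_and] using card_filter_le_card_corner_le_of_mul_le hn α ha hc hac
    · simpa only [hac, false_and, Finset.filter_false, Finset.card_empty, Nat.cast_zero]
  rw [Finset.filter_or, two_mul]
  refine le_trans ?_ (add_le_add hempty hlarge)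
  exact_mod_cast Finset.card_union_le _ _

open Classical in
lemma card_filter_not_good_le (hn : 0 < n) (α : Perm (Fin n)) :
    ((Finset.univ.filter fun β => ¬ Good α β).card : ℝ) ≤
      (n + 1 : ℕ) ^ 2 * (2 * (((n : ℝ) ^ 5)⁻¹ * n.factorial)) := by
  set I := Finset.range (n + 1) ×ˢ Finset.range (n + 1)
  let E : ℕ × ℕ → Finset (Perm (Fin n)) := fun z => {β |
    (5 * Nat.clog 2 n * n ≤ z.1 * z.2 ∧ corner α β z.1 z.2 = ∅) ∨
      (z.1 * z.2 ≤ 8 * (5 * Nat.clog 2 n) * n ∧ 160 * Nat.clog 2 n ≤ (corner α β z.1 z.2).card)}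
  have hsub : (Finset.univ.filter fun β => ¬ Good α β) ⊆ I.biUnion E := by
    intro β hβ
    simp only [Good, GoodPair, Finset.mem_filter_univ, not_forall, not_and_or,
      Finset.not_nonempty_iff_eq_empty, not_lt, exists_prop] at hβ
    obtain ⟨a, ha, c, hc, hac⟩ := hβ
    refine Finset.mem_biUnion.2 ⟨(a, c), ?_, Finset.mem_filter_univ _ |>.2 hac⟩
    exact Finset.mem_product.2 ⟨Finset.mem_range_succ_iff.2 ha, Finset.mem_range_succ_iff.2 hc⟩
  have hE : ∀ z ∈ I, ((E z).card : ℝ) ≤ 2 * (((n : ℝ) ^ 5)⁻¹ * n.factorial) := fun z hz => by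
    simp only [I, Finset.mem_product, Finset.mem_range_succ_iff] at hz
    simpa only [E] using card_filter_bad_corner_le hn α hz.1 hz.2
  calc ((Finset.univ.filter fun β => ¬ Good α β).card : ℝ)
      ≤ ∑ z ∈ I, ((E z).card : ℝ) := by
        exact_mod_cast (Finset.card_le_card hsub).trans Finset.card_biUnion_le
    _ ≤ I.card • (2 * (((n : ℝ) ^ 5)⁻¹ * n.factorial)) := Finset.sum_le_card_nsmul _ _ _ hE
    _ = _ := by
        rw [nsmul_eq_mul, Finset.card_product, Finset.card_range, Nat.cast_mul, pow_two]

open Classical in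
lemma mul_card_filter_not_good_le (hn : 3 ≤ n) (α : Perm (Fin n)) :
    (n : ℝ) * (Finset.univ.filter fun β => ¬ Good α β).card ≤ n.factorial := by
  have hn' : (3 : ℝ) ≤ n := by exact_mod_cast hn
  have hpow : 2 * ((n : ℝ) + 1) ^ 2 ≤ (n : ℝ) ^ 4 := by nlinarith [sq_nonneg ((n : ℝ) ^ 2 - 9)]
  calc (n : ℝ) * (Finset.univ.filter fun β => ¬ Good α β).card
      ≤ n * ((n + 1 : ℕ) ^ 2 * (2 * (((n : ℝ) ^ 5)⁻¹ * n.factorial))) := by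
        gcongr
        exact card_filter_not_good_le (by omega) α
    _ = 2 * ((n : ℝ) + 1) ^ 2 * ((n : ℝ) ^ 4)⁻¹ * n.factorial := by
        push_cast
        field_simp
    _ ≤ (n : ℝ) ^ 4 * ((n : ℝ) ^ 4)⁻¹ * n.factorial := by gcongr
    _ = n.factorial := by rw [mul_inv_cancel₀ (by positivity), one_mul]

/-- A number of faults that suffices to search the whole of a good pair. -/
def pairRank (n : ℕ) : ℕ := 2 * Nat.clog 2 (Nat.clog 2 n) + 8

lemma Good.pairWin {α β : Perm (Fin n)} (h : Good α β) {a c : ℕ} (ha : a ≤ n) (hc : c ≤ n) :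
    PairWin α β (pairRank n) a c := by
  rcases lt_or_ge n 2 with hn | hn
  · refine pairWin_of_card_corner_lt (((Finset.card_le_univ _).trans_lt ?_).trans_le
      (Nat.pow_le_pow_right two_pos (Nat.le_add_left 8 _)))
    rw [Fintype.card_fin]
    omega
  set l := Nat.clog 2 n with hl
  have hl_pos : 0 < l := Nat.clog_pos one_lt_two hn
  have hl_le : l ≤ 2 ^ Nat.clog 2 l := Nat.le_pow_clog one_lt_two l
  have hs : 160 * l ≤ 2 ^ (Nat.clog 2 l + 8) := by
    rw [pow_add]
    omega
  have hn_le : n ≤ 2 ^ 2 ^ Nat.clog 2 l :=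
    (Nat.le_pow_clog one_lt_two n).trans (Nat.pow_le_pow_right two_pos hl_le)
  refine (GoodPair.pairWin h hs (m := Nat.clog 2 l) ha hc ?_).of_le ?_
  · exact Nat.mul_le_mul (ha.trans (by nlinarith)) (hc.trans hn_le)
  · rw [pairRank, ← hl]
    omega

end GoodPairs

section Blocks

open Equiv

/-- The `j`-th entry of a permutation of `0, …, f`, as a function of natural numbers (the value for
`f < j` is irrelevant). -/
def entry {f : ℕ} (σ : Perm (Fin (f + 1))) (j : ℕ) : ℕ := σ (Fin.ofNat (f + 1) j)

variable {f : ℕ}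

lemma entry_le (σ : Perm (Fin (f + 1))) (j : ℕ) : entry σ j ≤ f :=
  Nat.le_of_lt_succ (σ _).isLt

lemma entry_val (σ : Perm (Fin (f + 1))) (j : Fin (f + 1)) : entry σ j = σ j := by
  simp [entry]

lemma entry_inv (σ : Perm (Fin (f + 1))) (p : Fin (f + 1)) :
    entry σ (σ⁻¹ p : Fin (f + 1)) = p := by
  simp [entry_val]

lemma entry_inj {σ : Perm (Fin (f + 1))} {i j : ℕ} (hi : i ≤ f) (hj : j ≤ f)
    (h : entry σ i = entry σ j) : i = j := by
  lift i to Fin (f + 1) using Nat.lt_succ_of_le hi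
  lift j to Fin (f + 1) using Nat.lt_succ_of_le hj
  rw [entry_val, entry_val] at h
  rw [σ.injective (Fin.ext h)]

lemma exists_entry_eq (σ : Perm (Fin (f + 1))) {p : ℕ} (hp : p ≤ f) : ∃ j ≤ f, entry σ j = p :=
  ⟨_, Nat.le_of_lt_succ (σ⁻¹ ⟨p, Nat.lt_succ_of_le hp⟩).isLt, entry_inv σ _⟩

/-- The labels of a path that consists of cells of length `k`: the `i`-th cell starts with a block
of the first `f` entries of the permutation `π i` of the pages `0, …, f`, followed by a separator
that consists of the pages `f + 1, …, k`. -/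
def blockLab (f k : ℕ) (π : ℕ → Perm (Fin (f + 1))) (x : ℕ) : ℕ :=
  if x % k < f then entry (π (x / k)) (x % k) else x % k + 1

variable {k : ℕ} {π : ℕ → Perm (Fin (f + 1))}

lemma exists_eq_mul_add (hk : 0 < k) (x : ℕ) : ∃ i j, j < k ∧ x = i * k + j :=
  ⟨x / k, x % k, Nat.mod_lt x hk, (Nat.div_add_mod' x k).symm⟩

lemma mul_add_div_of_lt {i j : ℕ} (hj : j < k) : (i * k + j) / k = i := by
  rw [mul_comm, Nat.mul_add_div (Nat.zero_lt_of_lt hj), Nat.div_eq_of_lt hj, add_zero]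

lemma mul_add_mod_of_lt {i j : ℕ} (hj : j < k) : (i * k + j) % k = j := by
  rw [mul_comm, Nat.mul_add_mod, Nat.mod_eq_of_lt hj]

lemma blockLab_mul_add {i j : ℕ} (hj : j < k) :
    blockLab f k π (i * k + j) = if j < f then entry (π i) j else j + 1 := by
  rw [blockLab, mul_add_div_of_lt hj, mul_add_mod_of_lt hj]

lemma blockLab_of_lt {i j : ℕ} (hj : j < k) (hjf : j < f) :
    blockLab f k π (i * k + j) = entry (π i) j := by
  rw [blockLab_mul_add hj, if_pos hjf]

lemma blockLab_of_le {i j : ℕ} (hj : j < k) (hjf : f ≤ j) :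
    blockLab f k π (i * k + j) = j + 1 := by
  rw [blockLab_mul_add hj, if_neg (by omega)]

lemma blockLab_le (hk : 0 < k) (hfk : f ≤ k) (x : ℕ) : blockLab f k π x ≤ k := by
  obtain ⟨i, j, hj, rfl⟩ := exists_eq_mul_add hk x
  rw [blockLab_mul_add hj]
  have := entry_le (π i) j
  split_ifs <;> omega

lemma eq_of_blockLab_mul_add_eq {i j j' : ℕ} (hj : j < k) (hj' : j' < k)
    (h : blockLab f k π (i * k + j) = blockLab f k π (i * k + j')) : j = j' := by
  rw [blockLab_mul_add hj, blockLab_mul_add hj'] at h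
  have hle := entry_le (π i) j
  have hle' := entry_le (π i) j'
  split_ifs at h with hjf hjf'
  · exact entry_inj hjf.le hjf'.le h
  all_goals omega

lemma exists_cells_of_blockLab_eq (hk : 0 < k) {x y : ℕ} (hxy : x < y)
    (h : blockLab f k π x = blockLab f k π y) :
    ∃ i i' j j', i < i' ∧ j < k ∧ j' < k ∧ x = i * k + j ∧ y = i' * k + j' ∧
      (j = j' ∨ j < f ∧ j' < f ∧ entry (π i) j = entry (π i') j') := by
  obtain ⟨i, j, hj, rfl⟩ := exists_eq_mul_add hk x
  obtain ⟨i', j', hj', rfl⟩ := exists_eq_mul_add hk y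
  refine ⟨i, i', j, j', ?_, hj, hj', rfl, rfl, ?_⟩
  · rcases lt_trichotomy i i' with hlt | rfl | hgt
    · exact hlt
    · have := eq_of_blockLab_mul_add_eq hj hj' h
      omega
    · have := Nat.mul_le_mul_right k (Nat.succ_le_of_lt hgt)
      rw [Nat.succ_mul] at this
      omega
  · rw [blockLab_mul_add hj, blockLab_mul_add hj'] at h
    have hle := entry_le (π i) j
    have hle' := entry_le (π i') j'
    split_ifs at h with hjf hjf'
    · exact Or.inr ⟨hjf, hjf', h⟩
    all_goals omega

lemma add_le_of_blockLab_eq (hk : 0 < k) (hf : 1 ≤ f) {x y : ℕ} (hxy : x < y)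
    (h : blockLab f k π x = blockLab f k π y) : x + (k - f + 1) ≤ y := by
  obtain ⟨i, i', j, j', hi, _, hj', rfl, rfl, hjj'⟩ := exists_cells_of_blockLab_eq hk hxy h
  have := Nat.mul_le_mul_right k (Nat.succ_le_of_lt hi)
  rw [Nat.succ_mul] at this
  rcases hjj' with rfl | ⟨hjf, _, -⟩ <;> omega

lemma add_lt_of_blockLab_eq (hk : 0 < k) (hf : 2 ≤ f) (hfk : f ≤ k) {m x y : ℕ} (hxy : x < y)
    (hy : y < m * k) (hne : ∀ i, i + 1 < m → entry (π i) (f - 1) ≠ entry (π (i + 1)) 0)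
    (h : blockLab f k π x = blockLab f k π y) : x + (k - f + 1) < y := by
  obtain ⟨i, i', j, j', hi, hj, hj', rfl, rfl, hjj'⟩ := exists_cells_of_blockLab_eq hk hxy h
  have hm : i' < m := Nat.lt_of_mul_lt_mul_right ((Nat.le_add_right _ _).trans_lt hy)
  rcases (Nat.succ_le_of_lt hi).eq_or_lt with rfl | hlt
  · rw [Nat.succ_mul]
    rcases hjj' with rfl | ⟨hjf, hjf', heq⟩
    · omega
    · by_contra! hle
      obtain ⟨rfl, rfl⟩ : j = f - 1 ∧ j' = 0 := by omega
      exact hne i hm heq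
  · have := Nat.mul_le_mul_right k (Nat.succ_le_of_lt hlt)
    simp only [Nat.succ_mul] at this
    omega

lemma card_filter_blockLab_le {P : Type} [DecidableEq P] {pg : ℕ → P} (hk : 0 < k) (hfk : f ≤ k)
    (hpg : Set.InjOn pg (Set.Iic k)) (m : ℕ) (p : P) :
    ((Finset.range (m * k)).filter fun x => pg (blockLab f k π x) = p).card ≤ m := by
  rw [← Finset.card_range m]
  refine Finset.card_le_card_of_injOn (· / k) (fun x hx => ?_) fun x hx y hy hxy => ?_
  · simp only [Finset.coe_filter, Finset.mem_range, Set.mem_ofPred_eq] at hx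
    simpa [Nat.div_lt_iff_lt_mul hk] using hx.1
  · have hlab := hpg (blockLab_le hk hfk x) (blockLab_le hk hfk y)
      ((Finset.mem_filter.1 hx).2.trans (Finset.mem_filter.1 hy).2.symm)
    obtain ⟨i, j, hj, rfl⟩ := exists_eq_mul_add hk x
    obtain ⟨i', j', hj', rfl⟩ := exists_eq_mul_add hk y
    obtain rfl : i = i' := by simpa only [mul_add_div_of_lt, hj, hj'] using hxy
    rw [eq_of_blockLab_mul_add_eq hj hj' hlab]

end Blocks

section BlockGame

open Equiv

lemma WinsPhase.of_forall_mem {P : Type} [DecidableEq P] {lab : ℕ → P} {N k n l r : ℕ}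
    {Q : Finset P} {q : P} (hq : q ∈ Q) (hlr : l ≤ r) (hr : r < N)
    (hcard : ((Finset.Icc l r).image lab).card ≤ k)
    (h : ∀ l' r', l' ≤ l → r ≤ r' → r' < N → q ∈ (Finset.Icc l' r').image lab →
      ((Finset.Icc l' r').image lab).card ≤ k → WinsPhase N lab Q k n (Finset.Icc l' r')) :
    WinsPhase N lab Q k (n + 1) (Finset.Icc l r) := by
  by_cases hqlr : q ∈ (Finset.Icc l r).image lab
  · exact (h l r le_rfl le_rfl hr hqlr hcard).succ
  · refine ⟨q, hq, hqlr, fun l' r' hsub => ?_⟩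
    rw [Finset.Icc_subset_Icc_iff hlr] at hsub
    exact h l' r' hsub.1 hsub.2

lemma WinsPhase.comp {P P' : Type} [DecidableEq P] [DecidableEq P'] {lab : ℕ → P} {N k n : ℕ}
    {Q : Finset P} {pg : P → P'} {I : Finset ℕ} (hpg : Set.InjOn pg Q) (hlab : ∀ x, lab x ∈ Q)
    (h : WinsPhase N lab Q k n I) : WinsPhase N (pg ∘ lab) (Q.image pg) k n I := by
  induction n generalizing I with
  | zero => exact h.elim
  | succ n ih =>
    have hsub (J : Finset ℕ) : (J.image lab : Set P) ⊆ Q := by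
      simpa [Set.subset_def] using fun x _ => hlab x
    have hmem {q : P} (hq : q ∈ Q) (J : Finset ℕ) :
        pg q ∈ J.image (pg ∘ lab) ↔ q ∈ J.image lab := by
      rw [← Finset.image_image, ← Finset.mem_coe, Finset.coe_image, hpg.mem_image_iff (hsub J) hq,
        Finset.mem_coe]
    obtain ⟨q, hq, hqI, h⟩ := h
    refine ⟨pg q, Finset.mem_image_of_mem pg hq, mt (hmem hq I).1 hqI,
      fun l r hI hr hqlr hcard => ih (h l r hI hr ((hmem hq _).1 hqlr) ?_)⟩
    rwa [← Finset.image_image, Finset.card_image_of_injOn (hpg.mono (hsub _))] at hcard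

variable {f k N : ℕ} {π : ℕ → Perm (Fin (f + 1))}

/-- The pages of the positions from `l` to `r` of a block path. -/
abbrev pagesOn (f k : ℕ) (π : ℕ → Perm (Fin (f + 1))) (l r : ℕ) : Finset ℕ :=
  (Finset.Icc l r).image (blockLab f k π)

lemma pagesOn_mono {l r l' r' : ℕ} (hl : l' ≤ l) (hr : r ≤ r') :
    pagesOn f k π l r ⊆ pagesOn f k π l' r' :=
  Finset.image_subset_image (Finset.Icc_subset_Icc hl hr)

lemma mem_pagesOn_of_lt {l r i j : ℕ} (hj : j < k) (hjf : j < f) (hl : l ≤ i * k + j)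
    (hr : i * k + j ≤ r) : entry (π i) j ∈ pagesOn f k π l r :=
  Finset.mem_image.2 ⟨i * k + j, Finset.mem_Icc.2 ⟨hl, hr⟩, blockLab_of_lt hj hjf⟩

lemma mem_pagesOn_of_separator {l r i p : ℕ} (hl : l ≤ i * k + f) (hr : (i + 1) * k ≤ r + 1)
    (hp : f < p) (hpk : p ≤ k) : p ∈ pagesOn f k π l r := by
  rw [Nat.succ_mul] at hr
  refine Finset.mem_image.2 ⟨i * k + (p - 1), Finset.mem_Icc.2 ⟨by omega, by omega⟩, ?_⟩
  rw [blockLab_of_le (by omega) (by omega)]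
  omega

lemma exists_block_of_mem_pagesOn (hk : 0 < k) {l r p : ℕ} (hp : p ≤ f)
    (h : p ∈ pagesOn f k π l r) :
    ∃ i j, j < k ∧ j < f ∧ l ≤ i * k + j ∧ i * k + j ≤ r ∧ entry (π i) j = p := by
  obtain ⟨x, hx, rfl⟩ := Finset.mem_image.1 h
  obtain ⟨i, j, hj, rfl⟩ := exists_eq_mul_add hk x
  rw [Finset.mem_Icc] at hx
  rcases lt_or_ge j f with hjf | hjf
  · exact ⟨i, j, hj, hjf, hx.1, hx.2, (blockLab_of_lt hj hjf).symm⟩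
  · rw [blockLab_of_le hj hjf] at hp
    omega

lemma Iic_subset_pagesOn_of_block (hk : 0 < k) (hfk : f ≤ k) {l r i : ℕ} (hl : l ≤ i * k)
    (hr : i * k + f ≤ r + 1) (he : entry (π i) f ∈ pagesOn f k π l r) :
    Finset.Iic k ⊆ pagesOn f k π l r := by
  intro p hp
  rw [Finset.mem_Iic] at hp
  rcases le_or_gt p f with hpf | hpf
  · obtain ⟨j, hj, rfl⟩ := exists_entry_eq (π i) hpf
    rcases hj.eq_or_lt with rfl | hj
    · exact he
    · exact mem_pagesOn_of_lt (by omega) hj (by omega) (by omega)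
  · obtain ⟨i', j, _, hjf, hlj, hjr, heq⟩ := exists_block_of_mem_pagesOn hk (entry_le (π i) f) he
    rcases lt_trichotomy i i' with hlt | rfl | hlt
    · have := Nat.mul_le_mul_right k (Nat.succ_le_of_lt hlt)
      exact mem_pagesOn_of_separator (i := i) (by omega) (by rw [← Nat.succ_eq_add_one]; omega)
        hpf hp
    · exact absurd (entry_inj hjf.le le_rfl heq) hjf.ne
    · have := Nat.mul_le_mul_right k (Nat.succ_le_of_lt hlt)
      exact mem_pagesOn_of_separator (i := i') (by omega) (by rw [← Nat.succ_eq_add_one]; omega)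
        hpf hp

lemma not_Iic_subset_of_card_le {S : Finset ℕ} (hS : S.card ≤ k) : ¬ Finset.Iic k ⊆ S := by
  intro hsub
  have := Finset.card_le_card hsub
  rw [Nat.card_Iic] at this
  omega

lemma winsPhase_of_block (hk : 0 < k) (hfk : f ≤ k) {l r i : ℕ} (hlr : l ≤ r) (hr : r < N)
    (hcard : (pagesOn f k π l r).card ≤ k) (hl : l ≤ i * k) (hir : i * k + f ≤ r + 1) :
    WinsPhase N (blockLab f k π) (Finset.Iic k) k 1 (Finset.Icc l r) := by
  refine .of_forall_mem (Finset.mem_Iic.2 ((entry_le (π i) f).trans hfk)) hlr hr hcard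
    fun l' r' hl' hr' _ he hcard' => absurd ?_ (not_Iic_subset_of_card_le hcard')
  exact Iic_subset_pagesOn_of_block hk hfk (hl'.trans hl) (by omega) he

lemma Iic_subset_pagesOn_of_corner_eq_empty (hfk : f ≤ k) {i a c l r : ℕ} (ha : a ≤ f)
    (hc1 : 1 ≤ c) (hc : c ≤ f) (hl : l ≤ i * k + a) (hr : (i + 1) * k + f ≤ r + c)
    (he : entry (π i) f ∈ pagesOn f k π l r) (hcorner : corner (π i) (π (i + 1)) a c = ∅) :
    Finset.Iic k ⊆ pagesOn f k π l r := by
  have hsucc : (i + 1) * k = i * k + k := Nat.succ_mul i k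
  intro p hp
  rw [Finset.mem_Iic] at hp
  rcases le_or_gt p f with hpf | hpf
  · lift p to Fin (f + 1) using Nat.lt_succ_of_le hpf
    have hp_notMem : p ∉ corner (π i) (π (i + 1)) a c := by simp [hcorner]
    rw [mem_corner] at hp_notMem
    have hx := ((π i)⁻¹ p).isLt
    have hentry := entry_inv (π i) p
    rcases lt_or_ge ((π i)⁻¹ p : ℕ) a with hxa | hxa
    · rw [← entry_inv (π (i + 1)) p]
      exact mem_pagesOn_of_lt (by omega) (by omega) (by omega) (by omega)
    · rcases (Nat.le_of_lt_succ hx).eq_or_lt with hxf | hxf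
      · rwa [← hentry, hxf]
      · rw [← hentry]
        exact mem_pagesOn_of_lt (by omega) (by omega) (by omega) (by omega)
  · exact mem_pagesOn_of_separator (i := i) (by omega) (by omega) hpf hp

lemma winsPhase_of_pairWin (hk : 0 < k) (hfk : f ≤ k) {i n a c l r : ℕ} (ha : a ≤ f)
    (hc1 : 1 ≤ c) (hc : c ≤ f) (hlr : l ≤ r) (hrN : r < N) (hl : l ≤ i * k + a)
    (hr : (i + 1) * k + f ≤ r + c) (hcard : (pagesOn f k π l r).card ≤ k)
    (he : entry (π i) f ∈ pagesOn f k π l r) (hwin : PairWin (π i) (π (i + 1)) n a c) :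
    WinsPhase N (blockLab f k π) (Finset.Iic k) k (n + 1) (Finset.Icc l r) := by
  have hsucc : (i + 1) * k = i * k + k := Nat.succ_mul i k
  have hcorner {a c l r : ℕ} (ha : a ≤ f) (hc1 : 1 ≤ c) (hc : c ≤ f) (hl : l ≤ i * k + a)
      (hr : (i + 1) * k + f ≤ r + c) (hcard : (pagesOn f k π l r).card ≤ k)
      (he : entry (π i) f ∈ pagesOn f k π l r) : corner (π i) (π (i + 1)) a c ≠ ∅ := fun h =>
    not_Iic_subset_of_card_le hcard
      (Iic_subset_pagesOn_of_corner_eq_empty hfk ha hc1 hc hl hr he h)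
  induction n generalizing a c l r with
  | zero => exact absurd hwin (hcorner ha hc1 hc hl hr hcard he)
  | succ n ih =>
    obtain hempty | ⟨q, hq, hwin₁, hwin₂⟩ := hwin
    · exact absurd hempty (hcorner ha hc1 hc hl hr hcard he)
    obtain ⟨hqa, hqc⟩ := mem_corner.1 hq
    have hqf : (q : ℕ) ≤ f := Nat.le_of_lt_succ q.isLt
    refine .of_forall_mem (Finset.mem_Iic.2 (hqf.trans hfk)) hlr hrN hcard
      fun l' r' hl' hr' hrN' hq' hcard' => ?_
    have he' := pagesOn_mono hl' hr' he
    obtain ⟨i', j, hj, hjf, hlj, hjr, hentry⟩ := exists_block_of_mem_pagesOn hk hqf hq'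
    have hpos : i' < i ∨ i' = i ∨ i' = i + 1 ∨ i + 1 < i' := by omega
    rcases hpos with hlt | rfl | rfl | hgt
    · have := Nat.mul_le_mul_right k (Nat.succ_le_of_lt hlt)
      rw [Nat.succ_mul] at this
      exact absurd (Iic_subset_pagesOn_of_block hk hfk (i := i) (by omega) (by omega) he')
        (not_Iic_subset_of_card_le hcard')
    · have hjq := entry_inj hjf.le (by omega) (hentry.trans (entry_inv _ q).symm)
      exact ih (by omega) hc1 hc (by omega) hrN' (by omega) (by omega) hcard' he' hwin₁
    · have hjq := entry_inj hjf.le (by omega) (hentry.trans (entry_inv _ q).symm)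
      exact ih ha (by omega) (by omega) (by omega) hrN' (by omega) (by omega) hcard' he' hwin₂
    · have := Nat.mul_le_mul_right k (Nat.succ_le_of_lt hgt)
      rw [Nat.succ_mul] at this
      exact (winsPhase_of_block hk hfk (i := i + 1) (by omega) hrN' hcard' (by omega)
        (by omega)).of_le (by omega)

lemma winsPhase_of_two_blocks (hk : 0 < k) (hf : 1 ≤ f) (hfk : f ≤ k) {n : ℕ}
    (hpair : ∀ i, (i + 1) * k < N → PairWin (π i) (π (i + 1)) n f f) {i l r : ℕ} (hrN : r < N)
    (hl : l < i * k + f) (hr : (i + 1) * k ≤ r) (hcard : (pagesOn f k π l r).card ≤ k) :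
    WinsPhase N (blockLab f k π) (Finset.Iic k) k (n + 2) (Finset.Icc l r) := by
  have hsucc : (i + 1) * k = i * k + k := Nat.succ_mul i k
  refine .of_forall_mem (Finset.mem_Iic.2 ((entry_le (π i) f).trans hfk)) (by omega) hrN hcard
    fun l' r' hl' hr' hrN' he hcard' => ?_
  exact winsPhase_of_pairWin hk hfk le_rfl hf le_rfl (by omega) hrN' (by omega) (by omega) hcard'
    he (hpair i (by omega))

lemma winsPhase_of_one_block (hk : 0 < k) (hf : 1 ≤ f) (hfk : f ≤ k) {n : ℕ}
    (hpair : ∀ i, (i + 1) * k < N → PairWin (π i) (π (i + 1)) n f f) {i l r : ℕ} (hlr : l ≤ r)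
    (hrN : r < N) (hl : l < i * k + f) (hr : i * k ≤ r)
    (hcard : (pagesOn f k π l r).card ≤ k) :
    WinsPhase N (blockLab f k π) (Finset.Iic k) k (n + 3) (Finset.Icc l r) := by
  refine .of_forall_mem (Finset.mem_Iic.2 ((entry_le (π i) f).trans hfk)) hlr hrN hcard
    fun l' r' hl' hr' hrN' he hcard' => ?_
  obtain ⟨i', j, _, hjf, hlj, hjr, hentry⟩ := exists_block_of_mem_pagesOn hk (entry_le _ _) he
  rcases lt_trichotomy i i' with hlt | rfl | hgt
  · have := Nat.mul_le_mul_right k (Nat.succ_le_of_lt hlt)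
    exact winsPhase_of_two_blocks hk hf hfk hpair (i := i) hrN' (by omega)
      (by rw [← Nat.succ_eq_add_one]; omega) hcard'
  · exact absurd (entry_inj hjf.le le_rfl hentry) hjf.ne
  · have := Nat.mul_le_mul_right k (Nat.succ_le_of_lt hgt)
    exact winsPhase_of_two_blocks hk hf hfk hpair (i := i') hrN' (by omega)
      (by rw [← Nat.succ_eq_add_one]; omega) hcard'

lemma winsPhase_singleton (hk : 0 < k) (hf : 1 ≤ f) (hfk : f ≤ k) {n : ℕ}
    (hpair : ∀ i, (i + 1) * k < N → PairWin (π i) (π (i + 1)) n f f) {x : ℕ} (hx : x < N) :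
    WinsPhase N (blockLab f k π) (Finset.Iic k) k (n + 4) {x} := by
  rw [← Finset.Icc_self]
  refine .of_forall_mem (q := 0) (Finset.mem_Iic.2 k.zero_le) le_rfl hx
    (by simpa using Nat.succ_le_of_lt hk) fun l' r' hl' hr' hrN' h0 hcard' => ?_
  obtain ⟨i, j, _, hjf, hlj, hjr, -⟩ := exists_block_of_mem_pagesOn hk f.zero_le h0
  exact winsPhase_of_one_block hk hf hfk hpair (i := i) (by omega) hrN' (by omega) (by omega)
    hcard'

/-- The set of the first `k + 1` pages of an enumeration. -/
def pageSet {P : Type} [DecidableEq P] (pg : ℕ → P) (k : ℕ) : Finset P := (Finset.Iic k).image pg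

variable {P : Type} [DecidableEq P] {pg : ℕ → P}

lemma card_pageSet (hpg : Set.InjOn pg (Set.Iic k)) : (pageSet pg k).card = k + 1 := by
  rw [pageSet, Finset.card_image_of_injOn (by rwa [Finset.coe_Iic]), Nat.card_Iic]

lemma mem_pageSet {p : ℕ} (hp : p ≤ k) : pg p ∈ pageSet pg k :=
  Finset.mem_image_of_mem pg (Finset.mem_Iic.2 hp)

theorem detRatio_blockPath_le (hk : 0 < k) (hf : 1 ≤ f) (hfk : f + 2 ≤ k)
    (hpg : Set.InjOn pg (Set.Iic k)) {m : ℕ} (hm : m ≤ k + 1)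
    (hgood : ∀ i, i + 1 < m → Good (π i) (π (i + 1))) :
    detRatio (pathExt (m * k) fun x => pg (blockLab f k π x)) k ≤
      ((2 * (pairRank (f + 1) + 4) + 1 : ℕ) : ℝ≥0∞) := by
  have hfk' : f ≤ k := by omega
  have hle (x : ℕ) : blockLab f k π x ≤ k := blockLab_le hk hfk' x
  refine detRatio_pathExt_le_of_winsPhase hk (card_pageSet hpg) (fun x _ => mem_pageSet (hle x))
    (fun x y hxy _ h => ?_) (fun p => (card_filter_blockLab_le hk hfk' hpg m p).trans hm)
    fun x hx => ?_
  · have := add_le_of_blockLab_eq hk hf hxy (hpg (hle x) (hle y) h)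
    omega
  · refine (winsPhase_singleton hk hf hfk' (fun i hi => ?_) hx).comp (pg := pg)
      (by rwa [Finset.coe_Iic]) fun x => Finset.mem_Iic.2 (hle x)
    exact (hgood i (Nat.lt_of_mul_lt_mul_right hi)).pairWin f.le_succ f.le_succ

end BlockGame

section Reach

variable {P : Type} [DecidableEq P] {k : ℕ}

/-- With memory content `C` one can serve `σ` with `m` faults and end with memory content `C'`.
This is expressed through the request sequences that can be served afterwards. -/
def Reach (k : ℕ) (C : Finset P) (σ : List P) (m : ℕ) (C' : Finset P) : Prop :=
  ∀ τ m', Serves k C' τ m' → Serves k C (σ ++ τ) (m + m')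

lemma Reach.nil (C : Finset P) : Reach k C [] 0 C := fun τ m' h => by
  rwa [List.nil_append, zero_add]

lemma Reach.trans {C C' C'' : Finset P} {σ τ : List P} {m m' : ℕ} (h : Reach k C σ m C')
    (h' : Reach k C' τ m' C'') : Reach k C (σ ++ τ) (m + m') C'' := by
  intro ρ m'' hs
  rw [List.append_assoc, add_assoc]
  exact h _ _ (h' _ _ hs)

lemma Reach.serves {C C' : Finset P} {σ : List P} {m : ℕ} (h : Reach k C σ m C') :
    Serves k C σ m := by
  simpa using h [] 0 (.nil C')

lemma reach_singleton_of_mem {C : Finset P} (hC : C.card ≤ k) {p : P} (hp : p ∈ C) :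
    Reach k C [p] 0 C := by
  intro τ m' h
  simpa [hp] using Serves.cons C C p τ m' hp (Finset.subset_insert _ _) hC h

lemma reach_singleton_erase {Q : Finset P} (hQ : Q.card = k + 1) {p q : P} (hp : p ∈ Q)
    (hq : q ∈ Q) (hpq : p ≠ q) : Reach k (Q.erase p) [p] 1 (Q.erase q) := by
  intro τ m' h
  have hsub : Q.erase q ⊆ insert p (Q.erase p) :=
    (Finset.erase_subset q Q).trans_eq (Finset.insert_erase hp).symm
  have hcard : (Q.erase q).card ≤ k := by rw [Finset.card_erase_of_mem hq, hQ, Nat.add_sub_cancel]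
  simpa using Serves.cons _ _ p τ m' (Finset.mem_erase.2 ⟨hpq, hp⟩) hsub hcard h

/-- Evicting `e` at the first fault makes all further requests of a sequence without `e` hits. -/
lemma exists_reach_of_forall_ne {Q : Finset P} (hQ : Q.card = k + 1) {e : P} (he : e ∈ Q)
    {s : List P} (hs : ∀ p ∈ s, p ∈ Q ∧ p ≠ e) {q : P} (hq : q ∈ Q) :
    ∃ m, ∃ q' ∈ Q, Reach k (Q.erase q) s m (Q.erase q') ∧
      m + (if q' = e then 0 else 1) ≤ if q = e then 0 else 1 := by
  induction s generalizing q with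
  | nil => exact ⟨0, q, hq, .nil _, (zero_add _).le⟩
  | cons p s ih =>
    obtain ⟨⟨hpQ, hpe⟩, hs⟩ := List.forall_mem_cons.1 hs
    by_cases hpq : p = q
    · subst hpq
      obtain ⟨m, q', hq', hr, hm⟩ := ih hs he
      refine ⟨1 + m, q', hq', (reach_singleton_erase hQ hpQ he hpe).trans hr, ?_⟩
      rw [if_pos rfl] at hm
      rw [if_neg hpe]
      omega
    · obtain ⟨m, q', hq', hr, hm⟩ := ih hs hq
      have hcard : (Q.erase q).card ≤ k := by
        rw [Finset.card_erase_of_mem hq, hQ, Nat.add_sub_cancel]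
      have hhit := reach_singleton_of_mem hcard (Finset.mem_erase.2 ⟨hpq, hpQ⟩)
      exact ⟨0 + m, q', hq', hhit.trans hr, by rwa [zero_add]⟩

lemma Serves.of_subset {C D : Finset P} {σ : List P} {m : ℕ} (h : Serves k C σ m) (hD : D ⊆ C) :
    ∃ m' ≤ m + (C \ D).card, Serves k D σ m' := by
  induction h generalizing D with
  | nil C => exact ⟨0, Nat.zero_le _, .nil D⟩
  | cons C C' p σ m hp hC hk _ ih =>
    obtain ⟨m', hm', hs⟩ := ih (D := C' ∩ insert p D) Finset.inter_subset_left
    refine ⟨_, ?_, .cons D (C' ∩ insert p D) p σ m' (by simp [hp]) Finset.inter_subset_right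
      ((Finset.card_le_card Finset.inter_subset_left).trans hk) hs⟩
    have hsub : C' \ (C' ∩ insert p D) ⊆ (C \ D).erase p := by
      intro x hx
      have := @hC x
      simp only [Finset.mem_sdiff, Finset.mem_inter, Finset.mem_insert, Finset.mem_erase] at *
      tauto
    have hcard := Finset.card_le_card hsub
    have hle := Finset.card_erase_le (s := C \ D) (a := p)
    by_cases hpD : p ∈ D
    · simp only [hpD, hD hpD, if_true]
      omega
    · by_cases hpC : p ∈ C
      · have := Finset.card_erase_add_one (Finset.mem_sdiff.2 ⟨hpC, hpD⟩)
        simp only [hpD, hpC, if_true, if_false]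
        omega
      · simp only [hpD, hpC, if_false]
        omega

end Reach

section Sweep

open Equiv

/-- The position to which the sweeping walk on a block path goes back from `t` before it visits
`t + 1` for the first time: the beginning of the separator before the cell of `t` or, if `t` is the
last position of its cell, the last position of the block in this cell. -/
def backTo (f k t : ℕ) : ℕ := if k ∣ t + 1 then t + f - k else t / k * k + f - k

/-- The walk on a path from `t` back to `y` and forth to `t` again. -/
def backAndForth (y t : ℕ) : List ℕ :=
  (List.range' y (t + 1 - y)).reverse ++ List.range' (y + 1) (t - y)

/-- The walk that repeatedly goes back over recent positions, up to its first visit of `t`. -/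
def sweep (f k : ℕ) : ℕ → List ℕ
  | 0 => [0]
  | t + 1 => sweep f k t ++ (backAndForth (backTo f k t) t ++ [t + 1])

lemma mem_backAndForth {y t v : ℕ} (h : y ≤ t) : v ∈ backAndForth y t ↔ y ≤ v ∧ v ≤ t := by
  simp only [backAndForth, List.mem_append, List.mem_reverse, List.mem_range'_1]
  omega

lemma head?_backAndForth {y t : ℕ} (h : y ≤ t) : (backAndForth y t).head? = some t := by
  obtain ⟨n, rfl⟩ := Nat.exists_eq_add_of_le h
  rw [backAndForth, show y + n + 1 - y = n + 1 by omega, List.range'_concat]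
  simp

lemma isChain_range'_near (a n : ℕ) : (List.range' a n).IsChain Near :=
  (List.isChain_range' a n 1).imp fun u v h => by
    rw [Near]
    omega

lemma isChain_backAndForth_append {y t : ℕ} (h : y ≤ t) :
    (backAndForth y t ++ [t + 1]).IsChain Near := by
  obtain ⟨n, rfl⟩ := Nat.exists_eq_add_of_le h
  have hback : (List.range' y (n + 1)).reverse.IsChain Near :=
    List.isChain_reverse.2 ((isChain_range'_near _ _).imp fun u v h => And.symm h)
  have hforth : List.range' (y + 1) n ++ [y + n + 1] = List.range' (y + 1) (n + 1) := by
    rw [List.range'_concat, one_mul, add_right_comm]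
  rw [backAndForth, show y + n + 1 - y = n + 1 by omega, Nat.add_sub_cancel_left,
    List.append_assoc, hforth]
  refine List.isChain_append.2 ⟨hback, isChain_range'_near _ _, ?_⟩
  simp [List.range'_succ, Near]
  omega

variable {f k : ℕ} {π : ℕ → Perm (Fin (f + 1))}

lemma backTo_of_add_one_eq {i t : ℕ} (ht : t + 1 = (i + 1) * k) :
    backTo f k t = i * k + f - 1 := by
  rw [backTo, if_pos ⟨i + 1, by rw [ht, mul_comm]⟩]
  rw [Nat.succ_mul] at ht
  omega

lemma backTo_mul_add {i j : ℕ} (hj : j + 1 < k) : backTo f k (i * k + j) = i * k + f - k := by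
  have hndvd : ¬ k ∣ i * k + j + 1 := fun h =>
    Nat.not_dvd_of_pos_of_lt j.succ_pos hj ((Nat.dvd_add_right (Nat.dvd_mul_left k i)).1 h)
  rw [backTo, if_neg hndvd, mul_add_div_of_lt (by omega)]

lemma backTo_le (hfk : f ≤ k) (t : ℕ) : backTo f k t ≤ t := by
  have := Nat.div_mul_le_self t k
  rw [backTo]
  split_ifs <;> omega

lemma le_of_mem_sweep (hfk : f ≤ k) {t v : ℕ} (hv : v ∈ sweep f k t) : v ≤ t := by
  induction t with
  | zero => exact (List.mem_singleton.1 hv).le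
  | succ t ih =>
    simp only [sweep, List.mem_append, mem_backAndForth (backTo_le hfk t),
      List.mem_singleton] at hv
    rcases hv with h | h | h
    · exact (ih h).trans t.le_succ
    · omega
    · exact h.le

lemma getLast?_sweep (t : ℕ) : (sweep f k t).getLast? = some t := by
  cases t <;> simp [sweep]

lemma isChain_sweep (hfk : f ≤ k) (t : ℕ) : (sweep f k t).IsChain Near := by
  induction t with
  | zero => exact .singleton 0
  | succ t ih =>
    rw [sweep, List.isChain_append]
    refine ⟨ih, isChain_backAndForth_append (backTo_le hfk t), ?_⟩
    simp [getLast?_sweep, head?_backAndForth (backTo_le hfk t), Near]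

lemma blockLab_ne_entry_last (hk : 0 < k) (x : ℕ) : blockLab f k π x ≠ entry (π (x / k)) f := by
  obtain ⟨i, j, hj, rfl⟩ := exists_eq_mul_add hk x
  rw [mul_add_div_of_lt hj]
  rcases lt_or_ge j f with hjf | hjf
  · rw [blockLab_of_lt hj hjf]
    exact fun h => hjf.ne (entry_inj hjf.le le_rfl h)
  · rw [blockLab_of_le hj hjf]
    have := entry_le (π i) f
    omega

lemma blockLab_ne_entry_last_of_backTo_le (hk : 0 < k) (hf : 1 ≤ f) {t x : ℕ}
    (hx : backTo f k t ≤ x) (hxt : x ≤ t) : blockLab f k π x ≠ entry (π (t / k)) f := by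
  obtain ⟨i, j, hj, rfl⟩ := exists_eq_mul_add hk t
  rw [mul_add_div_of_lt hj]
  rcases le_or_gt (i * k) x with hix | hix
  · have hdiv : x / k = i := Nat.div_eq_of_lt_le hix (by rw [Nat.succ_mul]; omega)
    simpa only [hdiv] using blockLab_ne_entry_last (π := π) hk x
  · have hj' : j + 1 < k := by
      by_contra! hkj
      rw [backTo_of_add_one_eq (i := i) (by rw [Nat.succ_mul]; omega)] at hx
      omega
    rw [backTo_mul_add hj'] at hx
    obtain ⟨i, rfl⟩ : ∃ i', i = i' + 1 := Nat.exists_eq_succ_of_ne_zero (by rintro rfl; omega)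
    rw [Nat.succ_mul] at hx hix
    obtain ⟨j', rfl⟩ := Nat.exists_eq_add_of_le (show i * k ≤ x by omega)
    rw [blockLab_of_le (by omega) (by omega)]
    have := entry_le (π (i + 1)) f
    omega

variable {P : Type} {pg : ℕ → P}

/-- The requests of the sweeping walk on the block path, up to its first visit of `t`. -/
def sweepReq (pg : ℕ → P) (f k : ℕ) (π : ℕ → Perm (Fin (f + 1))) (t : ℕ) : List P :=
  (sweep f k t).map fun x => pg (blockLab f k π x)

/-- The requests of the sweeping walk between the first visits of `t` and `t + 1`. -/
def backReq (pg : ℕ → P) (f k : ℕ) (π : ℕ → Perm (Fin (f + 1))) (t : ℕ) : List P :=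
  (backAndForth (backTo f k t) t).map fun x => pg (blockLab f k π x)

lemma sweepReq_succ (t : ℕ) : sweepReq pg f k π (t + 1) =
    sweepReq pg f k π t ++ (backReq pg f k π t ++ [pg (blockLab f k π (t + 1))]) := by
  simp [sweepReq, backReq, sweep]

lemma sweepReq_ne_nil (t : ℕ) : sweepReq pg f k π t ≠ [] := by
  cases t <;> simp [sweepReq, sweep]

lemma sweepReq_prefix_of_le {s t : ℕ} (h : s ≤ t) :
    sweepReq pg f k π s <+: sweepReq pg f k π t := by
  induction h with
  | refl => exact List.prefix_rfl
  | step _ ih =>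
    rw [sweepReq_succ]
    exact ih.trans (List.prefix_append _ _)

lemma sweepReq_mem_requests (hfk : f ≤ k) {t N : ℕ} (ht : t < N) :
    sweepReq pg f k π t ∈ (pathExt N fun x => pg (blockLab f k π x)).requests :=
  mem_requests_pathExt.2 ⟨sweep f k t, fun _ hv => (le_of_mem_sweep hfk hv).trans_lt ht,
    isChain_sweep hfk t, rfl⟩

lemma mem_backReq (hfk : f ≤ k) {t : ℕ} {p : P} :
    p ∈ backReq pg f k π t ↔ ∃ x, backTo f k t ≤ x ∧ x ≤ t ∧ pg (blockLab f k π x) = p := by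
  simp [backReq, mem_backAndForth (backTo_le hfk t), and_assoc]

variable [DecidableEq P]

/-- In the `i`-th cell the last entry of `π i` may be missing from the memory, so that one fault per
cell suffices. -/
lemma exists_reach_sweepReq (hk : 0 < k) (hf : 1 ≤ f) (hfk : f ≤ k)
    (hpg : Set.InjOn pg (Set.Iic k)) (t : ℕ) :
    ∃ m, ∃ q ∈ pageSet pg k, Reach k ((pageSet pg k).erase (pg (entry (π 0) f)))
        (sweepReq pg f k π t) m ((pageSet pg k).erase q) ∧
      m + (if q = pg (entry (π (t / k)) f) then 0 else 1) ≤ t / k := by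
  have hQ : (pageSet pg k).card = k + 1 := card_pageSet hpg
  have hentry (i : ℕ) : entry (π i) f ≤ k := (entry_le _ _).trans hfk
  have hlab (x : ℕ) : blockLab f k π x ≤ k := blockLab_le hk hfk x
  have havoid (x i : ℕ) (h : blockLab f k π x ≠ entry (π i) f) :
      pg (blockLab f k π x) ∈ pageSet pg k ∧ pg (blockLab f k π x) ≠ pg (entry (π i) f) :=
    ⟨mem_pageSet (hlab x), hpg.ne (hlab x) (hentry i) h⟩
  have hvisit (x : ℕ) : ∀ p ∈ [pg (blockLab f k π x)],
      p ∈ pageSet pg k ∧ p ≠ pg (entry (π (x / k)) f) := by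
    simpa using havoid x _ (blockLab_ne_entry_last hk x)
  induction t with
  | zero =>
    obtain ⟨m, q, hq, hr, hm⟩ := exists_reach_of_forall_ne hQ (mem_pageSet (hentry _)) (hvisit 0)
      (mem_pageSet (hentry 0))
    exact ⟨m, q, hq, hr, by simpa using hm⟩
  | succ t ih =>
    obtain ⟨m, q, hq, hr, hm⟩ := ih
    obtain ⟨m₁, q₁, hq₁, hr₁, hm₁⟩ := exists_reach_of_forall_ne (s := backReq pg f k π t) hQ
      (mem_pageSet (hentry (t / k))) (fun p hp => by
        obtain ⟨x, hx, hxt, rfl⟩ := (mem_backReq hfk).1 hp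
        exact havoid x _ (blockLab_ne_entry_last_of_backTo_le hk hf hx hxt)) hq
    obtain ⟨m₂, q₂, hq₂, hr₂, hm₂⟩ := exists_reach_of_forall_ne hQ
      (mem_pageSet (hentry ((t + 1) / k))) (hvisit (t + 1)) hq₁
    refine ⟨m + (m₁ + m₂), q₂, hq₂, sweepReq_succ t ▸ hr.trans (hr₁.trans hr₂), ?_⟩
    rcases (Nat.div_le_div_right t.le_succ : t / k ≤ (t + 1) / k).eq_or_lt with hdiv | hdiv
    · rw [← hdiv] at hm₂ ⊢
      omega
    · have : (if q₁ = pg (entry (π ((t + 1) / k)) f) then 0 else 1) ≤ 1 := by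
        split_ifs <;> simp
      omega

lemma opt_sweepReq_le (hk : 0 < k) (hf : 1 ≤ f) (hfk : f ≤ k) (hpg : Set.InjOn pg (Set.Iic k))
    (t : ℕ) : opt k (sweepReq pg f k π t) ≤ k + t / k := by
  obtain ⟨m, q, -, hr, hm⟩ := exists_reach_sweepReq (π := π) hk hf hfk hpg t
  obtain ⟨m', hm', hs⟩ := hr.serves.of_subset (Finset.empty_subset _)
  rw [Finset.sdiff_empty, Finset.card_erase_of_mem (mem_pageSet ((entry_le _ _).trans hfk)),
    card_pageSet hpg] at hm'
  have := opt_le_of_serves hs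
  omega

lemma backTo_le_of_lt (hf : 1 ≤ f) (hfk : f ≤ k) {t i j : ℕ} (hjf : j < f)
    (ht : t + 1 = (i + 1) * k + j) :
    backTo f k t ≤ i * k + f ∧ (j = 0 → backTo f k t ≤ i * k + (f - 1)) := by
  cases j with
  | zero =>
    rw [backTo_of_add_one_eq ht]
    omega
  | succ j =>
    obtain rfl : t = (i + 1) * k + j := by omega
    rw [backTo_mul_add (by omega), Nat.succ_mul]
    omega

lemma mem_backReq_or_exists_entry_eq (hf : 1 ≤ f) (hfk : f ≤ k) {t i j : ℕ} (hjf : j < f)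
    (ht : t + 1 = (i + 1) * k + j) {q : P} (hq : q ∈ pageSet pg k) :
    q ∈ backReq pg f k π t ∨ ∃ j' : Fin (f + 1), j ≤ j' ∧
      (j = 0 → entry (π (i + 1)) j' ≠ entry (π i) (f - 1)) ∧
      pg (entry (π (i + 1)) j') = q := by
  obtain ⟨p, hp, rfl⟩ := Finset.mem_image.1 hq
  rw [Finset.mem_Iic] at hp
  obtain ⟨hback, hback₀⟩ := backTo_le_of_lt hf hfk hjf ht
  have hcell : (i + 1) * k = i * k + k := Nat.succ_mul i k
  rw [or_iff_not_imp_left, mem_backReq hfk]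
  intro hmem
  have hne (x : ℕ) (hx : backTo f k t ≤ x) (hxt : x ≤ t) : blockLab f k π x ≠ p :=
    fun h => hmem ⟨x, hx, hxt, congrArg pg h⟩
  have hpf : p ≤ f := by
    by_contra! hfp
    refine hne (i * k + (p - 1)) (by omega) (by omega) ?_
    rw [blockLab_of_le (by omega) (by omega), Nat.sub_add_cancel (by omega)]
  obtain ⟨j', hj', rfl⟩ := exists_entry_eq (π (i + 1)) hpf
  refine ⟨⟨j', Nat.lt_succ_of_le hj'⟩, ?_, fun hj₀ => ?_, rfl⟩
  · by_contra! hlt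
    dsimp only at hlt
    exact hne ((i + 1) * k + j') (by omega) (by omega) (blockLab_of_lt (by omega) (by omega))
  · have := hne (i * k + (f - 1)) (hback₀ hj₀) (by omega)
    rw [blockLab_of_lt (by omega) (by omega)] at this
    exact this.symm

end Sweep

section LowerBounds

open Equiv

variable {P : Type} {pg : ℕ → P} {f k : ℕ} {π π' : ℕ → Perm (Fin (f + 1))}

lemma sweepReq_congr (hfk : f ≤ k) {t : ℕ} (h : ∀ x ≤ t, blockLab f k π x = blockLab f k π' x) :
    sweepReq pg f k π t = sweepReq pg f k π' t :=
  List.map_congr_left fun x hx => by rw [h x (le_of_mem_sweep hfk hx)]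

lemma backReq_congr (hfk : f ≤ k) {t : ℕ} (h : ∀ x ≤ t, blockLab f k π x = blockLab f k π' x) :
    backReq pg f k π t = backReq pg f k π' t :=
  List.map_congr_left fun x hx => by
    rw [h x ((mem_backAndForth (backTo_le hfk t)).1 hx).2]

lemma blockLab_congr {i x : ℕ} (h : ∀ l < i, π l = π' l) (hx : x < i * k) :
    blockLab f k π x = blockLab f k π' x := by
  rw [blockLab, blockLab, h _ (Nat.div_lt_of_lt_mul (by rwa [mul_comm]))]

lemma entry_mul_swap (σ : Perm (Fin (f + 1))) (a b : Fin (f + 1)) :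
    entry (σ * swap a b) a = entry σ b := by
  rw [entry_val, entry_val, Perm.mul_apply, swap_apply_left]

lemma entry_mul_swap_of_lt (σ : Perm (Fin (f + 1))) {j : ℕ} {a b : Fin (f + 1)}
    (ha : j < a) (hb : j < b) : entry (σ * swap a b) j = entry σ j := by
  lift j to Fin (f + 1) using ha.trans a.isLt
  rw [entry_val, entry_val, Perm.mul_apply,
    swap_apply_of_ne_of_ne (Fin.val_fin_lt.1 ha).ne (Fin.val_fin_lt.1 hb).ne]

/-- The blocks `π` with the entries `a` and `b` of the `i`-th permutation exchanged. For `a ≤ b`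
this keeps the block path before the `a`-th position of the `i`-th cell. -/
def swapAt (π : ℕ → Perm (Fin (f + 1))) (i : ℕ) (a b : Fin (f + 1)) : ℕ → Perm (Fin (f + 1)) :=
  Function.update π i (π i * swap a b)

lemma swapAt_update (i : ℕ) (σ : Perm (Fin (f + 1))) (a b : Fin (f + 1)) :
    swapAt (Function.update π i σ) i a b = Function.update π i (σ * swap a b) := by
  rw [swapAt, Function.update_self, Function.update_idem]

lemma swapAt_self (i : ℕ) (a b : Fin (f + 1)) : swapAt π i a b i = π i * swap a b :=
  Function.update_self ..

lemma swapAt_of_ne {i l : ℕ} (h : l ≠ i) (a b : Fin (f + 1)) : swapAt π i a b l = π l :=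
  Function.update_of_ne h ..

lemma blockLab_swapAt (hfk : f ≤ k) {i x : ℕ} {a b : Fin (f + 1)} (hab : a ≤ b)
    (hx : x < i * k + a) : blockLab f k (swapAt π i a b) x = blockLab f k π x := by
  rcases lt_or_ge x (i * k) with hxi | hxi
  · exact blockLab_congr (fun l hl => swapAt_of_ne hl.ne a b) hxi
  · obtain ⟨j, rfl⟩ := Nat.exists_eq_add_of_le hxi
    have hj : j < a := Nat.lt_of_add_lt_add_left hx
    have := a.isLt
    rw [blockLab_of_lt (by omega) (by omega), blockLab_of_lt (by omega) (by omega), swapAt_self,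
      entry_mul_swap_of_lt _ hj (hj.trans_le hab)]

lemma sweepReq_swapAt (hfk : f ≤ k) {i t : ℕ} {a b : Fin (f + 1)} (hab : a ≤ b)
    (ht : t + 1 = i * k + a) : sweepReq pg f k (swapAt π i a b) t = sweepReq pg f k π t :=
  sweepReq_congr hfk fun _ hx => blockLab_swapAt hfk hab (by omega)

lemma sweepReq_swapAt_succ (hfk : f ≤ k) {i t : ℕ} {a b : Fin (f + 1)} (ha : (a : ℕ) < f)
    (hab : a ≤ b) (ht : t + 1 = i * k + a) : sweepReq pg f k (swapAt π i a b) (t + 1) =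
      sweepReq pg f k π t ++ (backReq pg f k π t ++ [pg (entry (π i) b)]) := by
  rw [sweepReq_succ, sweepReq_swapAt hfk hab ht,
    backReq_congr hfk fun _ hx => blockLab_swapAt hfk hab (by omega), ht,
    blockLab_of_lt (by omega) ha, swapAt_self, entry_mul_swap]

variable [DecidableEq P]

lemma exists_swapAt_faults_lt (hf : 1 ≤ f) (hfk : f ≤ k) (hpg : Set.InjOn pg (Set.Iic k))
    (π : ℕ → Perm (Fin (f + 1))) (a : DetAlg P k) {t i : ℕ} {j : Fin (f + 1)} (hj : (j : ℕ) < f)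
    (ht : t + 1 = (i + 1) * k + j) :
    ∃ j', j ≤ j' ∧ ((j : ℕ) = 0 → entry (π (i + 1)) j' ≠ entry (π i) (f - 1)) ∧
      a.faults (sweepReq pg f k π t) <
        a.faults (sweepReq pg f k (swapAt π (i + 1) j j') (t + 1)) := by
  classical
  set R : Finset (Fin (f + 1)) := Finset.univ.filter fun j' =>
    j ≤ j' ∧ ((j : ℕ) = 0 → entry (π (i + 1)) j' ≠ entry (π i) (f - 1)) with hR
  have hcover : ∀ q ∈ pageSet pg k, q ∈ backReq pg f k π t ∨
      q ∈ R.image fun j' : Fin (f + 1) => pg (entry (π (i + 1)) j') := by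
    intro q hq
    refine (mem_backReq_or_exists_entry_eq hf hfk hj ht hq).imp_right ?_
    rintro ⟨j', hjj', hne, rfl⟩
    exact Finset.mem_image_of_mem _ (Finset.mem_filter.2 ⟨Finset.mem_univ _, hjj', hne⟩)
  have hne : R.Nonempty := by
    by_contra! hemp
    have hlast (j' : Fin (f + 1)) (hjj' : j ≤ j') :
        (j : ℕ) = 0 ∧ entry (π (i + 1)) j' = entry (π i) (f - 1) := by
      by_contra! h
      exact Finset.notMem_empty j' (hemp ▸ Finset.mem_filter.2 ⟨Finset.mem_univ _, hjj', h⟩)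
    have hj₀ := hlast j le_rfl
    have heq := hj₀.2.trans (hlast (Fin.last f) (Fin.le_last j)).2.symm
    have := entry_inj hj.le le_rfl heq
    omega
  obtain ⟨p, hp, hlt⟩ := a.exists_faults_lt (sweepReq pg f k π t) (backReq pg f k π t)
    ((card_pageSet hpg).symm ▸ k.lt_succ_self) (hne.image _) hcover
  obtain ⟨j', hj', rfl⟩ := Finset.mem_image.1 hp
  simp only [hR, Finset.mem_filter, Finset.mem_univ, true_and] at hj'
  exact ⟨j', hj'.1, hj'.2, by rwa [sweepReq_swapAt_succ hfk hj hj'.1 ht]⟩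

lemma exists_det_block (hf : 1 ≤ f) (hfk : f ≤ k) (hpg : Set.InjOn pg (Set.Iic k))
    (a : DetAlg P k) (π : ℕ → Perm (Fin (f + 1))) {i t j : ℕ} (ht : t + 1 = (i + 1) * k)
    (hj : j ≤ f) :
    ∃ π' : ℕ → Perm (Fin (f + 1)), (∀ l ≤ i, π' l = π l) ∧
      (j ≠ 0 → entry (π' (i + 1)) 0 ≠ entry (π i) (f - 1)) ∧
      a.faults (sweepReq pg f k π t) + j ≤ a.faults (sweepReq pg f k π' (t + j)) := by
  induction j with
  | zero => exact ⟨π, fun _ _ => rfl, fun h => absurd rfl h, le_rfl⟩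
  | succ j ih =>
    obtain ⟨π', hπ', hne, hfaults⟩ := ih (by omega)
    obtain ⟨J, rfl⟩ : ∃ J : Fin (f + 1), (J : ℕ) = j := ⟨⟨j, by omega⟩, rfl⟩
    obtain ⟨j', hjj', hne', hlt⟩ := exists_swapAt_faults_lt (t := t + J) (i := i) hf hfk hpg π' a
      (Nat.lt_of_succ_le hj) (by omega)
    refine ⟨swapAt π' (i + 1) J j', fun l hl => ?_, fun _ => ?_, ?_⟩
    · rw [swapAt_of_ne (by omega), hπ' l hl]
    · rw [swapAt_self]
      rcases Nat.eq_zero_or_pos J with hJ | hJ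
      · have hentry := entry_mul_swap (π' (i + 1)) J j'
        rw [hJ] at hentry
        rw [hentry, ← hπ' i le_rfl]
        exact hne' hJ
      · rw [entry_mul_swap_of_lt _ hJ (hJ.trans_le hjj')]
        exact hne hJ.ne'
    · rw [← add_assoc t]
      omega

lemma exists_det_blocks (hk : 0 < k) (hf : 1 ≤ f) (hfk : f ≤ k) (hpg : Set.InjOn pg (Set.Iic k))
    (a : DetAlg P k) (m : ℕ) :
    ∃ π : ℕ → Perm (Fin (f + 1)), (∀ i < m, entry (π i) (f - 1) ≠ entry (π (i + 1)) 0) ∧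
      f * m ≤ a.faults (sweepReq pg f k π ((m + 1) * k - 1)) := by
  induction m with
  | zero => exact ⟨fun _ => 1, by simp, by simp⟩
  | succ m ih =>
    obtain ⟨π, hne, hfaults⟩ := ih
    have hpos : 0 < (m + 1) * k := by positivity
    obtain ⟨π', hπ', hne', hfaults'⟩ := exists_det_block hf hfk hpg a π (i := m)
      (Nat.sub_add_cancel hpos) le_rfl
    have hcell : (m + 1 + 1) * k = (m + 1) * k + k := Nat.succ_mul _ k
    refine ⟨π', fun i hi => ?_, ?_⟩
    · rcases (Nat.le_of_lt_succ hi).eq_or_lt with rfl | hlt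
      · rw [hπ' i le_rfl]
        exact (hne' (by omega)).symm
      · rw [hπ' i (by omega), hπ' (i + 1) (by omega)]
        exact hne i hlt
    · obtain ⟨τ, hτ⟩ := sweepReq_prefix_of_le (pg := pg) (f := f) (k := k) (π := π')
        (show (m + 1) * k - 1 + f ≤ (m + 1 + 1) * k - 1 by omega)
      have := a.faults_le_append (sweepReq pg f k π' ((m + 1) * k - 1 + f)) τ
      rw [hτ] at this
      rw [Nat.mul_succ]
      omega

/-- The probability of a fault of the random strategy `μ` between the first visits of `t` and
`t + 1`. -/
noncomputable def faultProb (μ : RandAlg P k) (pg : ℕ → P) (f : ℕ) (π : ℕ → Perm (Fin (f + 1)))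
    (t : ℕ) : ℝ :=
  (μ : Measure (DetAlg P k)).real
    {a | a.faults (sweepReq pg f k π t) < a.faults (sweepReq pg f k π (t + 1))}

lemma randCost_add_sum_faultProb_le (μ : RandAlg P k) (t j : ℕ) :
    randCost μ (sweepReq pg f k π t) +
      ENNReal.ofReal (∑ r ∈ Finset.range j, faultProb μ pg f π (t + r)) ≤
      randCost μ (sweepReq pg f k π (t + j)) := by
  induction j with
  | zero => simp
  | succ j ih =>
    have hnonneg (r : ℕ) : 0 ≤ faultProb μ pg f π (t + r) := measureReal_nonneg
    rw [Finset.sum_range_succ, ENNReal.ofReal_add (Finset.sum_nonneg fun r _ => hnonneg r)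
      (hnonneg j), ← add_assoc]
    refine (add_le_add_left ih _).trans ?_
    rw [faultProb, ofReal_measureReal, ← add_assoc t j 1, sweepReq_succ (t + j)]
    exact randCost_add_measure_faults_lt_le μ _ _

lemma one_le_sum_faultProb_swapAt (hf : 1 ≤ f) (hfk : f ≤ k) (hpg : Set.InjOn pg (Set.Iic k))
    (μ : RandAlg P k) (π : ℕ → Perm (Fin (f + 1))) {t i : ℕ} {j : Fin (f + 1)} (hj : (j : ℕ) < f)
    (ht : t + 1 = (i + 1) * k + j) :
    1 ≤ ∑ j' ∈ Finset.Ici j, faultProb μ pg f (swapAt π (i + 1) j j') t := by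
  set E : Fin (f + 1) → Set (DetAlg P k) := fun j' =>
    {a | a.faults (sweepReq pg f k π t) <
      a.faults (sweepReq pg f k (swapAt π (i + 1) j j') (t + 1))}
  have hE : ∀ j' ∈ Finset.Ici j, faultProb μ pg f (swapAt π (i + 1) j j') t =
      (μ : Measure (DetAlg P k)).real (E j') := fun j' hj' => by
    rw [faultProb, sweepReq_swapAt hfk (Finset.mem_Ici.1 hj') ht]
  have hcover : ⋃ j' ∈ Finset.Ici j, E j' = Set.univ := by
    refine Set.eq_univ_of_forall fun a => ?_
    obtain ⟨j', hjj', -, hlt⟩ := exists_swapAt_faults_lt hf hfk hpg π a hj ht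
    exact Set.mem_biUnion (Finset.mem_coe.2 (Finset.mem_Ici.2 hjj')) hlt
  rw [Finset.sum_congr rfl hE, ← probReal_univ (μ := (μ : Measure (DetAlg P k))), ← hcover]
  exact measureReal_biUnion_finset_le _ _

/-- Averaging over the exchanges of the `j`-th entry with a later one: they permute the
permutations. -/
lemma factorial_mul_inv_le_sum_faultProb (hf : 1 ≤ f) (hfk : f ≤ k)
    (hpg : Set.InjOn pg (Set.Iic k)) (μ : RandAlg P k) (π : ℕ → Perm (Fin (f + 1))) {t i j : ℕ}
    (hj : j < f) (ht : t + 1 = (i + 1) * k + j) :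
    ((f + 1).factorial : ℝ) * ((f + 1 - j : ℕ) : ℝ)⁻¹ ≤
      ∑ σ : Perm (Fin (f + 1)), faultProb μ pg f (Function.update π (i + 1) σ) t := by
  lift j to Fin (f + 1) using hj.trans f.lt_succ_self
  set S := ∑ σ : Perm (Fin (f + 1)), faultProb μ pg f (Function.update π (i + 1) σ) t
  have hswap (j' : Fin (f + 1)) : ∑ σ : Perm (Fin (f + 1)),
      faultProb μ pg f (Function.update π (i + 1) (σ * swap j j')) t = S :=
    Equiv.sum_comp (Equiv.mulRight (swap j j') : Perm (Fin (f + 1)) ≃ Perm (Fin (f + 1)))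
      fun σ => faultProb μ pg f (Function.update π (i + 1) σ) t
  have hsum : ((f + 1).factorial : ℝ) ≤ ((f + 1 - j : ℕ) : ℝ) * S :=
    calc ((f + 1).factorial : ℝ) = ∑ _σ : Perm (Fin (f + 1)), (1 : ℝ) := by
          simp [Fintype.card_perm]
      _ ≤ ∑ σ : Perm (Fin (f + 1)), ∑ j' ∈ Finset.Ici j,
            faultProb μ pg f (Function.update π (i + 1) (σ * swap j j')) t :=
          Finset.sum_le_sum fun σ _ => by
            simpa only [swapAt_update] using
              one_le_sum_faultProb_swapAt hf hfk hpg μ (Function.update π (i + 1) σ) hj ht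
      _ = ((f + 1 - j : ℕ) : ℝ) * S := by
          rw [Finset.sum_comm, Finset.sum_congr rfl fun j' _ => hswap j', Finset.sum_const,
            Fin.card_Ici, nsmul_eq_mul]
  have hpos : (0 : ℝ) < ((f + 1 - j : ℕ) : ℝ) := by exact_mod_cast (by omega : 0 < f + 1 - j)
  rwa [← div_eq_mul_inv, div_le_iff₀' hpos]

lemma sum_range_inv_eq_harmonic_sub_one (f : ℕ) :
    ∑ j ∈ Finset.range f, ((f + 1 - j : ℕ) : ℝ)⁻¹ = (harmonic (f + 1) : ℝ) - 1 := by
  rw [harmonic, Finset.sum_range_succ', ← Finset.sum_range_reflect]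
  push_cast
  rw [inv_one, add_sub_cancel_right]
  refine Finset.sum_congr rfl fun j hj => ?_
  have hj := Finset.mem_range.1 hj
  rw [show f + 1 - (f - 1 - j) = j + 1 + 1 by omega]
  push_cast
  rfl

lemma exists_good_le {n : ℕ} (hn : 3 ≤ n) (α : Perm (Fin n)) {V : Perm (Fin n) → ℝ} {c : ℝ}
    (hc : 0 ≤ c) (hV : ∀ σ, V σ < n) (hsum : n.factorial * (c + 1) ≤ ∑ σ, V σ) :
    ∃ σ, Good α σ ∧ c ≤ V σ := by
  classical
  by_contra! hlt
  refine hsum.not_gt ?_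
  calc ∑ σ, V σ < ∑ σ, (c + if ¬ Good α σ then (n : ℝ) else 0) :=
        Finset.sum_lt_sum_of_nonempty Finset.univ_nonempty fun σ _ => by
          by_cases hσ : Good α σ
          · simpa [hσ] using hlt σ hσ
          · simpa [hσ] using (hV σ).trans_le (le_add_of_nonneg_left hc)
    _ = n.factorial * c + n * (Finset.univ.filter fun σ => ¬ Good α σ).card := by
        rw [Finset.sum_add_distrib, ← Finset.sum_filter, Finset.sum_const, Finset.sum_const,
          Finset.card_univ, Fintype.card_perm, Fintype.card_fin, nsmul_eq_mul, nsmul_eq_mul,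
          mul_comm (n : ℝ)]
    _ ≤ n.factorial * (c + 1) := by
        rw [mul_add, mul_one]
        exact add_le_add_right (mul_card_filter_not_good_le hn α) _

lemma exists_rand_block (hf : 2 ≤ f) (hfk : f ≤ k) (hpg : Set.InjOn pg (Set.Iic k))
    (hH : 2 ≤ (harmonic (f + 1) : ℝ)) (μ : RandAlg P k) (π : ℕ → Perm (Fin (f + 1))) {i t : ℕ}
    (ht : t + 1 = (i + 1) * k) :
    ∃ σ : Perm (Fin (f + 1)), Good (π i) σ ∧
      randCost μ (sweepReq pg f k π t) + ENNReal.ofReal ((harmonic (f + 1) : ℝ) - 2) ≤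
        randCost μ (sweepReq pg f k (Function.update π (i + 1) σ) (t + f)) := by
  set V : Perm (Fin (f + 1)) → ℝ := fun σ =>
    ∑ j ∈ Finset.range f, faultProb μ pg f (Function.update π (i + 1) σ) (t + j)
  have hV (σ : Perm (Fin (f + 1))) : V σ < (f + 1 : ℕ) := by
    refine (Finset.sum_le_card_nsmul _ _ 1 fun j _ => measureReal_le_one).trans_lt ?_
    simp
  have hsum : ((f + 1).factorial : ℝ) * ((harmonic (f + 1) : ℝ) - 2 + 1) ≤ ∑ σ, V σ := by
    rw [show (harmonic (f + 1) : ℝ) - 2 + 1 = harmonic (f + 1) - 1 by ring, Finset.sum_comm,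
      ← sum_range_inv_eq_harmonic_sub_one, Finset.mul_sum]
    refine Finset.sum_le_sum fun j hj => ?_
    exact factorial_mul_inv_le_sum_faultProb (by omega) hfk hpg μ π (Finset.mem_range.1 hj)
      (by omega)
  obtain ⟨σ, hgood, hle⟩ := exists_good_le (by omega) (π i) (sub_nonneg.2 hH) hV hsum
  have hcongr : sweepReq pg f k π t = sweepReq pg f k (Function.update π (i + 1) σ) t :=
    sweepReq_congr hfk fun x hx => blockLab_congr
      (fun l hl => (Function.update_of_ne hl.ne _ _).symm) (by omega)
  refine ⟨σ, hgood, hcongr ▸ ?_⟩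
  exact (add_le_add_right (ENNReal.ofReal_le_ofReal hle) _).trans
    (randCost_add_sum_faultProb_le μ t f)

lemma exists_rand_blocks (hk : 0 < k) (hf : 2 ≤ f) (hfk : f ≤ k) (hpg : Set.InjOn pg (Set.Iic k))
    (hH : 2 ≤ (harmonic (f + 1) : ℝ)) (μ : RandAlg P k) (m : ℕ) :
    ∃ π : ℕ → Perm (Fin (f + 1)), (∀ i < m, Good (π i) (π (i + 1))) ∧
      m * ENNReal.ofReal ((harmonic (f + 1) : ℝ) - 2) ≤
        randCost μ (sweepReq pg f k π ((m + 1) * k - 1)) := by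
  induction m with
  | zero => exact ⟨fun _ => 1, by simp, by simp⟩
  | succ m ih =>
    obtain ⟨π, hgood, hcost⟩ := ih
    have hpos : 0 < (m + 1) * k := by positivity
    obtain ⟨σ, hσ, hcost'⟩ := exists_rand_block hf hfk hpg hH μ π (Nat.sub_add_cancel hpos)
    have hcell : (m + 1 + 1) * k = (m + 1) * k + k := Nat.succ_mul _ k
    refine ⟨Function.update π (m + 1) σ, fun i hi => ?_, ?_⟩
    · rcases (Nat.le_of_lt_succ hi).eq_or_lt with rfl | hlt
      · rwa [Function.update_self, Function.update_of_ne (by omega)]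
      · rw [Function.update_of_ne (by omega), Function.update_of_ne (by omega)]
        exact hgood i hlt
    · obtain ⟨τ, hτ⟩ := sweepReq_prefix_of_le (pg := pg) (f := f) (k := k)
        (π := Function.update π (m + 1) σ)
        (show (m + 1) * k - 1 + f ≤ (m + 1 + 1) * k - 1 by omega)
      rw [← hτ, Nat.cast_succ, add_mul, one_mul]
      exact (add_le_add_left hcost _).trans <| hcost'.trans <|
        le_self_add.trans (randCost_add_measure_faults_lt_le μ _ τ)

end LowerBounds

section Estimates

open Real

lemma natLog_two_add_two_le {k m d : ℕ} (hk : 2 ≤ k) (hm : m ≤ k ^ d) :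
    ((Nat.log 2 m + 2 : ℕ) : ℝ) ≤ (2 * d + 4) * log k := by
  have hlog2 : 1 / 2 < log 2 := by linarith [log_two_gt_d9]
  have hlogk : log 2 ≤ log k := log_le_log two_pos (by exact_mod_cast hk)
  have hpow : (2 : ℝ) ^ Nat.log 2 m ≤ (k : ℝ) ^ d := by
    exact_mod_cast (Nat.pow_le_pow_right two_pos (Nat.log_mono_right hm)).trans
      (Nat.pow_log_le_self 2 (by positivity))
  have hmul : Nat.log 2 m * log 2 ≤ d * log k := by
    simpa only [log_pow] using log_le_log (by positivity) hpow
  have hhalf : (Nat.log 2 m : ℝ) * (1 / 2) ≤ Nat.log 2 m * log 2 := by gcongr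
  push_cast
  linarith

lemma clog_two_mul_log_two_le {m : ℕ} (hm : m ≠ 0) :
    Nat.clog 2 m * log 2 ≤ log m + log 2 := by
  have hlog2 := log_pos one_lt_two
  have hlogb : 0 ≤ logb 2 m :=
    logb_nonneg one_lt_two (by exact_mod_cast Nat.one_le_iff_ne_zero.2 hm)
  have hceil : (Nat.clog 2 m : ℝ) ≤ logb 2 m + 1 := by
    have := natCeil_logb_natCast 2 m
    push_cast at this
    exact this ▸ (Nat.ceil_lt_add_one hlogb).le
  calc Nat.clog 2 m * log 2 ≤ (logb 2 m + 1) * log 2 := by gcongr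
    _ = log m + log 2 := by rw [add_mul, logb, div_mul_cancel₀ _ hlog2.ne', one_mul]

lemma four_le_log {f : ℕ} (hf : 64 ≤ f) : 4 ≤ log f := by
  have := le_log_of_pow_le (n := 6) two_pos (show (2 : ℝ) ^ 6 ≤ f by norm_num; exact_mod_cast hf)
  push_cast at this
  linarith [log_two_gt_d9]

lemma one_le_log_log {f : ℕ} (hf : 64 ≤ f) : 1 ≤ log (log f) := by
  have := le_log_of_pow_le (n := 2) two_pos (show (2 : ℝ) ^ 2 ≤ log f by
    norm_num; exact four_le_log hf)
  push_cast at this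
  linarith [log_two_gt_d9]

lemma two_mul_pairRank_add_le {f : ℕ} (hf : 64 ≤ f) :
    ((2 * (pairRank f + 4) + 1 : ℕ) : ℝ) ≤ 50 * log (log f) := by
  have hlog2 := log_two_gt_d9
  have hlog2' := log_two_lt_d9
  have hlogf := four_le_log hf
  have hloglog := one_le_log_log hf
  have hpos : 0 < Nat.clog 2 f := Nat.clog_pos one_lt_two (by omega)
  have hclog : (Nat.clog 2 f : ℝ) ≤ 2 ^ 2 * log f := by
    nlinarith [clog_two_mul_log_two_le (show f ≠ 0 by omega)]
  have hlogclog : log (Nat.clog 2 f) ≤ 2 * log 2 + log (log f) := by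
    refine (log_le_log (by exact_mod_cast hpos) hclog).trans_eq ?_
    rw [log_mul (by norm_num) (by positivity), log_pow]
    norm_num
  have hclogclog : (Nat.clog 2 (Nat.clog 2 f) : ℝ) ≤ 6 * log (log f) := by
    nlinarith [clog_two_mul_log_two_le hpos.ne']
  rw [pairRank]
  push_cast
  linarith

lemma one_le_log_sub_log_add_log_log {f k : ℕ} (hf : 0 < f) (hfk : f < k) :
    1 ≤ 100 * (log k - log f + log (log f)) := by
  have hlog2 := log_two_gt_d9
  have hlog32 := one_sub_inv_le_log_of_pos (show (0 : ℝ) < 3 / 2 by norm_num)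
  rw [log_div (by norm_num) (by norm_num)] at hlog32
  norm_num at hlog32
  have hmono : log f ≤ log k := log_le_log (by exact_mod_cast hf) (by exact_mod_cast hfk.le)
  obtain rfl | rfl | hf3 : f = 1 ∨ f = 2 ∨ 3 ≤ f := by omega
  · have : log 2 ≤ log k := log_le_log two_pos (by exact_mod_cast hfk)
    simp only [Nat.cast_one, log_one, log_zero]
    linarith
  · have hlogk : log 3 ≤ log k := log_le_log three_pos (by exact_mod_cast hfk)
    have hprod := one_sub_inv_le_log_of_pos (show (0 : ℝ) < 3 / 2 * log 2 by positivity)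
    rw [log_mul (by norm_num) (by positivity), log_div (by norm_num) (by norm_num)] at hprod
    have hinv : (3 / 2 * log 2)⁻¹ ≤ (1.03 : ℝ)⁻¹ := inv_anti₀ (by norm_num) (by linarith)
    norm_num at hinv hprod ⊢
    linarith
  · have hlogf : log 3 ≤ log f := log_le_log three_pos (by exact_mod_cast hf3)
    have hloglog := one_sub_inv_le_log_of_pos (show (0 : ℝ) < log f by linarith)
    have hinv : (log f)⁻¹ ≤ (1.02 : ℝ)⁻¹ := inv_anti₀ (by norm_num) (by linarith)
    norm_num at hinv
    linarith

lemma log_le_five {f : ℕ} (hf : f < 64) : log f ≤ 5 := by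
  rcases f.eq_zero_or_pos with rfl | hpos
  · simp
  have : log f ≤ log ((2 : ℝ) ^ 6) :=
    log_le_log (by exact_mod_cast hpos) (by norm_num; exact_mod_cast hf.le)
  rw [log_pow] at this
  push_cast at this
  linarith [log_two_lt_d9]

lemma log_le_harmonic (f : ℕ) : log f ≤ (harmonic f : ℝ) := by
  rcases f.eq_zero_or_pos with rfl | hpos
  · simp
  exact (log_le_log (by exact_mod_cast hpos) (by exact_mod_cast f.le_succ)).trans
    (log_add_one_le_harmonic f)

end Estimates

section OnePage

variable {P : Type} [DecidableEq P] {k : ℕ}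

/-- The strategy that keeps only the last requested page. -/
def lastPage (hk : 0 < k) : DetAlg P k where
  cache σ := σ.getLast?.toFinset
  cache_nil := rfl
  card_le σ := by
    cases σ.getLast? with
    | none => exact Nat.zero_le k
    | some p => exact hk
  mem_cache σ p := by simp
  cache_subset σ p := by simp

lemma faults_lastPage_replicate_le (hk : 0 < k) (p : P) (m : ℕ) :
    (lastPage hk).faults (List.replicate m p) ≤ 1 := by
  induction m with
  | zero => simp
  | succ m ih =>
    rw [List.replicate_succ', DetAlg.faults_append_singleton]
    rcases m.eq_zero_or_pos with rfl | hm
    · simp only [List.replicate_zero, DetAlg.faults_nil]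
      split_ifs <;> simp
    · rwa [if_pos (by simp [lastPage, List.getLast?_replicate, hm.ne'])]

lemma detRatio_le_one_of_label_eq (hk : 0 < k) {G : ExtGraph P} {p : P}
    (hG : ∀ v, G.label v = p) : detRatio G k ≤ 1 := by
  refine iInf_le_of_le (lastPage hk) (sInf_le ?_)
  rintro _ ⟨vs, -, rfl⟩
  rw [one_mul, detCost, Nat.cast_le]
  rcases eq_or_ne vs [] with rfl | hvs
  · simp
  · have hrepl : vs.map G.label = List.replicate (vs.map G.label).length p :=
      List.eq_replicate_of_mem (by simp [hG])
    rw [hrepl]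
    exact (faults_lastPage_replicate_le hk p _).trans
      (Nat.one_le_iff_ne_zero.2 (opt_ne_zero hk (by simpa using hvs)))

lemma opt_singleton_le (hk : 0 < k) (p : P) : opt k [p] ≤ 1 :=
  opt_le_of_serves (.cons ∅ {p} p [] 0 (by simp) (by simp) hk (.nil _))

lemma randCost_singleton (μ : RandAlg P k) (p : P) : randCost μ [p] = 1 := by
  have hfaults (a : DetAlg P k) : a.faults [p] = 1 := by
    simpa [a.cache_nil] using a.faults_append_singleton [] p
  simp [randCost, hfaults]

lemma one_le_ratio_randCost (hk : 0 < k) {G : ExtGraph P} (v : G.V) (μ : RandAlg P k) :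
    1 ≤ ratio G k (randCost μ) := by
  refine le_ratio (σ := [G.label v]) ⟨[v], .singleton v, rfl⟩ (opt_ne_zero hk (by simp)) ?_
  rw [randCost_singleton, one_mul]
  exact_mod_cast opt_singleton_le hk _

end OnePage

section Construction

variable {P : Type} {n k f m : ℕ} {pg : ℕ → P} {π : ℕ → Equiv.Perm (Fin (f + 1))}

lemma le_Delta_blockPath (hk : 0 < k) (hfk : f ≤ k) (hpg : Set.InjOn pg (Set.Iic k)) {d N : ℕ}
    (h : ∀ x y, x < y → y < N → blockLab f k π x = blockLab f k π y → x + d ≤ y) :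
    (d : ℕ∞) ≤ (pathExt N fun x => pg (blockLab f k π x)).Delta :=
  le_Delta_pathExt fun x y hxy hy hxy' =>
    h x y hxy hy (hpg (blockLab_le hk hfk x) (blockLab_le hk hfk y) hxy')

lemma sweepReq_mul_sub_one_mem_requests (hk : 0 < k) (hfk : f ≤ k) (m : ℕ) :
    sweepReq pg f k π ((m + 1) * k - 1) ∈
      (pathExt ((m + 1) * k) fun x => pg (blockLab f k π x)).requests :=
  sweepReq_mem_requests hfk (Nat.sub_one_lt (by positivity))

variable [DecidableEq P]

lemma le_ratio_blockPath (hk : 0 < k) (hf : 1 ≤ f) (hfk : f ≤ k)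
    (hpg : Set.InjOn pg (Set.Iic k)) {cost : List P → ℝ≥0∞} {c : ℝ≥0∞}
    (h : c * (k + m : ℕ) ≤ cost (sweepReq pg f k π ((m + 1) * k - 1))) :
    c ≤ ratio (pathExt ((m + 1) * k) fun x => pg (blockLab f k π x)) k cost := by
  refine le_ratio (sweepReq_mul_sub_one_mem_requests hk hfk m)
    (opt_ne_zero hk (sweepReq_ne_nil _)) (le_trans ?_ h)
  have hdiv : ((m + 1) * k - 1) / k ≤ m :=
    Nat.le_of_lt_succ (Nat.div_lt_of_lt_mul (mul_comm k _ ▸ Nat.sub_one_lt (by positivity)))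
  gcongr
  exact (opt_sweepReq_le hk hf hfk hpg _).trans (Nat.add_le_add_left hdiv k)

lemma detRatio_blockPath_le_log (hk : 2 ≤ k) (hfk : f ≤ k) (hpg : Set.InjOn pg (Set.Iic k))
    (hm : m ≤ k ^ 2) :
    detRatio (pathExt (m * k) fun x => pg (blockLab f k π x)) k ≤
      ENNReal.ofReal (100 * Real.log k) := by
  have hk' : 0 < k := by omega
  refine (detRatio_pathExt_le hk' (card_pageSet hpg)
    fun x _ => mem_pageSet (blockLab_le hk' hfk x)).trans ?_
  rw [← ENNReal.ofReal_natCast]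
  have hpow : (k + 1) ^ 3 * (m * k) ≤ k ^ 9 :=
    calc (k + 1) ^ 3 * (m * k) ≤ (k ^ 2) ^ 3 * (k ^ 2 * k) := by
          gcongr
          nlinarith
      _ = k ^ 9 := by ring
  refine ENNReal.ofReal_le_ofReal ((natLog_two_add_two_le hk hpow).trans ?_)
  gcongr
  norm_num

/-- Pages for block paths with `k + 1 ≤ n` pages: the numbers below `n`, extended periodically. -/
def page (hn : 0 < n) (i : ℕ) : Fin n := ⟨i % n, Nat.mod_lt _ hn⟩

lemma injOn_page (hn : 0 < n) : Set.InjOn (page hn) (Set.Iio n) := by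
  intro i hi j hj h
  simpa [page, Nat.mod_eq_of_lt hi, Nat.mod_eq_of_lt hj] using congrArg Fin.val h

lemma injOn_page_Iic (hkn : k < n) : Set.InjOn (page (k.zero_le.trans_lt hkn)) (Set.Iic k) :=
  (injOn_page _).mono fun _ hi => lt_of_le_of_lt hi hkn

/-- Cells with `f + 1` exchanged entries are used: this gains the term `k` by which `OPT` may exceed
the number `f * k` of cells. -/
theorem exists_det_graph (hf : 0 < f) (hfk : f < k) (hkn : k < n)
    (A : ExtGraph (Fin n) → DetAlg (Fin n) k) (hA : TrulyOnline A) :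
    ∃ G : ExtGraph (Fin n), ((k - f + 1 : ℕ) : ℕ∞) ≤ G.Delta ∧
      (f : ℝ≥0∞) ≤ ratio G k (detCost (A G)) ∧
      detRatio G k ≤ ENNReal.ofReal (100 * Real.log k) := by
  have hk : 0 < k := by omega
  have hpg := injOn_page_Iic hkn
  set pg := page (k.zero_le.trans_lt hkn)
  obtain ⟨π, hne, hfaults⟩ := exists_det_blocks hk (Nat.le_add_left 1 f) hfk hpg
    (A (completeExtGraph (Fin n))) (f * k)
  refine ⟨pathExt ((f * k + 1) * k) fun x => pg (blockLab (f + 1) k π x), ?_, ?_, ?_⟩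
  · refine le_Delta_blockPath hk hfk hpg fun x y hxy hy h => ?_
    have := add_lt_of_blockLab_eq hk (by omega) hfk hxy hy (fun i hi => hne i (by omega)) h
    omega
  · refine le_ratio_blockPath hk (by omega) hfk hpg ?_
    rw [hA.detCost_eq (sweepReq_mul_sub_one_mem_requests hk hfk _)
      (mem_requests_completeExtGraph _), detCost]
    have hmul : f * (k + f * k) = (f + 1) * (f * k) := by ring
    exact_mod_cast hmul.trans_le hfaults
  · exact detRatio_blockPath_le_log (by omega) hfk hpg (by nlinarith)

theorem exists_rand_graph_of_le (hf : 64 ≤ f) (hfk : f < k) (hkn : k < n)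
    (A : ExtGraph (Fin n) → RandAlg (Fin n) k) (hA : RandTrulyOnline A) :
    ∃ G : ExtGraph (Fin n), ((k - f - 1 : ℕ) : ℕ∞) ≤ G.Delta ∧
      ENNReal.ofReal (1 / 5 * Real.log f) ≤ ratio G k (randCost (A G)) ∧
      oblRatio G k ≤ ENNReal.ofReal (50 * Real.log (Real.log f)) := by
  have hk : 0 < k := by omega
  have hpg := injOn_page_Iic hkn
  have hlog := four_le_log hf
  have hharm : 2 * (1 / 5 * Real.log f) ≤ (harmonic f : ℝ) - 2 := by
    linarith [log_le_harmonic f]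
  have hrank := two_mul_pairRank_add_le hf
  set pg := page (k.zero_le.trans_lt hkn)
  obtain ⟨g, rfl⟩ : ∃ g, f = g + 1 := ⟨f - 1, by omega⟩
  have hgk : g ≤ k := by omega
  obtain ⟨π, hgood, hcost⟩ := exists_rand_blocks hk (by omega) hgk hpg (by linarith)
    (A (completeExtGraph (Fin n))) k
  refine ⟨pathExt ((k + 1) * k) fun x => pg (blockLab g k π x), ?_, ?_, ?_⟩
  · refine le_Delta_blockPath hk hgk hpg fun x y hxy _ h => ?_
    have := add_le_of_blockLab_eq hk (by omega) hxy h
    omega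
  · refine le_ratio_blockPath hk (by omega) hgk hpg ?_
    rw [hA.randCost_eq (sweepReq_mul_sub_one_mem_requests hk hgk _)
      (mem_requests_completeExtGraph _)]
    refine le_trans ?_ hcost
    rw [← ENNReal.ofReal_natCast, ← ENNReal.ofReal_natCast, mul_comm,
      ← ENNReal.ofReal_mul (by positivity), ← ENNReal.ofReal_mul (by positivity)]
    refine ENNReal.ofReal_le_ofReal ?_
    calc _ = (k : ℝ) * (2 * (1 / 5 * Real.log (g + 1 : ℕ))) := by push_cast; ring
      _ ≤ _ := by gcongr
  · refine (oblRatio_le_detRatio _ _).trans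
      ((detRatio_blockPath_le hk (by omega) (by omega) hpg le_rfl
        fun i hi => hgood i (by omega)).trans ?_)
    rw [← ENNReal.ofReal_natCast]
    exact ENNReal.ofReal_le_ofReal hrank

/-- For `f < 64` the lower bound is at most `1`, hence a graph with a single vertex suffices. -/
theorem exists_rand_graph (hf : 0 < f) (hfk : f < k) (hkn : k < n)
    (A : ExtGraph (Fin n) → RandAlg (Fin n) k) (hA : RandTrulyOnline A) :
    ∃ G : ExtGraph (Fin n), ((k - f - 1 : ℕ) : ℕ∞) ≤ G.Delta ∧
      ENNReal.ofReal (1 / 5 * Real.log f) ≤ ratio G k (randCost (A G)) ∧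
      oblRatio G k ≤
        ENNReal.ofReal (100 * (Real.log k - Real.log f + Real.log (Real.log f))) := by
  rcases le_or_gt 64 f with h64 | h64
  · obtain ⟨G, hΔ, hlower, hupper⟩ := exists_rand_graph_of_le h64 hfk hkn A hA
    refine ⟨G, hΔ, hlower, hupper.trans (ENNReal.ofReal_le_ofReal ?_)⟩
    have hloglog := one_le_log_log h64
    have hmono : Real.log f ≤ Real.log k :=
      Real.log_le_log (by exact_mod_cast hf) (by exact_mod_cast hfk.le)
    linarith
  · have hk : 0 < k := by omega
    refine ⟨pathExt 1 fun _ => page (k.zero_le.trans_lt hkn) 0,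
      le_Delta_pathExt fun x y hxy hy _ => by omega, ?_, ?_⟩
    · refine le_trans ?_ (one_le_ratio_randCost hk (0 : Fin 1) _)
      rw [ENNReal.ofReal_le_one]
      linarith [log_le_five h64]
    · refine (oblRatio_le_detRatio _ _).trans
        ((detRatio_le_one_of_label_eq hk fun _ => rfl).trans ?_)
      rw [ENNReal.one_le_ofReal]
      exact one_le_log_sub_log_add_log_log hf hfk

end Construction

section Asymptotics

lemma mul_le_ofReal_of_le {B : ℝ≥0} {r : ℝ≥0∞} {x y : ℝ} (hr : r ≤ ENNReal.ofReal x)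
    (h : B * x ≤ y) : B * r ≤ ENNReal.ofReal y :=
  calc B * r ≤ B * ENNReal.ofReal x := by gcongr
    _ = ENNReal.ofReal (B * x) := by
        rw [ENNReal.ofReal_mul B.coe_nonneg, ENNReal.ofReal_coe_nnreal]
    _ ≤ ENNReal.ofReal y := ENNReal.ofReal_le_ofReal h

lemma le_mul_add_of_ofReal_le {x y : ℝ} {b₁ b₂ : ℝ≥0} {r : ℝ≥0∞} (hy : 0 ≤ y)
    (h : ENNReal.ofReal x ≤ b₁ * r + b₂) (hr : r ≤ ENNReal.ofReal y) : x ≤ b₁ * y + b₂ := by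
  refine (ENNReal.ofReal_le_ofReal_iff (by positivity)).1 (h.trans ?_)
  rw [ENNReal.ofReal_add (by positivity) b₂.coe_nonneg, ENNReal.ofReal_coe_nnreal]
  gcongr
  exact mul_le_ofReal_of_le hr le_rfl

lemma exists_det_graph_family {f : ℕ → ℕ}
    (hf : (fun k : ℕ => Real.log k) =o[atTop] (fun k : ℕ => (f k : ℝ)))
    (A : DetUniform) (hA : ∀ n k hk, TrulyOnline (A n k hk)) :
    ∃ G : ∀ _ n : ℕ, ExtGraph (Fin n),
      (∀ (k n : ℕ) (hk : 0 < k), 0 < f k → f k < k → k < n →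
        ((k - f k + 1 : ℕ) : ℕ∞) ≤ (G k n).Delta ∧
        (f k : ℝ≥0∞) ≤ ratio (G k n) k (detCost (A n k hk (G k n))) ∧
        detRatio (G k n) k ≤ ENNReal.ofReal (100 * Real.log k)) ∧
      ∀ B : ℝ≥0, ∀ᶠ k : ℕ in atTop, ∀ (hk : 0 < k) (n : ℕ), f k < k → k < n →
        B * detRatio (G k n) k ≤ ratio (G k n) k (detCost (A n k hk (G k n))) := by
  have (n : ℕ) : Nonempty (ExtGraph (Fin n)) := ⟨completeExtGraph (Fin n)⟩
  choose! G hG using fun k n (hk : 0 < k) (hfk₀ : 0 < f k) (hfk : f k < k) (hkn : k < n) =>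
    exists_det_graph hfk₀ hfk hkn (A n k hk) (hA n k hk)
  refine ⟨G, hG, fun B => ?_⟩
  have hlog : (fun k : ℕ => B * (100 * Real.log k)) =o[atTop] fun k : ℕ => (f k : ℝ) :=
    (hf.const_mul_left 100).const_mul_left B
  filter_upwards [hlog.def one_pos, hf.def one_pos, eventually_gt_atTop 1]
    with k hB hle hk₁ hk n hfk hkn
  rw [one_mul, RCLike.norm_natCast] at hB hle
  have hpos : (0 : ℝ) < f k :=
    (Real.log_pos (by exact_mod_cast hk₁)).trans_le ((Real.le_norm_self _).trans hle)
  obtain ⟨-, hlower, hupper⟩ := hG k n hk (by exact_mod_cast hpos) hfk hkn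
  rw [← ENNReal.ofReal_natCast] at hlower
  exact (mul_le_ofReal_of_le hupper ((Real.le_norm_self _).trans hB)).trans hlower

lemma eventually_mul_log_sub_log_le {f : ℕ → ℕ}
    (hf : Tendsto (fun k : ℕ => Real.log (f k) / Real.log k) atTop (nhds 1)) (b : ℝ) :
    ∀ᶠ k : ℕ in atTop, 0 < f k ∧
      b * (Real.log k - Real.log (f k) + Real.log (Real.log (f k))) ≤ Real.log (f k) := by
  have hequiv : (fun k : ℕ => Real.log (f k)) ~[atTop] fun k : ℕ => Real.log k :=
    isEquivalent_of_tendsto_one hf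
  have hlogf : Tendsto (fun k : ℕ => Real.log (f k)) atTop atTop :=
    hequiv.symm.tendsto_atTop (Real.tendsto_log_atTop.comp tendsto_natCast_atTop_atTop)
  have hlittle := (hequiv.symm.isLittleO.add
    (Real.isLittleO_log_id_atTop.comp_tendsto hlogf)).const_mul_left b
  filter_upwards [hlittle.def one_pos, hlogf.eventually_gt_atTop 0] with k hk hpos
  refine ⟨Nat.pos_of_ne_zero fun h => by simp [h] at hpos, ?_⟩
  rw [one_mul, Real.norm_of_nonneg hpos.le] at hk
  exact (le_abs_self _).trans hk

lemma exists_rand_graph_family {f : ℕ → ℕ}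
    (hf : Tendsto (fun k : ℕ => Real.log (f k) / Real.log k) atTop (nhds 1))
    (A : RandUniform) (hA : ∀ n k hk, RandTrulyOnline (A n k hk)) :
    ∃ G : ∀ _ n : ℕ, ExtGraph (Fin n),
      (∀ (k n : ℕ) (hk : 0 < k), 0 < f k → f k < k → k < n →
        ((k - f k - 1 : ℕ) : ℕ∞) ≤ (G k n).Delta ∧
        ENNReal.ofReal (1 / 5 * Real.log (f k)) ≤
          ratio (G k n) k (randCost (A n k hk (G k n))) ∧
        oblRatio (G k n) k ≤ ENNReal.ofReal
          (100 * (Real.log k - Real.log (f k) + Real.log (Real.log (f k))))) ∧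
      ∀ B : ℝ≥0, ∀ᶠ k : ℕ in atTop, ∀ (hk : 0 < k) (n : ℕ), f k < k → k < n →
        B * oblRatio (G k n) k ≤ ratio (G k n) k (randCost (A n k hk (G k n))) := by
  have (n : ℕ) : Nonempty (ExtGraph (Fin n)) := ⟨completeExtGraph (Fin n)⟩
  choose! G hG using fun k n (hk : 0 < k) (hfk₀ : 0 < f k) (hfk : f k < k) (hkn : k < n) =>
    exists_rand_graph hfk₀ hfk hkn (A n k hk) (hA n k hk)
  refine ⟨G, hG, fun B => ?_⟩
  filter_upwards [eventually_mul_log_sub_log_le hf (500 * B)]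
    with k ⟨hpos, hle⟩ hk n hfk hkn
  obtain ⟨-, hlower, hupper⟩ := hG k n hk hpos hfk hkn
  exact (mul_le_ofReal_of_le hupper (by linarith)).trans hlower

lemma eventually_mul_log_add_lt (a b : ℝ) : ∀ᶠ x : ℝ in atTop, a * Real.log x + b < x := by
  have hlittle := (Real.isLittleO_log_id_atTop.const_mul_left a).add (isLittleO_const_id_atTop b)
  filter_upwards [hlittle.def (half_pos one_pos), eventually_gt_atTop 0] with x hx hpos
  rw [id, Real.norm_of_nonneg hpos.le] at hx
  linarith [Real.le_norm_self (a * Real.log x + b)]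

lemma isLittleO_sqrt_add_one :
    (fun k : ℕ => ((Nat.sqrt k + 1 : ℕ) : ℝ)) =o[atTop] (fun k : ℕ => (k : ℝ)) := by
  have hsqrt : Tendsto Nat.sqrt atTop atTop :=
    tendsto_atTop_atTop_of_monotone (fun _ _ => Nat.sqrt_le_sqrt) fun n => ⟨n * n, by simp⟩
  have hlin : (fun x : ℝ => x + 1) =o[atTop] fun x : ℝ => x ^ 2 := by
    simpa only [pow_one, pow_zero] using (isLittleO_pow_pow_atTop_of_lt (𝕜 := ℝ) one_lt_two).add
      (isLittleO_pow_pow_atTop_of_lt two_pos)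
  refine ((hlin.comp_tendsto (tendsto_natCast_atTop_atTop.comp hsqrt)).congr_left
    fun k => by simp).trans_le fun k => ?_
  simp only [Function.comp_apply, norm_pow, RCLike.norm_natCast]
  exact_mod_cast Nat.sqrt_le' k

lemma le_add_sqrt_mul_self {j : ℕ} {x : ℕ∞} (h : ((j * j - j - 1 : ℕ) : ℕ∞) ≤ x) :
    ((j * j : ℕ) : ℕ∞) ≤ x + (Nat.sqrt (j * j) + 1 : ℕ) := by
  rw [Nat.sqrt_eq]
  refine le_trans ?_ (add_le_add_left h _)
  exact_mod_cast (by omega : j * j ≤ (j * j - j - 1) + (j + 1))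

theorem not_veryStronglyCompetitive {𝒞 : ∀ n : ℕ, ℕ → Set (ExtGraph (Fin n))}
    (h𝒞 : ∀ (n k : ℕ) (G : ExtGraph (Fin n)),
      (k : ℕ∞) ≤ G.Delta + (Nat.sqrt k + 1 : ℕ) → G ∈ 𝒞 n k)
    (A : DetUniform) (hA : ∀ n k hk, TrulyOnline (A n k hk)) :
    ¬ VeryStronglyCompetitive A 𝒞 := by
  rintro ⟨b₁, b₂, h⟩
  obtain ⟨j, hj, hj2⟩ := ((tendsto_natCast_atTop_atTop.eventually
    (eventually_mul_log_add_lt (b₁ * 200) b₂)).and (eventually_ge_atTop 2)).exists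
  have hk : 0 < j * j := by positivity
  obtain ⟨G, hΔ, hlower, hupper⟩ := exists_det_graph (f := j) (by omega) (by nlinarith)
    (j * j).lt_succ_self (A _ _ hk) (hA _ _ _)
  have hmem : G ∈ 𝒞 (j * j + 1) (j * j) := h𝒞 _ _ _ <| le_add_sqrt_mul_self <|
    (Nat.cast_le.2 (by omega)).trans hΔ
  have hlt := hlower.trans (h _ _ hk G hmem)
  rw [← ENNReal.ofReal_natCast] at hlt
  have hle := le_mul_add_of_ofReal_le (mul_nonneg (by norm_num) (Real.log_natCast_nonneg _)) hlt
    ((detRatioInf_le_detRatio _ _).trans hupper)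
  rw [Nat.cast_mul, Real.log_mul (by positivity) (by positivity)] at hle
  linarith

theorem not_randVeryStronglyCompetitive {𝒞 : ∀ n : ℕ, ℕ → Set (ExtGraph (Fin n))}
    (h𝒞 : ∀ (n k : ℕ) (G : ExtGraph (Fin n)),
      (k : ℕ∞) ≤ G.Delta + (Nat.sqrt k + 1 : ℕ) → G ∈ 𝒞 n k)
    (A : RandUniform) (hA : ∀ n k hk, RandTrulyOnline (A n k hk)) :
    ¬ RandVeryStronglyCompetitive A 𝒞 := by
  rintro ⟨b₁, b₂, h⟩
  obtain ⟨j, hj, hj64⟩ := (((Real.tendsto_log_atTop.comp tendsto_natCast_atTop_atTop).eventually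
    (eventually_mul_log_add_lt (5 * (b₁ * 50)) (5 * b₂))).and (eventually_ge_atTop 64)).exists
  have hk : 0 < j * j := by positivity
  obtain ⟨G, hΔ, hlower, hupper⟩ := exists_rand_graph_of_le hj64 (by nlinarith)
    (j * j).lt_succ_self (A _ _ hk) (hA _ _ _)
  have hmem : G ∈ 𝒞 (j * j + 1) (j * j) := h𝒞 _ _ _ (le_add_sqrt_mul_self hΔ)
  have hle := le_mul_add_of_ofReal_le (by linarith [one_le_log_log hj64])
    (hlower.trans (h _ _ hk G hmem)) ((oblRatioInf_le_oblRatio _ _).trans hupper)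
  rw [Function.comp_apply] at hj
  linarith

end Asymptotics

end Paging

theorem mainTheorem5 :
    ∃ c C : ℝ, 0 < c ∧ 0 < C ∧
    -- (1) deterministic algorithms
    (∀ f k n : ℕ, 0 < f → f < k → k < n →
      ∀ A : Paging.ExtGraph (Fin n) → Paging.DetAlg (Fin n) k, Paging.TrulyOnline A →
      ∃ G : Paging.ExtGraph (Fin n),
        ((k - f + 1 : ℕ) : ℕ∞) ≤ G.Delta ∧
        (f : ℝ≥0∞) ≤ Paging.ratio G k (Paging.detCost (A G)) ∧
        Paging.detRatio G k ≤ ENNReal.ofReal (C * Real.log k)) ∧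
    -- (1), in particular: `f = ω(log k)`
    (∀ f : ℕ → ℕ, (fun k : ℕ => Real.log k) =o[atTop] (fun k : ℕ => (f k : ℝ)) →
      ∀ A : Paging.DetUniform, (∀ n k hk, Paging.TrulyOnline (A n k hk)) →
      ∃ G : ∀ k n : ℕ, Paging.ExtGraph (Fin n),
        (∀ (k n : ℕ) (hk : 0 < k), 0 < f k → f k < k → k < n →
          ((k - f k + 1 : ℕ) : ℕ∞) ≤ (G k n).Delta ∧
          (f k : ℝ≥0∞) ≤ Paging.ratio (G k n) k (Paging.detCost (A n k hk (G k n))) ∧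
          Paging.detRatio (G k n) k ≤ ENNReal.ofReal (C * Real.log k)) ∧
        ∀ B : ℝ≥0, ∀ᶠ k : ℕ in atTop, ∀ (hk : 0 < k) (n : ℕ), f k < k → k < n →
          B * Paging.detRatio (G k n) k ≤
            Paging.ratio (G k n) k (Paging.detCost (A n k hk (G k n)))) ∧
    -- (2) randomized algorithms (for `f = 1`, `log (log f)` is read as `0`)
    (∀ f k n : ℕ, 0 < f → f < k → k < n →
      ∀ A : Paging.ExtGraph (Fin n) → Paging.RandAlg (Fin n) k, Paging.RandTrulyOnline A →
      ∃ G : Paging.ExtGraph (Fin n),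
        ((k - f - 1 : ℕ) : ℕ∞) ≤ G.Delta ∧
        ENNReal.ofReal (c * Real.log f) ≤ Paging.ratio G k (Paging.randCost (A G)) ∧
        Paging.oblRatio G k ≤
          ENNReal.ofReal (C * (Real.log k - Real.log f + Real.log (Real.log f)))) ∧
    -- (2), in particular: `f = k ^ (1 - o(1))`
    (∀ f : ℕ → ℕ, Tendsto (fun k : ℕ => Real.log (f k) / Real.log k) atTop (nhds 1) →
      ∀ A : Paging.RandUniform, (∀ n k hk, Paging.RandTrulyOnline (A n k hk)) →
      ∃ G : ∀ k n : ℕ, Paging.ExtGraph (Fin n),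
        (∀ (k n : ℕ) (hk : 0 < k), 0 < f k → f k < k → k < n →
          ((k - f k - 1 : ℕ) : ℕ∞) ≤ (G k n).Delta ∧
          ENNReal.ofReal (c * Real.log (f k)) ≤
            Paging.ratio (G k n) k (Paging.randCost (A n k hk (G k n))) ∧
          Paging.oblRatio (G k n) k ≤ ENNReal.ofReal
            (C * (Real.log k - Real.log (f k) + Real.log (Real.log (f k))))) ∧
        ∀ B : ℝ≥0, ∀ᶠ k : ℕ in atTop, ∀ (hk : 0 < k) (n : ℕ), f k < k → k < n →
          B * Paging.oblRatio (G k n) k ≤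
            Paging.ratio (G k n) k (Paging.randCost (A n k hk (G k n)))) ∧
    -- consequence: a class of all graphs with `Δ(G) ≥ k - o(k)` is too large
    (∃ g : ℕ → ℕ, (fun k : ℕ => (g k : ℝ)) =o[atTop] (fun k : ℕ => (k : ℝ)) ∧
      ∀ 𝒞 : ∀ n : ℕ, ℕ → Set (Paging.ExtGraph (Fin n)),
        (∀ (n k : ℕ) (G : Paging.ExtGraph (Fin n)), (k : ℕ∞) ≤ G.Delta + g k → G ∈ 𝒞 n k) →
        (∀ A : Paging.DetUniform, (∀ n k hk, Paging.TrulyOnline (A n k hk)) →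
          ¬ Paging.VeryStronglyCompetitive A 𝒞) ∧
        (∀ A : Paging.RandUniform, (∀ n k hk, Paging.RandTrulyOnline (A n k hk)) →
          ¬ Paging.RandVeryStronglyCompetitive A 𝒞)) := by
  refine ⟨1 / 5, 100, by norm_num, by norm_num, ?_, ?_, ?_, ?_, ?_⟩
  · exact fun f k n hf hfk hkn A hA => Paging.exists_det_graph hf hfk hkn A hA
  · exact fun f hf A hA => Paging.exists_det_graph_family hf A hA
  · exact fun f k n hf hfk hkn A hA => Paging.exists_rand_graph hf hfk hkn A hA
  · exact fun f hf A hA => Paging.exists_rand_graph_family hf A hA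
  · exact ⟨fun k => Nat.sqrt k + 1, Paging.isLittleO_sqrt_add_one, fun 𝒞 h𝒞 =>
      ⟨fun A hA => Paging.not_veryStronglyCompetitive h𝒞 A hA,
        fun A hA => Paging.not_randVeryStronglyCompetitive h𝒞 A hA⟩⟩
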